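/- Let $p,q$ be odd primes with $p=2q+1$ and let $n=pq$. Conventions. A permutation group of degree $n$ is a group $G$ with a faithful transitive action on a set $X$ of $n$ elements; isomorphism of permutation groups means an isomorphism of groups together with a compatible bijection of the sets. Let $L/K$ be a finite separable field extension with normal closure $E$. A Hopf–Galois structure on $L/K$ is a cocommutative $K$-Hopf algebra $H$ with a $K$-linear action on $L$ making $L$ an $H$-module algebra and such that the map $L\otimes_K H\to\mathrm{End}_K(L)$, $x\otimes h\mapsto(y\mapsto x(h\cdot y))$, is bijective; structures are counted up to isomorphism of Hopf algebras compatible with the actions on $L$. Its type is the group $N$ (unique up to isomorphism) with $E\otimes_K H\cong E[N]$ as $E$-Hopf algebras. The extension $L/K$ realises the permutation group $G$ if there is an isomorphism $G\to\mathrm{Gal}(E/K)$ taking the stabiliser of a point to $\mathrm{Gal}(E/L)$; and $G$ is realised by a Hopf–Galois structure of a given type if some finite separable extension $L/K$ realising $G$ admits a Hopf–Galois structure of that type. The extension $L/K$ is almost classically Galois if $\mathrm{Gal}(E/L)$ has a normal complement in $\mathrm{Gal}(E/K)$. Write $C_m$ for the cyclic group of order $m$, $D_{2p}$ for the dihedral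 group of order $2p$, and $C_p\rtimes C_d$ for the semidirect product with respect to a faithful action. Theorem. Up to isomorphism of permutation groups there are exactly six permutation groups of degree $n$ which are realised both by a Hopf–Galois structure of cyclic type and by a Hopf–Galois structure of non-abelian type. As abstract groups they are those in the following table. Every finite separable extension $L/K$ realising one of these six permutation groups has exactly the stated numbers of Hopf–Galois structures of cyclic and of non-abelian type, and is almost classically Galois. $$\begin{array}{c|c|c} \text{Structure of } G & \#\,\text{cyclic type} & \#\,\text{non-abelian type}\\ \hline C_q\times(C_p\rtimes C_{2q}) & 1 & 2(q-1)\\ C_q\times(C_p\rtimes C_q) & 1 & 2(q-1)\\ C_p\rtimes C_{2q} & 1 & 2(q-1)\\ D_{2p}\times C_q & 1 & 2(q-1)\\ C_p\rtimes C_q & p & 2p(q-2)+2\\ C_{pq} & 1 & 2(q-1) \end{array}$$ -/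

import Mathlib

open scoped TensorProduct

universe u v w z

/-! ### Permutation groups -/

/-- `G` acting on `X` and `G'` acting on `X'` are isomorphic as permutation groups. -/
def PermGroupIso (G X G' X' : Type*) [Group G] [MulAction G X] [Group G'] [MulAction G' X'] :
    Prop :=
  ∃ (θ : G ≃* G') (e : X ≃ X'), ∀ (g : G) (x : X), e (g • x) = θ g • e x

/-! ### Hopf-Galois structures -/

/-- A Hopf-Galois structure on `L / K`: a cocommutative `K`-Hopf algebra `H` acting on `L` by
`K`-linear endomorphisms, such that `L` is an `H`-module algebra and the map
`L ⊗ H → End_K(L)`, `x ⊗ h ↦ (y ↦ x * (h • y))`, is bijective. The action of `H` is the algebra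
homomorphism `act`. -/
structure HopfGaloisStructure (K : Type u) (L : Type v) [Field K] [Field L]
    [Algebra K L] where
  /-- the underlying type of the Hopf algebra -/
  H : Type v
  [ring : Ring H]
  [hopf : HopfAlgebra K H]
  [cocomm : Coalgebra.IsCocomm K H]
  /-- the action of the Hopf algebra on `L` -/
  act : H →ₐ[K] Module.End K L
  /-- `h • (x * y) = ∑ (h₁ • x) * (h₂ • y)` -/
  act_mul : ∀ (h : H) (x y : L),
    act h (x * y) = LinearMap.mul' K L
      (TensorProduct.map (act.toLinearMap.flip x) (act.toLinearMap.flip y)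
        (Coalgebra.comul (R := K) h))
  /-- `h • k = ε(h) k` for `k` in the base field -/
  act_algebraMap : ∀ (h : H) (k : K),
    act h (algebraMap K L k) = algebraMap K L (Coalgebra.counit (R := K) h * k)
  /-- `L / K` is `H`-Galois -/
  galois : Function.Bijective
    (TensorProduct.lift
      (((LinearMap.mul K (Module.End K L)).comp (LinearMap.mul K L)).compl₂ act.toLinearMap) :
      L ⊗[K] H →ₗ[K] Module.End K L)

namespace HopfGaloisStructure

variable {K : Type u} {L : Type v} [Field K] [Field L] [Algebra K L]

attribute [instance] HopfGaloisStructure.ring HopfGaloisStructure.hopf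
  HopfGaloisStructure.cocomm

/-- Two Hopf-Galois structures on `L / K` are the same if there is an isomorphism of the Hopf
algebras that is compatible with the actions on `L`. -/
def Equivalent (S T : HopfGaloisStructure K L) : Prop :=
  ∃ f : S.H ≃ₐc[K] T.H, ∀ h : S.H, T.act (f h) = S.act h

theorem equivalent_equivalence :
    Equivalence (Equivalent : HopfGaloisStructure K L → HopfGaloisStructure K L → Prop) where
  refl S := ⟨BialgEquiv.refl K S.H, fun _ => rfl⟩
  symm := by
    rintro S T ⟨f, hf⟩
    refine ⟨f.symm, fun h => ?_⟩
    rw [← hf (f.symm h)]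
    congr 1
    exact f.toEquiv.apply_symm_apply h
  trans := by
    rintro S T U ⟨f, hf⟩ ⟨g, hg⟩
    exact ⟨f.trans g, fun h => (hg (f h)).trans (hf h)⟩

/-- The setoid of Hopf-Galois structures on `L / K` up to isomorphism. -/
def isoSetoid (K : Type u) (L : Type v) [Field K] [Field L] [Algebra K L] :
    Setoid (HopfGaloisStructure K L) :=
  ⟨Equivalent, equivalent_equivalence⟩

end HopfGaloisStructure

/-! ### The normal closure, and the types of Hopf-Galois structures -/

/-- The normal closure `E` of `L / K` inside an algebraic closure of `L`. -/
abbrev NormalClos (K : Type u) (L : Type v) [Field K] [Field L] [Algebra K L] : Type v :=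
  IntermediateField.normalClosure K L (AlgebraicClosure L)

/-- The subgroup `Gal(E / L)` of `Gal(E / K)`, where `E` is the normal closure of `L / K`. -/
noncomputable def galSubgroup (K : Type u) (L : Type v) [Field K] [Field L] [Algebra K L] :
    Subgroup (NormalClos K L ≃ₐ[K] NormalClos K L) :=
  (IsScalarTower.toAlgHom K L (NormalClos K L)).fieldRange.fixingSubgroup

/-- The Hopf-Galois structure has type `N`: after base change to the normal closure `E`, its Hopf
algebra becomes the group algebra `E[N]`. -/
def HopfGaloisStructure.IsOfType {K : Type u} {L : Type v} [Field K] [Field L]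
    [Algebra K L] (S : HopfGaloisStructure K L) (N : Type) [Group N] : Prop :=
  Nonempty ((NormalClos K L ⊗[K] S.H) ≃ₐc[NormalClos K L] MonoidAlgebra (NormalClos K L) N)

/-- The Hopf-Galois structure is of cyclic type. -/
def HopfGaloisStructure.IsOfCyclicType {K : Type u} {L : Type v} [Field K] [Field L]
    [Algebra K L] (S : HopfGaloisStructure K L) : Prop :=
  ∃ (N : Type) (_ : Group N), IsCyclic N ∧ S.IsOfType N

/-- The Hopf-Galois structure is of non-abelian type. -/
def HopfGaloisStructure.IsOfNonabelianType {K : Type u} {L : Type v} [Field K] [Field L]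
    [Algebra K L] (S : HopfGaloisStructure K L) : Prop :=
  ∃ (N : Type) (_ : Group N), (∃ a b : N, a * b ≠ b * a) ∧ S.IsOfType N

/-- The number of Hopf-Galois structures of cyclic type on `L / K`, up to isomorphism. -/
noncomputable def numCyclicType (K : Type u) (L : Type v) [Field K] [Field L]
    [Algebra K L] : ℕ :=
  Set.ncard {c : Quotient (HopfGaloisStructure.isoSetoid K L) |
    ∃ S : HopfGaloisStructure K L, S.IsOfCyclicType ∧
      Quotient.mk (HopfGaloisStructure.isoSetoid K L) S = c}

/-- The number of Hopf-Galois structures of non-abelian type on `L / K`, up to isomorphism. -/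
noncomputable def numNonabelianType (K : Type u) (L : Type v) [Field K] [Field L]
    [Algebra K L] : ℕ :=
  Set.ncard {c : Quotient (HopfGaloisStructure.isoSetoid K L) |
    ∃ S : HopfGaloisStructure K L, S.IsOfNonabelianType ∧
      Quotient.mk (HopfGaloisStructure.isoSetoid K L) S = c}

/-- `L / K` is almost classically Galois: `Gal(E / L)` has a normal complement in `Gal(E / K)`. -/
def IsAlmostClassicallyGalois (K : Type u) (L : Type v) [Field K] [Field L]
    [Algebra K L] : Prop :=
  ∃ C : Subgroup (NormalClos K L ≃ₐ[K] NormalClos K L),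
    C.Normal ∧ C.IsComplement' (galSubgroup K L)

/-! ### Realisation of permutation groups -/

/-- `L / K` realises the permutation group `G` on `X`: there is an isomorphism
`G ≃ Gal(E / K)` which takes the stabiliser of a point to `Gal(E / L)`. -/
def Realises (K : Type u) (L : Type v) [Field K] [Field L] [Algebra K L]
    (G : Type w) (X : Type z) [Group G] [MulAction G X] : Prop :=
  ∃ (x : X) (θ : G ≃* (NormalClos K L ≃ₐ[K] NormalClos K L)),
    (MulAction.stabilizer G x).map θ.toMonoidHom = galSubgroup K L

/-- The permutation group `G` on `X` is realised by a Hopf-Galois structure of cyclic type, on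
some finite separable extension `L / K` realising `G`. -/
def IsRealisedByCyclicType (G : Type w) (X : Type z) [Group G] [MulAction G X] : Prop :=
  ∃ (K : Type u) (L : Type v) (_ : Field K) (_ : Field L) (_ : Algebra K L),
    FiniteDimensional K L ∧ Algebra.IsSeparable K L ∧ Realises K L G X ∧
      ∃ S : HopfGaloisStructure K L, S.IsOfCyclicType

/-- The permutation group `G` on `X` is realised by a Hopf-Galois structure of non-abelian type,
on some finite separable extension `L / K` realising `G`. -/
def IsRealisedByNonabelianType (G : Type w) (X : Type z) [Group G] [MulAction G X] : Prop :=
  ∃ (K : Type u) (L : Type v) (_ : Field K) (_ : Field L) (_ : Algebra K L),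
    FiniteDimensional K L ∧ Algebra.IsSeparable K L ∧ Realises K L G X ∧
      ∃ S : HopfGaloisStructure K L, S.IsOfNonabelianType

/-! ### The abstract groups that occur -/

/-- The cyclic group of order `m` (for `m ≠ 0`), written multiplicatively. -/
abbrev Cyc (m : ℕ) : Type := Multiplicative (ZMod m)

/-- The units of `ZMod p` acting on the cyclic group of order `p` by multiplication. -/
def unitsToMulAut (p : ℕ) : (ZMod p)ˣ →* MulAut (Cyc p) where
  toFun u :=
    { toFun := fun x => Multiplicative.ofAdd ((u : ZMod p) * x.toAdd)
      invFun := fun x => Multiplicative.ofAdd (((u⁻¹ : (ZMod p)ˣ) : ZMod p) * x.toAdd)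
      left_inv := fun x => by simp
      right_inv := fun x => by simp
      map_mul' := fun x y => by simp [mul_add] }
  map_one' := by
    ext x
    simp
  map_mul' u v := by
    ext x
    simp [mul_assoc]

/-- `C_p ⋊ C_d` with faithful action, for a prime `p` and a divisor `d` of `p - 1`: here `C_d` is
the subgroup `{u | u ^ d = 1}` of `(ℤ/p)ˣ`, acting on `ℤ/p` by multiplication. -/
abbrev CycSemi (p d : ℕ) : Type :=
  Cyc p ⋊[(unitsToMulAut p).comp (rootsOfUnity d (ZMod p)).subtype] (rootsOfUnity d (ZMod p))

/-! The proof has a field-theoretic half and a permutation-theoretic half. Let `E` be the normal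
closure, Γ = Gal(E/K) and X the set of `K`-embeddings of `L` in `E`. By the Greither–Pareigis
correspondence, Hopf–Galois structures on `L / K` correspond to regular subgroups N of Perm(X)
normalised by Γ, and N is the type. From N one forms the fixed ring of E[N] under Γ; it acts on `L`,
which is the ring of Γ-equivariant functions X → E (`HopfGaloisStructure.ofRegular`). Conversely the
group-like elements of E ⊗ H permute X regularly, and these permutations determine the structure
(`equivalent_of_range_eq`). Hence everything depends only on the permutation group G
(`ncard_hopfGaloisStructure`). Every transitive group is realised by some extension
(`exists_realises`), so a statement about permutation groups remains.

If G normalises a cyclic regular group, X can be identified with F_p × Z/q so that this group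
consists of the translations; G is then a group of affine maps (x, j) ↦ (ax + b, dj + e). It
contains x ↦ x + 1 and some g : (x, j) ↦ (ax, j + 1). The core is `exists_eq_shearGroup`: a regular
N normalised by these two has a characteristic subgroup of order p, consisting of the maps (x +
tχ(j), j) for a character χ of Z/q with values in F_p, and solving a linear recursion over F_p for
an element of N above j ↦ j + 1 shows that N is `shearGroup χ ω` with χ or ω trivial, or a conjugate
of it by (x + lβ(j), j) where β(1) = a.

If a non-abelian N is normalised as well, a nontrivial character must be preserved by j ↦ dj, so d =
1 throughout G. Thus G is given by a subgroup B of F_p^× × Z/q. As F_p^× is cyclic of order 2q with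
q odd, B splits into a part that is trivial or {±1}, and a q-part that is everything, Z/q alone, or
the graph of a nontrivial character: six cases up to rescaling j (`exists_sixSub`).

For the counts, if `a` can be chosen not to be a nontrivial q-th root of unity, no proper conjugates
occur: one cyclic group (both characters trivial) and 2(q - 1) non-abelian ones (exactly one
trivial). The exception is C_p ⋊ C_q, where B is the graph of α. There the maps (x + lα(j), j)
centralise G, so each group is replaced by its p conjugates, except the two non-abelian groups whose
nontrivial character is α, which are fixed. -/

set_option linter.unusedSectionVars false

/-! ### Galois descent for equivariant functions -/

section Descent

variable {K E Y Z : Type*} [Field K] [Field E] [Algebra K E]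

/-- If all the twisted traces of a finite family vanish, so does the family. -/
theorem eq_zero_of_forall_sum_algEquiv_mul [FiniteDimensional K E] [IsGalois K E] (e : E)
    (h : ∀ c : E, ∑ σ : E ≃ₐ[K] E, σ (c * e) = 0) : e = 0 := by
  by_contra he
  -- If e is nonzero, c * e runs through all of E, so the trace form would vanish identically.
  have h1 : ∀ c : E, Algebra.trace K E c = 0 := fun c => by
    have := h (c * e⁻¹)
    rw [mul_assoc, inv_mul_cancel₀ he, mul_one, ← trace_eq_sum_automorphisms] at this
    exact (map_eq_zero _).1 this
  exact Algebra.trace_ne_zero K E (LinearMap.ext h1)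

/-- Equivariant functions that are linearly independent over the base field are linearly
independent over the extension. -/
theorem linearIndependent_of_equivariant [FiniteDimensional K E] [IsGalois K E]
    (a : (E ≃ₐ[K] E) → Y → Y) {ι : Type*} (f : ι → Y → E)
    (hf : ∀ i σ y, f i (a σ y) = σ (f i y)) (hl : LinearIndependent K f) :
    LinearIndependent E f := by
  rw [linearIndependent_iff'] at hl ⊢
  intro s g hg i hi
  refine eq_zero_of_forall_sum_algEquiv_mul (K := K) _ fun c => ?_
  -- Multiply the relation by c, evaluate it at a translate of y, apply σ and sum over σ:
  -- equivariance leaves the values of f untouched and turns the coefficients into traces, which lie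
  -- in K.
  have key : ∑ i ∈ s, Algebra.trace K E (c * g i) • f i = 0 := by
    funext y
    simp only [Finset.sum_apply, Pi.smul_apply, Pi.zero_apply]
    simp only [Algebra.smul_def, trace_eq_sum_automorphisms, Finset.sum_mul]
    rw [Finset.sum_comm]
    refine Finset.sum_eq_zero fun σ _ => ?_
    have h1 := congrFun hg (a σ⁻¹ y)
    simp only [Finset.sum_apply, Pi.smul_apply, Pi.zero_apply, smul_eq_mul, hf] at h1
    have h2 := congrArg σ (congrArg (c * ·) h1)
    simp only [Finset.mul_sum, map_sum, map_mul, mul_zero, map_zero] at h2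
    rw [← h2]
    refine Finset.sum_congr rfl fun j _ => ?_
    have : σ (σ⁻¹ (f j y)) = f j y := σ.apply_symm_apply _
    rw [this, map_mul, mul_assoc]
  rw [← trace_eq_sum_automorphisms, hl s _ key i hi, map_zero]

/-- Every function on a finite Galois set is a linear combination of equivariant functions. -/
theorem mem_span_equivariant [FiniteDimensional K E] [IsGalois K E] [Finite Y]
    (a : (E ≃ₐ[K] E) →* Equiv.Perm Y) (f : Y → E) :
    f ∈ Submodule.span E {g : Y → E | ∀ σ y, g (a σ y) = σ (g y)} := by
  classical
  cases nonempty_fintype Y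
  set S := Submodule.span E {g : Y → E | ∀ σ y, g (a σ y) = σ (g y)}
  -- Dedekind independence of the automorphisms says that no nonzero functional kills all vectors (σ
  -- e), so these vectors span.
  let T : Submodule E ((E ≃ₐ[K] E) → E) :=
    Submodule.span E (Set.range fun e : E => fun σ : E ≃ₐ[K] E => σ e)
  have hT : T = ⊤ := by
    by_contra hne
    obtain ⟨φ, hφ, hle⟩ := Submodule.exists_le_ker_of_lt_top T (lt_top_iff_ne_top.2 hne)
    apply hφ
    have hli := linearIndependent_toLinearMap K E E
    have hli' : LinearIndependent E
        (fun σ : E ≃ₐ[K] E => (σ : E →ₐ[K] E).toLinearMap) :=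
      hli.comp (fun σ : E ≃ₐ[K] E => (σ : E →ₐ[K] E)) AlgEquiv.coe_toAlgHom_injective
    have h0 : ∑ σ : E ≃ₐ[K] E, φ (Pi.single σ 1) • (σ : E →ₐ[K] E).toLinearMap = 0 := by
      ext e
      have h1 : φ (fun σ : E ≃ₐ[K] E => σ e) = 0 :=
        hle (Submodule.subset_span ⟨e, rfl⟩)
      rw [LinearMap.pi_apply_eq_sum_univ] at h1
      simp only [LinearMap.sum_apply, LinearMap.smul_apply, smul_eq_mul, LinearMap.zero_apply]
      rw [← h1]
      refine Finset.sum_congr rfl fun σ _ => ?_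
      have h3 : (Pi.single σ 1 : (E ≃ₐ[K] E) → E) = fun τ => if σ = τ then 1 else 0 := by
        ext τ
        simp [Pi.single_apply, eq_comm]
      rw [smul_eq_mul, mul_comm, h3]
      rfl
    have h2 := (Fintype.linearIndependent_iff.1 hli') _ h0
    refine LinearMap.pi_ext' fun σ => LinearMap.ext_ring ?_
    simpa using h2 σ
  have key : ∀ y : Y, Pi.single y (1 : E) ∈ S := by
    intro y
    -- Pushing a function on the Galois group forward along the orbit map of y makes each vector (σ
    -- e) an equivariant function, while the unit vector at the identity becomes the indicator of y.
    let Λ : ((E ≃ₐ[K] E) → E) →ₗ[E] (Y → E) :=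
      ∑ σ : E ≃ₐ[K] E, (LinearMap.proj σ : _ →ₗ[E] E).smulRight (Pi.single (a σ y) 1)
    have hΛ : ∀ v, Λ v = ∑ σ : E ≃ₐ[K] E, v σ • Pi.single (a σ y) 1 := fun v => by
      simp [Λ]
    have hmem : T ≤ S.comap Λ := by
      refine Submodule.span_le.2 ?_
      rintro _ ⟨e, rfl⟩
      refine Submodule.subset_span fun τ y' => ?_
      rw [hΛ]
      simp only [Finset.sum_apply, Pi.smul_apply, smul_eq_mul, map_sum, map_mul]
      rw [← Equiv.sum_comp (Equiv.mulLeft τ)]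
      refine Finset.sum_congr rfl fun σ _ => ?_
      simp only [Equiv.coe_mulLeft, map_mul, Pi.single_apply, Equiv.Perm.mul_apply,
        EmbeddingLike.apply_eq_iff_eq]
      congr 1
      split_ifs <;> simp
    have h1 : Λ (Pi.single 1 1) ∈ S := hmem (hT ▸ Submodule.mem_top)
    rw [hΛ, Finset.sum_eq_single 1] at h1
    · simpa using h1
    · intro σ _ hσ
      simp [hσ]
    · simp
  have : f = ∑ y, f y • Pi.single y (1 : E) := by
    ext y
    simp [Pi.single_apply]
  rw [this]
  exact Submodule.sum_mem _ fun y _ => Submodule.smul_mem _ _ (key y)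

/-- A criterion for the vanishing of an element of a tensor product. -/
theorem tensor_eq_zero {K F V W A ι Z : Type*} [Field K] [Field F] [Algebra K F] [AddCommGroup V]
    [Module K V] [AddCommMonoid W] [Module K W] [AddCommGroup A] [Module K A] [Module F A]
    (i : V → A) (b : Module.Basis ι K V)
    (hb : LinearIndependent F fun k => i (b k)) (j : Z → W →ₗ[K] F)
    (hj : ∀ w, (∀ z, j z w = 0) → w = 0) (Φ : Z → V ⊗[K] W →ₗ[K] A)
    (hΦ : ∀ z v w, Φ z (v ⊗ₜ w) = j z w • i v) (t : V ⊗[K] W) (ht : ∀ z, Φ z t = 0) :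
    t = 0 := by
  classical
  let e := TensorProduct.equivFinsuppOfBasisLeft (N := W) b
  have hsum : t = (e t).sum fun k w => b k ⊗ₜ w := by
    conv_lhs => rw [← e.symm_apply_apply t]
    rw [TensorProduct.equivFinsuppOfBasisLeft_symm_apply]
  have h0 : e t = 0 := by
    ext k
    refine hj _ fun z => ?_
    -- Expanding t along the basis b, the vanishing of Φ z t is an F-linear relation between the
    -- independent vectors i (b k), with coefficients j z (w k).
    have h1 := ht z
    rw [hsum, Finsupp.sum, map_sum] at h1
    simp only [hΦ] at h1
    by_cases hk : k ∈ (e t).support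
    · exact linearIndependent_iff'.1 hb _ _ h1 k hk
    · rw [Finsupp.notMem_support_iff.1 hk, map_zero]
  exact e.map_eq_zero_iff.1 h0

end Descent

/-! ### The fixed points of a twisted Galois action on a group algebra -/

section FixedAlgebra

open MonoidAlgebra

variable {K E M N : Type*} [Field K] [Field E] [Algebra K E] [Group M] [Group N]

/-- The semilinear action of an automorphism of the field and of the group on the group
algebra. -/
noncomputable def twist (σ : E ≃ₐ[K] E) (s : MulAut N) :
    MonoidAlgebra E N →ₐ[K] MonoidAlgebra E N :=
  (mapAlgHom N (σ : E →ₐ[K] E)).comp (mapDomainAlgHom K E s.toMonoidHom)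

theorem twist_single (σ : E ≃ₐ[K] E) (s : MulAut N) (n : N) (e : E) :
    twist σ s (single n e) = single (s n) (σ e) := by
  simp [twist]

theorem coeff_twist (σ : E ≃ₐ[K] E) (s : MulAut N) (h : MonoidAlgebra E N) (n : N) :
    (twist σ s h).coeff (s n) = σ (h.coeff n) := by
  classical
  induction h using MonoidAlgebra.induction_linear with
  | zero => simp
  | add x y hx hy => simp [hx, hy]
  | single m e =>
    rw [twist_single]
    simp only [coeff_single, Finsupp.single_apply, EmbeddingLike.apply_eq_iff_eq]
    split_ifs <;> simp

/-- The elements of the group algebra `E[N]` which are fixed by the action of the Galois group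
through `c` on `N`. -/
noncomputable def fixedAlgebra (c : (E ≃ₐ[K] E) →* MulAut N) : Subalgebra K (MonoidAlgebra E N) :=
  ⨅ σ : E ≃ₐ[K] E, AlgHom.equalizer (twist σ (c σ)) (AlgHom.id K _)

/-- Comparing coefficients turns fixedness into equivariance of the coefficient function N → E, so
the descent results for equivariant functions apply. -/
theorem mem_fixedAlgebra {c : (E ≃ₐ[K] E) →* MulAut N} {h : MonoidAlgebra E N} :
    h ∈ fixedAlgebra c ↔ ∀ σ n, h.coeff (c σ n) = σ (h.coeff n) := by
  simp only [fixedAlgebra, Algebra.mem_iInf, AlgHom.mem_equalizer, AlgHom.coe_id, id]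
  refine forall_congr' fun σ => ⟨fun hs n => ?_, fun hs => ?_⟩
  · rw [← coeff_twist, hs]
  · ext n
    obtain ⟨n, rfl⟩ := (c σ).surjective n
    rw [coeff_twist, hs]

theorem coeff_fixedAlgebra {c : (E ≃ₐ[K] E) →* MulAut N} (h : fixedAlgebra c) (σ : E ≃ₐ[K] E)
    (n : N) : h.1.coeff (c σ n) = σ (h.1.coeff n) :=
  mem_fixedAlgebra.1 h.2 σ n

theorem linearIndependent_coeff [FiniteDimensional K E] [IsGalois K E]
    {c : (E ≃ₐ[K] E) →* MulAut N} {ι : Type*} (b : Module.Basis ι K (fixedAlgebra c)) :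
    LinearIndependent E fun i => (⇑(b i).1.coeff : N → E) := by
  refine linearIndependent_of_equivariant (fun σ => c σ) _
    (fun i σ n => coeff_fixedAlgebra (b i) σ n) ?_
  let Λ : fixedAlgebra c →ₗ[K] (N → E) :=
    { toFun := fun h => h.1.coeff
      map_add' := fun _ _ => rfl
      map_smul' := fun _ _ => rfl }
  have hΛ : LinearMap.ker Λ = ⊥ := by
    rw [LinearMap.ker_eq_bot]
    intro x y hxy
    exact Subtype.ext (coeff_injective (DFunLike.coe_injective hxy))
  exact b.linearIndependent.map' Λ hΛ

/-- With `linearIndependent_coeff` this is Galois descent: a K-basis of the fixed algebra is an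
E-basis of the functions on N. -/
theorem span_coeff [FiniteDimensional K E] [IsGalois K E] [Finite N]
    {c : (E ≃ₐ[K] E) →* MulAut N} {ι : Type*} (b : Module.Basis ι K (fixedAlgebra c)) :
    ⊤ ≤ Submodule.span E (Set.range fun i => (⇑(b i).1.coeff : N → E)) := by
  intro f _
  have h1 := mem_span_equivariant (K := K) (E := E)
    ((MulAut.toPerm N).comp c) f
  refine Submodule.span_le.2 ?_ h1
  intro g hg
  have hg' : (ofCoeff (Finsupp.equivFunOnFinite.symm g) : MonoidAlgebra E N) ∈ fixedAlgebra c :=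
    mem_fixedAlgebra.2 fun σ n => hg σ n
  have h2 := b.linearCombination_repr ⟨_, hg'⟩
  have h3 : g = ∑ i ∈ (b.repr ⟨_, hg'⟩).support,
      algebraMap K E (b.repr ⟨_, hg'⟩ i) • (⇑(b i).1.coeff : N → E) := by
    funext n
    have h4 := congrArg (fun h : fixedAlgebra c => h.1.coeff n) h2
    simp only [Finsupp.linearCombination_apply, Finsupp.sum] at h4
    rw [Finset.sum_apply]
    refine Eq.trans h4.symm ?_
    simp [Algebra.smul_def]
  rw [h3]
  exact Submodule.sum_mem _ fun i _ => Submodule.smul_mem _ _ (Submodule.subset_span ⟨i, rfl⟩)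

/-! ### Tensor products inside the group algebra of a product -/

section Pair

variable {A B : Type*} [Semiring A] [Algebra K A] [Semiring B] [Algebra K B]

theorem commute_inl_inr (x : MonoidAlgebra E M) (y : MonoidAlgebra E N) :
    Commute (mapDomainAlgHom K E (MonoidHom.inl M N) x)
      (mapDomainAlgHom K E (MonoidHom.inr M N) y) := by
  induction x using MonoidAlgebra.induction_linear with
  | zero => simp
  | add x y hx hy => rw [map_add]; exact hx.add_left hy
  | single m e =>
    induction y using MonoidAlgebra.induction_linear with
    | zero => simp
    | add x y hx hy => rw [map_add]; exact hx.add_right hy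
    | single n f => simp [Commute, SemiconjBy, single_mul_single, mul_comm]

theorem coeff_inl_mul_inr (x : MonoidAlgebra E M) (y : MonoidAlgebra E N) (m : M) (n : N) :
    (mapDomainAlgHom K E (MonoidHom.inl M N) x *
      mapDomainAlgHom K E (MonoidHom.inr M N) y).coeff (m, n) = x.coeff m * y.coeff n := by
  classical
  induction x using MonoidAlgebra.induction_linear with
  | zero => simp
  | add x y hx hy => simp only [map_add, add_mul, coeff_add, Finsupp.add_apply, hx, hy]
  | single m e =>
    induction y using MonoidAlgebra.induction_linear with
    | zero => simp
    | add x y hx hy => simp only [map_add, mul_add, coeff_add, Finsupp.add_apply, hx, hy]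
    | single n f =>
      simp only [mapDomainAlgHom_apply, mapDomain_single, single_mul_single, coeff_single,
        Finsupp.single_apply, MonoidHom.inl_apply, MonoidHom.inr_apply, Prod.mk_mul_mk, mul_one,
        one_mul, Prod.mk.injEq, ite_and]
      split_ifs <;> simp

/-- The homomorphism from a tensor product to the group algebra of a product. -/
noncomputable def pairHom (f : A →ₐ[K] MonoidAlgebra E M) (g : B →ₐ[K] MonoidAlgebra E N) :
    A ⊗[K] B →ₐ[K] MonoidAlgebra E (M × N) :=
  Algebra.TensorProduct.lift ((mapDomainAlgHom K E (MonoidHom.inl M N)).comp f)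
    ((mapDomainAlgHom K E (MonoidHom.inr M N)).comp g) fun _ _ => commute_inl_inr (K := K) _ _

theorem pairHom_tmul (f : A →ₐ[K] MonoidAlgebra E M) (g : B →ₐ[K] MonoidAlgebra E N) (a : A)
    (b : B) : pairHom f g (a ⊗ₜ b) = mapDomainAlgHom K E (MonoidHom.inl M N) (f a) *
      mapDomainAlgHom K E (MonoidHom.inr M N) (g b) := rfl

theorem coeff_pairHom_tmul (f : A →ₐ[K] MonoidAlgebra E M) (g : B →ₐ[K] MonoidAlgebra E N)
    (a : A) (b : B) (m : M) (n : N) :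
    (pairHom f g (a ⊗ₜ b)).coeff (m, n) = (f a).coeff m * (g b).coeff n :=
  coeff_inl_mul_inr (K := K) _ _ _ _

/-- A coefficient of an element of the group algebra, as a linear map. -/
noncomputable def coeffLinear (n : N) : MonoidAlgebra E N →ₗ[K] E where
  toFun x := x.coeff n
  map_add' _ _ := rfl
  map_smul' _ _ := rfl

/-- The partial coefficients of an element of the group algebra of a product. -/
noncomputable def sliceLinear (n : N) : MonoidAlgebra E (M × N) →ₗ[K] (M → E) where
  toFun x := fun m => x.coeff (m, n)
  map_add' _ _ := rfl
  map_smul' _ _ := rfl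

/-- The second factor is an arbitrary injective homomorphism, so that the lemma can be iterated to
embed triple tensor products. -/
theorem pairHom_injective [FiniteDimensional K E] [IsGalois K E]
    (c : (E ≃ₐ[K] E) →* MulAut M) (g : B →ₐ[K] MonoidAlgebra E N)
    (hg : Function.Injective g) : Function.Injective (pairHom (fixedAlgebra c).val g) := by
  -- The second factor is only assumed to be a semiring, so differences are formed with the scalar
  -- -1.
  suffices key : ∀ t, pairHom (fixedAlgebra c).val g t = 0 → t = 0 by
    intro s t hst
    have h1 := key (s + (-1 : K) • t) (by rw [map_add, map_smul, hst]; simp)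
    have h2 : (-1 : K) • t + t = 0 := by
      conv_lhs => rw [← one_smul K t, smul_smul, ← add_smul]
      simp
    rw [← add_zero s, ← h2, ← add_assoc, h1, zero_add]
  intro t ht
  let b := Module.Basis.ofVectorSpace K (fixedAlgebra c)
  refine tensor_eq_zero (F := E) (A := M → E) (Z := N) (fun h => h.1.coeff) b
    (linearIndependent_coeff b) (fun n => (coeffLinear n).comp g.toLinearMap) (fun w hw => ?_)
    (fun n => (sliceLinear n).comp (pairHom (fixedAlgebra c).val g).toLinearMap)
    (fun n v w => ?_) t (fun n => ?_)
  · refine hg (Eq.trans ?_ (map_zero g).symm)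
    ext n
    exact hw n
  · funext m
    exact (coeff_pairHom_tmul _ _ _ _ _ _).trans (mul_comm _ _)
  · funext m
    exact congrArg (fun x => x.coeff (m, n)) ht

/-- Expand F in its first variable along a basis of equivariant functions. By uniqueness the
coefficients are equivariant functions of the second variable, hence come from the second fixed
algebra. -/
theorem exists_pairHom_eq [FiniteDimensional K E] [IsGalois K E] [Finite M] [Finite N]
    (c : (E ≃ₐ[K] E) →* MulAut M) (d : (E ≃ₐ[K] E) →* MulAut N)
    (F : MonoidAlgebra E (M × N))
    (hF : ∀ σ m n, F.coeff (c σ m, d σ n) = σ (F.coeff (m, n))) :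
    ∃ t, pairHom (fixedAlgebra c).val (fixedAlgebra d).val t = F := by
  classical
  let b := Module.Basis.ofVectorSpace K (fixedAlgebra c)
  let eb := Module.Basis.mk (linearIndependent_coeff b) (span_coeff b)
  have heb : ∀ i m, eb i m = (b i).1.coeff m := fun i m => by simp [eb]
  have := FiniteDimensional.fintypeBasisIndex eb
  let β := fun i n => eb.repr (fun m => F.coeff (m, n)) i
  have hβ : ∀ m n, F.coeff (m, n) = ∑ i, β i n * (b i).1.coeff m := fun m n => by
    have := congrFun (eb.sum_repr fun m => F.coeff (m, n)) m
    simp only [Finset.sum_apply, Pi.smul_apply, smul_eq_mul, heb] at this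
    exact this.symm
  have hβσ : ∀ i σ n, β i (d σ n) = σ (β i n) := by
    intro i σ n
    have h1 : ∑ i, β i (d σ n) • eb i = ∑ i, σ (β i n) • eb i := by
      funext m
      obtain ⟨m, rfl⟩ := (c σ).surjective m
      simp only [Finset.sum_apply, Pi.smul_apply, smul_eq_mul, heb]
      rw [← hβ, hF, hβ, map_sum]
      refine Finset.sum_congr rfl fun i _ => ?_
      rw [map_mul, coeff_fixedAlgebra]
    have h2 := congrArg (fun f => eb.repr f i) h1
    simpa [Finsupp.single_apply] using h2
  let w : ∀ i, fixedAlgebra d := fun i => ⟨ofCoeff (Finsupp.equivFunOnFinite.symm (β i)),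
    mem_fixedAlgebra.2 fun σ n => hβσ i σ n⟩
  refine ⟨∑ i, b i ⊗ₜ w i, ?_⟩
  ext ⟨m, n⟩
  rw [map_sum, coeff_sum, Finsupp.finsetSum_apply, hβ]
  refine Finset.sum_congr rfl fun i _ => ?_
  rw [coeff_pairHom_tmul, mul_comm]
  rfl

end Pair

end FixedAlgebra

/-! ### The Hopf algebra of fixed points -/

section FixedHopf

open MonoidAlgebra

variable {K E N : Type*} [Field K] [Field E] [Algebra K E] [Group N]
  [FiniteDimensional K E] [IsGalois K E] [Finite N] (c : (E ≃ₐ[K] E) →* MulAut N)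

theorem mapDomainAlgHom_mapDomainAlgHom {M P : Type*} [Group M] [Group P] (f : N →* M)
    (g : M →* P) (x : MonoidAlgebra E N) :
    mapDomainAlgHom K E g (mapDomainAlgHom K E f x) = mapDomainAlgHom K E (g.comp f) x := by
  rw [mapDomainAlgHom_comp, AlgHom.comp_apply]

/-- The comparison map from the tensor square of the fixed algebra. -/
noncomputable def fixedPair :
    fixedAlgebra c ⊗[K] fixedAlgebra c →ₐ[K] MonoidAlgebra E (N × N) :=
  pairHom (fixedAlgebra c).val (fixedAlgebra c).val

theorem fixedPair_injective : Function.Injective (fixedPair c) :=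
  pairHom_injective c _ Subtype.val_injective

/-- The diagonal map of the group algebra. -/
noncomputable def diagHom (K E N : Type*) [Field K] [Field E] [Algebra K E] [Group N] :
    MonoidAlgebra E N →ₐ[K] MonoidAlgebra E (N × N) :=
  mapDomainAlgHom K E ((MonoidHom.id N).prod (MonoidHom.id N))

theorem diagHom_single (n : N) (e : E) : diagHom K E N (single n e) = single (n, n) e := by
  simp [diagHom]

theorem coeff_diagHom [DecidableEq N] (x : MonoidAlgebra E N) (m n : N) :
    (diagHom K E N x).coeff (m, n) = if m = n then x.coeff n else 0 := by
  induction x using MonoidAlgebra.induction_linear with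
  | zero => simp
  | add x y hx hy =>
    simp only [map_add, coeff_add, Finsupp.add_apply, hx, hy]
    split_ifs <;> simp
  | single k e =>
    rw [diagHom_single]
    simp only [coeff_single, Finsupp.single_apply, Prod.mk.injEq]
    grind

/-- The diagonal commutes with the simultaneous action on both factors, so the comultiplication of
E[N] restricts to the fixed algebra. -/
theorem diagHom_mem_range (h : fixedAlgebra c) :
    diagHom K E N h.1 ∈ (fixedPair c).range := by
  classical
  obtain ⟨t, ht⟩ := exists_pairHom_eq c c (diagHom K E N h.1) fun σ m n => by
    simp only [coeff_diagHom, EmbeddingLike.apply_eq_iff_eq, coeff_fixedAlgebra]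
    split_ifs <;> simp
  exact ⟨t, ht⟩

/-- The comultiplication of the fixed algebra. -/
noncomputable def fixedComul : fixedAlgebra c →ₐ[K] fixedAlgebra c ⊗[K] fixedAlgebra c :=
  ((AlgEquiv.ofInjective (fixedPair c) (fixedPair_injective c)).symm : _ →ₐ[K] _).comp
    (((diagHom K E N).comp (fixedAlgebra c).val).codRestrict _ (diagHom_mem_range c))

theorem fixedPair_fixedComul (h : fixedAlgebra c) :
    fixedPair c (fixedComul c h) = diagHom K E N h.1 := by
  have := (AlgEquiv.ofInjective (fixedPair c) (fixedPair_injective c)).apply_symm_apply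
    ⟨diagHom K E N h.1, diagHom_mem_range c h⟩
  exact congrArg Subtype.val this

/-- The augmentation of the group algebra. -/
noncomputable def augHom (K E N : Type*) [Field K] [Field E] [Algebra K E] [Group N] :
    MonoidAlgebra E N →ₐ[K] E :=
  (MonoidAlgebra.lift E E N 1).restrictScalars K

theorem augHom_single (n : N) (e : E) : augHom K E N (single n e) = e := by
  simp [augHom]

theorem augHom_twist (σ : E ≃ₐ[K] E) (s : MulAut N) (x : MonoidAlgebra E N) :
    augHom K E N (twist σ s x) = σ (augHom K E N x) := by
  induction x using MonoidAlgebra.induction_linear with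
  | zero => simp
  | add x y hx hy => simp only [map_add, hx, hy]
  | single k e => rw [twist_single, augHom_single, augHom_single]

theorem augHom_mem_bot (h : fixedAlgebra c) : augHom K E N h.1 ∈ (⊥ : Subalgebra K E) := by
  rw [Algebra.mem_bot, IsGalois.mem_range_algebraMap_iff_fixed]
  intro σ
  rw [← augHom_twist σ (c σ)]
  congr 1
  ext n
  obtain ⟨n, rfl⟩ := (c σ).surjective n
  rw [coeff_twist, coeff_fixedAlgebra]

/-- The counit of the fixed algebra. -/
noncomputable def fixedCounit : fixedAlgebra c →ₐ[K] K :=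
  (Algebra.botEquiv K E : _ →ₐ[K] K).comp
    (((augHom K E N).comp (fixedAlgebra c).val).codRestrict ⊥ (augHom_mem_bot c))

theorem algebraMap_fixedCounit (h : fixedAlgebra c) :
    algebraMap K E (fixedCounit c h) = augHom K E N h.1 := by
  have := (Algebra.botEquiv K E).symm_apply_apply ⟨augHom K E N h.1, augHom_mem_bot c h⟩
  exact congrArg Subtype.val this

/-- After embedding in E[N × N × N], both sides are induced by the homomorphism n ↦ (n, n, n). The
other Hopf axioms are treated alike: embed, then compare maps of groups. -/
theorem fixedComul_coassoc :
    (Algebra.TensorProduct.assoc K K K (fixedAlgebra c) (fixedAlgebra c)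
      (fixedAlgebra c) : _ →ₐ[K] _).comp
      ((Algebra.TensorProduct.map (fixedComul c) (AlgHom.id K (fixedAlgebra c))).comp
        (fixedComul c)) =
    (Algebra.TensorProduct.map (AlgHom.id K (fixedAlgebra c)) (fixedComul c)).comp
      (fixedComul c) := by
  let J3 := pairHom (fixedAlgebra c).val (fixedPair c)
  have hJ3 : Function.Injective J3 := pairHom_injective c _ (fixedPair_injective c)
  let A1 : MonoidAlgebra E (N × N) →ₐ[K] MonoidAlgebra E (N × N × N) :=
    mapDomainAlgHom K E ((MonoidHom.id N).prodMap ((MonoidHom.id N).prod (MonoidHom.id N)))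
  let A2 : MonoidAlgebra E (N × N) →ₐ[K] MonoidAlgebra E (N × N × N) :=
    mapDomainAlgHom K E ((MonoidHom.fst N N).prod (MonoidHom.id (N × N)))
  have h1 : J3.comp (Algebra.TensorProduct.map (AlgHom.id K _) (fixedComul c)) =
      A1.comp (fixedPair c) := by
    refine Algebra.TensorProduct.ext' fun x y => ?_
    have e1 : J3 (x ⊗ₜ fixedComul c y) = A1 (fixedPair c (x ⊗ₜ y)) := by
      simp only [J3, fixedPair, pairHom_tmul]
      rw [← fixedPair, fixedPair_fixedComul, map_mul]
      simp only [A1, diagHom, Subalgebra.coe_val, mapDomainAlgHom_mapDomainAlgHom]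
      rfl
    exact e1
  have h2 : ∀ t x, J3 (Algebra.TensorProduct.assoc K K K (fixedAlgebra c) (fixedAlgebra c)
      (fixedAlgebra c) (t ⊗ₜ x)) = mapDomainAlgHom K E (MulEquiv.prodAssoc).toMonoidHom
        (pairHom (fixedPair c) (fixedAlgebra c).val (t ⊗ₜ x)) := by
    intro t x
    induction t using TensorProduct.induction_on with
    | zero => simp
    | add t s ht hs => simp only [TensorProduct.add_tmul, map_add, ht, hs]
    | tmul y z =>
      simp only [J3, fixedPair, Algebra.TensorProduct.assoc_tmul, pairHom_tmul, map_mul, mul_assoc]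
      simp only [Subalgebra.coe_val, mapDomainAlgHom_mapDomainAlgHom]
      rfl
  have h3 : ∀ t, J3 (Algebra.TensorProduct.assoc K K K (fixedAlgebra c) (fixedAlgebra c)
      (fixedAlgebra c) (Algebra.TensorProduct.map (fixedComul c) (AlgHom.id K _) t)) =
      A2 (fixedPair c t) := by
    intro t
    induction t using TensorProduct.induction_on with
    | zero => simp
    | add t s ht hs => simp only [map_add, ht, hs]
    | tmul y z =>
      rw [Algebra.TensorProduct.map_tmul, h2, pairHom_tmul, fixedPair_fixedComul, fixedPair,
        pairHom_tmul, map_mul, map_mul]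
      simp only [A2, diagHom, AlgHom.id_apply, Subalgebra.coe_val, mapDomainAlgHom_mapDomainAlgHom]
      rfl
  refine AlgHom.ext fun h => hJ3 ?_
  have e1 := DFunLike.congr_fun h1 (fixedComul c h)
  have e2 := h3 (fixedComul c h)
  rw [AlgHom.comp_apply, AlgHom.comp_apply, fixedPair_fixedComul] at e1
  rw [fixedPair_fixedComul] at e2
  refine e2.trans (Eq.trans ?_ e1.symm)
  simp only [A1, A2, diagHom, mapDomainAlgHom_mapDomainAlgHom]
  rfl

theorem fixedCounit_fixedComul_left :
    (Algebra.TensorProduct.map (fixedCounit c) (AlgHom.id K (fixedAlgebra c))).comp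
      (fixedComul c) = (Algebra.TensorProduct.lid K (fixedAlgebra c)).symm := by
  have h1 : ∀ t, (Algebra.TensorProduct.lid K (fixedAlgebra c)
      (Algebra.TensorProduct.map (fixedCounit c) (AlgHom.id K (fixedAlgebra c)) t)).1 =
      mapDomainAlgHom K E (MonoidHom.snd N N) (fixedPair c t) := by
    intro t
    induction t using TensorProduct.induction_on with
    | zero => simp
    | add t s ht hs => simp only [map_add, ← ht, ← hs]; rfl
    | tmul x y =>
      have e1 : mapDomainAlgHom K E (MonoidHom.snd N N)
          (mapDomainAlgHom K E (MonoidHom.inl N N) x.1) = algebraMap K _ (fixedCounit c x) := by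
        rw [IsScalarTower.algebraMap_apply K E, algebraMap_fixedCounit]
        simp only [← AlgHom.comp_apply, ← mapDomainAlgHom_comp]
        generalize x.1 = x
        induction x using MonoidAlgebra.induction_linear with
        | zero => simp
        | add x y hx hy => simp only [map_add, hx, hy]
        | single n e => rw [augHom_single]; simp
      have e2 : mapDomainAlgHom K E (MonoidHom.snd N N)
          (mapDomainAlgHom K E (MonoidHom.inr N N) y.1) = y.1 := by
        rw [← AlgHom.comp_apply, ← mapDomainAlgHom_comp, MonoidHom.snd_comp_inr,
          mapDomainAlgHom_id, AlgHom.id_apply]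
      rw [fixedPair, pairHom_tmul, map_mul]
      refine Eq.trans ?_ (congrArg₂ (· * ·) e1 e2).symm
      rw [← Algebra.smul_def]
      rfl
  refine AlgHom.ext fun h => ?_
  refine (Algebra.TensorProduct.lid K (fixedAlgebra c)).injective (Subtype.ext ?_)
  refine (h1 (fixedComul c h)).trans ?_
  rw [fixedPair_fixedComul]
  simp only [diagHom, ← AlgHom.comp_apply, ← mapDomainAlgHom_comp]
  rw [MonoidHom.snd_comp_prod, mapDomainAlgHom_id]
  exact congrArg Subtype.val
    ((Algebra.TensorProduct.lid K (fixedAlgebra c)).apply_symm_apply h).symm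

theorem comm_fixedComul (h : fixedAlgebra c) :
    Algebra.TensorProduct.comm K (fixedAlgebra c) (fixedAlgebra c) (fixedComul c h) =
      fixedComul c h := by
  have h1 : ∀ t, fixedPair c (Algebra.TensorProduct.comm K (fixedAlgebra c) (fixedAlgebra c) t) =
      mapDomainAlgHom K E (MulEquiv.prodComm).toMonoidHom (fixedPair c t) := by
    intro t
    induction t using TensorProduct.induction_on with
    | zero => simp
    | add t s ht hs => simp only [map_add, ht, hs]
    | tmul x y =>
      rw [Algebra.TensorProduct.comm_tmul]
      simp only [fixedPair, pairHom_tmul, map_mul]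
      rw [(commute_inl_inr (K := K) _ _).eq]
      simp only [Subalgebra.coe_val]
      simp only [← AlgHom.comp_apply, ← mapDomainAlgHom_comp]
      congr 2
  refine fixedPair_injective c ?_
  rw [h1, fixedPair_fixedComul]
  simp only [diagHom, ← AlgHom.comp_apply, ← mapDomainAlgHom_comp]
  congr 2

theorem fixedCounit_fixedComul_right :
    (Algebra.TensorProduct.map (AlgHom.id K (fixedAlgebra c)) (fixedCounit c)).comp
      (fixedComul c) = (Algebra.TensorProduct.rid K K (fixedAlgebra c)).symm := by
  have h1 : ∀ t, Algebra.TensorProduct.rid K K (fixedAlgebra c)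
      (Algebra.TensorProduct.map (AlgHom.id K (fixedAlgebra c)) (fixedCounit c) t) =
      Algebra.TensorProduct.lid K (fixedAlgebra c)
      (Algebra.TensorProduct.map (fixedCounit c) (AlgHom.id K (fixedAlgebra c))
        (Algebra.TensorProduct.comm K (fixedAlgebra c) (fixedAlgebra c) t)) := by
    intro t
    induction t using TensorProduct.induction_on with
    | zero => simp
    | add t s ht hs => simp only [map_add, ht, hs]
    | tmul x y => simp
  refine AlgHom.ext fun h => ?_
  refine (Algebra.TensorProduct.rid K K (fixedAlgebra c)).injective ?_
  refine (h1 (fixedComul c h)).trans ?_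
  rw [comm_fixedComul]
  have := DFunLike.congr_fun (fixedCounit_fixedComul_left c) h
  refine (congrArg (Algebra.TensorProduct.lid K (fixedAlgebra c)) this).trans ?_
  exact ((Algebra.TensorProduct.lid K (fixedAlgebra c)).apply_symm_apply h).trans
    ((Algebra.TensorProduct.rid K K (fixedAlgebra c)).apply_symm_apply h).symm

/-- The bialgebra of fixed points of the group algebra. -/
noncomputable instance fixedBialgebra : Bialgebra K (fixedAlgebra c) :=
  Bialgebra.ofAlgHom (fixedComul c) (fixedCounit c) (fixedComul_coassoc c)
    (fixedCounit_fixedComul_left c) (fixedCounit_fixedComul_right c)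

theorem comul_fixedAlgebra (h : fixedAlgebra c) :
    Coalgebra.comul (R := K) h = fixedComul c h := rfl

theorem counit_fixedAlgebra (h : fixedAlgebra c) :
    Coalgebra.counit (R := K) h = fixedCounit c h := rfl

instance fixedCocomm : Coalgebra.IsCocomm K (fixedAlgebra c) where
  comm_comp_comul := LinearMap.ext fun h => comm_fixedComul c h

/-- The inversion of the group, extended to a linear map of the group algebra. -/
noncomputable def invLinear (E N : Type*) [Field E] [Group N] :
    MonoidAlgebra E N →ₗ[E] MonoidAlgebra E N where
  toFun x := mapDomain Inv.inv x
  map_add' _ _ := mapDomain_add _ _ _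
  map_smul' k x := by
    ext n
    exact DFunLike.congr_fun (Finsupp.mapDomain_smul (f := Inv.inv) k x.coeff) n

theorem invLinear_single (n : N) (e : E) : invLinear E N (single n e) = single n⁻¹ e :=
  mapDomain_single

theorem invLinear_mem (h : fixedAlgebra c) : invLinear E N h.1 ∈ fixedAlgebra c := by
  have h1 : ∀ (x : MonoidAlgebra E N) n, (invLinear E N x).coeff n = x.coeff n⁻¹ := by
    intro x n
    have := Finsupp.mapDomain_apply inv_injective x.coeff n⁻¹
    rwa [inv_inv] at this
  refine mem_fixedAlgebra.2 fun σ n => ?_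
  rw [h1, h1, ← map_inv, coeff_fixedAlgebra]

/-- The antipode of the fixed algebra. -/
noncomputable def fixedAntipode : fixedAlgebra c →ₗ[K] fixedAlgebra c where
  toFun h := ⟨invLinear E N h.1, invLinear_mem c h⟩
  map_add' _ _ := Subtype.ext (map_add (invLinear E N) _ _)
  map_smul' k x := Subtype.ext (LinearMap.map_smul_of_tower (invLinear E N) k x.1)

/-- The additive map of group algebras induced by a map of the groups. -/
noncomputable def pushHom {M : Type*} (E : Type*) [Field E] (f : M → N) :
    MonoidAlgebra E M →+ MonoidAlgebra E N :=
  { toFun := fun x => mapDomain f x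
    map_zero' := mapDomain_zero _
    map_add' := mapDomain_add _ }

theorem pushHom_single {M : Type*} (f : M → N) (m : M) (e : E) :
    pushHom E f (single m e) = single (f m) e :=
  mapDomain_single

/-- Multiplying after the antipode on the first factor is pushing forward along (m, n) ↦ m⁻¹n. This
is constant on the diagonal, which is the antipode axiom; as it is only a map of sets, `pushHom` is
merely additive. -/
theorem pushHom_inv_mul (x y : MonoidAlgebra E N) :
    pushHom E (fun p : N × N => p.1⁻¹ * p.2) (mapDomainAlgHom K E (MonoidHom.inl N N) x *
      mapDomainAlgHom K E (MonoidHom.inr N N) y) = invLinear E N x * y := by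
  induction x using MonoidAlgebra.induction_linear with
  | zero => simp
  | add x z hx hz => simp only [map_add, add_mul, hx, hz]
  | single n e =>
    induction y using MonoidAlgebra.induction_linear with
    | zero => simp
    | add x z hx hz => simp only [map_add, mul_add, hx, hz]
    | single m f =>
      rw [invLinear_single]
      simp [single_mul_single, pushHom_single]

theorem pushHom_mul_inv (x y : MonoidAlgebra E N) :
    pushHom E (fun p : N × N => p.1 * p.2⁻¹) (mapDomainAlgHom K E (MonoidHom.inl N N) x *
      mapDomainAlgHom K E (MonoidHom.inr N N) y) = x * invLinear E N y := by
  induction x using MonoidAlgebra.induction_linear with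
  | zero => simp
  | add x z hx hz => simp only [map_add, add_mul, hx, hz]
  | single n e =>
    induction y using MonoidAlgebra.induction_linear with
    | zero => simp
    | add x z hx hz => simp only [map_add, mul_add, hx, hz]
    | single m f =>
      rw [invLinear_single]
      simp [single_mul_single, pushHom_single]

theorem pushHom_diagHom (f : N × N → N) (hf : ∀ n, f (n, n) = 1) (x : MonoidAlgebra E N) :
    pushHom E f (diagHom K E N x) = algebraMap E _ (augHom K E N x) := by
  induction x using MonoidAlgebra.induction_linear with
  | zero => simp
  | add x z hx hz => simp only [map_add, hx, hz]
  | single n e => simp [diagHom_single, pushHom_single, augHom_single, hf]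

theorem mul_fixedAntipode_rTensor :
    LinearMap.mul' K (fixedAlgebra c) ∘ₗ LinearMap.rTensor (fixedAlgebra c) (fixedAntipode c) ∘ₗ
      Coalgebra.comul = Algebra.linearMap K (fixedAlgebra c) ∘ₗ Coalgebra.counit := by
  have h1 : ∀ t, (LinearMap.mul' K (fixedAlgebra c)
      (LinearMap.rTensor (fixedAlgebra c) (fixedAntipode c) t)).1 =
      pushHom E (fun p : N × N => p.1⁻¹ * p.2) (fixedPair c t) := by
    intro t
    induction t using TensorProduct.induction_on with
    | zero => simp
    | add t s ht hs => simp only [map_add, ← ht, ← hs]; rfl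
    | tmul x y =>
      rw [fixedPair, pairHom_tmul, pushHom_inv_mul]
      rfl
  refine LinearMap.ext fun h => Subtype.ext ((h1 (fixedComul c h)).trans ?_)
  rw [fixedPair_fixedComul, pushHom_diagHom _ (by simp), ← algebraMap_fixedCounit,
    ← IsScalarTower.algebraMap_apply]
  rfl

theorem mul_fixedAntipode_lTensor :
    LinearMap.mul' K (fixedAlgebra c) ∘ₗ LinearMap.lTensor (fixedAlgebra c) (fixedAntipode c) ∘ₗ
      Coalgebra.comul = Algebra.linearMap K (fixedAlgebra c) ∘ₗ Coalgebra.counit := by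
  have h1 : ∀ t, (LinearMap.mul' K (fixedAlgebra c)
      (LinearMap.lTensor (fixedAlgebra c) (fixedAntipode c) t)).1 =
      pushHom E (fun p : N × N => p.1 * p.2⁻¹) (fixedPair c t) := by
    intro t
    induction t using TensorProduct.induction_on with
    | zero => simp
    | add t s ht hs => simp only [map_add, ← ht, ← hs]; rfl
    | tmul x y =>
      rw [fixedPair, pairHom_tmul, pushHom_mul_inv]
      rfl
  refine LinearMap.ext fun h => Subtype.ext ((h1 (fixedComul c h)).trans ?_)
  rw [fixedPair_fixedComul, pushHom_diagHom _ (by simp), ← algebraMap_fixedCounit,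
    ← IsScalarTower.algebraMap_apply]
  rfl

/-- The Hopf algebra of fixed points of the group algebra. -/
noncomputable instance fixedHopf : HopfAlgebra K (fixedAlgebra c) where
  antipode := fixedAntipode c
  mul_antipode_rTensor_comul := mul_fixedAntipode_rTensor c
  mul_antipode_lTensor_comul := mul_fixedAntipode_lTensor c

/-! ### Base change of the fixed algebra -/

/-- The coefficients of an element of the group algebra. -/
noncomputable def coeffFun (E N : Type*) [Field E] [Group N] :
    MonoidAlgebra E N →ₗ[E] (N → E) where
  toFun x := x.coeff
  map_add' _ _ := rfl
  map_smul' _ _ := rfl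

/-- The natural map from the base change of the fixed algebra to the group algebra. -/
noncomputable def fixedBaseChange : E ⊗[K] fixedAlgebra c →ₐ[E] MonoidAlgebra E N :=
  Algebra.TensorProduct.lift (Algebra.ofId E _) (fixedAlgebra c).val
    fun e x => Algebra.commutes e x.1

theorem fixedBaseChange_tmul (e : E) (h : fixedAlgebra c) :
    fixedBaseChange c (e ⊗ₜ h) = e • h.1 :=
  (Algebra.smul_def e h.1).symm

/-- Injectivity is the independence half of descent, surjectivity the spanning half. -/
theorem fixedBaseChange_bijective : Function.Bijective (fixedBaseChange c) := by
  let b := Module.Basis.ofVectorSpace K (fixedAlgebra c)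
  constructor
  · refine (injective_iff_map_eq_zero (fixedBaseChange c)).2 fun t ht => ?_
    have h1 := tensor_eq_zero (F := E) (A := N → E) (Z := Unit) (fun h => h.1.coeff) b
      (linearIndependent_coeff b) (fun _ => (LinearMap.id : E →ₗ[K] E)) (fun w hw => hw ())
      (fun _ =>
        ((coeffFun E N).restrictScalars K).comp
        (((fixedBaseChange c).toLinearMap.restrictScalars K).comp
          (TensorProduct.comm K (fixedAlgebra c) E).toLinearMap))
      (fun _ h e => ?_) ((TensorProduct.comm K (fixedAlgebra c) E).symm t) (fun _ => ?_)
    · exact (TensorProduct.comm K (fixedAlgebra c) E).symm.map_eq_zero_iff.1 h1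
    · exact congrArg (coeffFun E N) (fixedBaseChange_tmul c e h)
    · refine (congrArg (coeffFun E N) ?_).trans (map_zero (coeffFun E N))
      refine (congrArg (fixedBaseChange c) ?_).trans ht
      exact (TensorProduct.comm K (fixedAlgebra c) E).apply_symm_apply t
  · intro x
    have h1 : (⇑x.coeff : N → E) ∈ (LinearMap.range (fixedBaseChange c).toLinearMap).map
        (coeffFun E N) := by
      refine (Submodule.span_le.2 ?_) (span_coeff b (Submodule.mem_top (x := ⇑x.coeff)))
      rintro _ ⟨i, rfl⟩
      refine ⟨(b i).1, ⟨1 ⊗ₜ b i, ?_⟩, rfl⟩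
      exact (fixedBaseChange_tmul c 1 (b i)).trans (one_smul _ _)
    obtain ⟨_, ⟨t, rfl⟩, h2⟩ := h1
    exact ⟨t, coeff_injective (DFunLike.coe_injective h2)⟩

end FixedHopf

section FixedBaseChange

open MonoidAlgebra

variable {K E N : Type*} [Field K] [Field E] [Algebra K E] [Group N]
  [FiniteDimensional K E] [IsGalois K E] [Finite N] (c : (E ≃ₐ[K] E) →* MulAut N)

theorem counit_eq_augHom (x : MonoidAlgebra E N) :
    Coalgebra.counit (R := E) x = augHom K E N x := by
  induction x using MonoidAlgebra.induction_linear with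
  | zero => simp
  | add x y hx hy => rw [map_add, map_add, hx, hy]
  | single n e => rw [augHom_single]; simp

/-- The map from the group algebra of `N × N` to the tensor square of the group algebra. -/
noncomputable def prodToTensor (E N : Type*) [Field E] [Group N] :
    MonoidAlgebra E (N × N) →ₐ[E] MonoidAlgebra E N ⊗[E] MonoidAlgebra E N :=
  MonoidAlgebra.lift E _ _
    { toFun := fun p => single p.1 1 ⊗ₜ single p.2 1
      map_one' := rfl
      map_mul' := fun p q => by simp [single_mul_single] }

theorem prodToTensor_single (p : N × N) (e : E) :
    prodToTensor E N (single p e) = e • (single p.1 1 ⊗ₜ single p.2 1) := by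
  simp [prodToTensor]

theorem prodToTensor_inl_mul_inr (x y : MonoidAlgebra E N) :
    prodToTensor E N (mapDomainAlgHom K E (MonoidHom.inl N N) x *
      mapDomainAlgHom K E (MonoidHom.inr N N) y) = x ⊗ₜ y := by
  induction x using MonoidAlgebra.induction_linear with
  | zero => simp
  | add x z hx hz => simp only [map_add, add_mul, hx, hz, TensorProduct.add_tmul]
  | single n e =>
    induction y using MonoidAlgebra.induction_linear with
    | zero => simp
    | add x z hx hz => simp only [map_add, mul_add, hx, hz, TensorProduct.tmul_add]
    | single m f =>
      have h1 : single n e = e • (single n 1 : MonoidAlgebra E N) := by simp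
      have h2 : single m f = f • (single m 1 : MonoidAlgebra E N) := by simp
      rw [h1, h2, TensorProduct.smul_tmul_smul]
      simp [single_mul_single, prodToTensor_single]

theorem prodToTensor_diagHom (x : MonoidAlgebra E N) :
    prodToTensor E N (diagHom K E N x) = Coalgebra.comul (R := E) x := by
  induction x using MonoidAlgebra.induction_linear with
  | zero => simp
  | add x y hx hy => simp only [map_add, hx, hy]
  | single n e =>
    have h1 : single n e = e • (single n 1 : MonoidAlgebra E N) := by simp
    rw [diagHom_single, prodToTensor_single, h1, map_smul]
    simp

/-- The group algebra is the base change of its fixed algebra, as a bialgebra. -/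
noncomputable def fixedBaseChangeEquiv : E ⊗[K] fixedAlgebra c ≃ₐc[E] MonoidAlgebra E N :=
  BialgEquiv.ofAlgEquiv (AlgEquiv.ofBijective (fixedBaseChange c) (fixedBaseChange_bijective c))
    (by
      refine Algebra.TensorProduct.ext' fun e h => ?_
      have h1 : Coalgebra.counit (R := E) (fixedBaseChange c (e ⊗ₜ h)) =
          Coalgebra.counit (R := E) (e ⊗ₜ[K] h) := by
        rw [fixedBaseChange_tmul, map_smul, counit_eq_augHom (K := K), ← algebraMap_fixedCounit,
          TensorProduct.counit_tmul, counit_fixedAlgebra, Algebra.smul_def, mul_comm,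
          Algebra.smul_def, CommSemiring.counit_apply]
        rfl
      exact h1)
    (by
      refine Algebra.TensorProduct.ext' fun e h => ?_
      -- The comultiplication of the base change is computed for an arbitrary tensor t, since
      -- `fixedComul c h` is only known through its image under `fixedPair`.
      have h1 : ∀ t, Algebra.TensorProduct.map (fixedBaseChange c) (fixedBaseChange c)
          (TensorProduct.AlgebraTensorModule.tensorTensorTensorComm K E K E E E (fixedAlgebra c)
            (fixedAlgebra c) (((1 : E) ⊗ₜ e) ⊗ₜ t)) = e • prodToTensor E N (fixedPair c t) := by
        intro t
        induction t using TensorProduct.induction_on with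
        | zero =>
          rw [TensorProduct.tmul_zero, LinearEquiv.map_zero, map_zero, map_zero,
            map_zero, smul_zero]
        | add t s ht hs =>
          rw [TensorProduct.tmul_add, LinearEquiv.map_add, map_add, ht, hs,
            map_add, map_add, smul_add]
        | tmul x y =>
          rw [TensorProduct.AlgebraTensorModule.tensorTensorTensorComm_tmul,
            Algebra.TensorProduct.map_tmul, fixedBaseChange_tmul, fixedBaseChange_tmul, one_smul,
            fixedPair, pairHom_tmul, prodToTensor_inl_mul_inr, TensorProduct.tmul_smul]
          rfl
      have h2 : Coalgebra.comul (R := E) (e ⊗ₜ[K] h) =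
          TensorProduct.AlgebraTensorModule.tensorTensorTensorComm K E K E E E (fixedAlgebra c)
            (fixedAlgebra c) (((1 : E) ⊗ₜ e) ⊗ₜ fixedComul c h) := by
        rw [TensorProduct.comul_tmul, comul_fixedAlgebra, CommSemiring.comul_apply]
      have h3 : Algebra.TensorProduct.map (fixedBaseChange c) (fixedBaseChange c)
          (Coalgebra.comul (R := E) (e ⊗ₜ[K] h)) =
          Coalgebra.comul (R := E) (fixedBaseChange c (e ⊗ₜ h)) := by
        rw [h2, h1, fixedPair_fixedComul, prodToTensor_diagHom, fixedBaseChange_tmul, map_smul]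
      exact h3)

end FixedBaseChange

/-! ### Regular subgroups -/

/-- A subgroup of the symmetric group is regular if it acts simply transitively. -/
def IsRegularPerm {X : Type*} (N : Subgroup (Equiv.Perm X)) : Prop :=
  ∀ x : X, Function.Bijective fun n : N => n.1 x

/-- Conjugation by the elements of a group acting on `X`, on a subgroup of the symmetric group
which is normalised by it. -/
noncomputable def conjHom {Γ X : Type*} [Group Γ] (ρ : Γ →* Equiv.Perm X)
    (N : Subgroup (Equiv.Perm X)) (h : ∀ σ, ρ σ ∈ Subgroup.normalizer (N : Set (Equiv.Perm X))) :
    Γ →* MulAut N :=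
  N.normalizerMonoidHom.comp (ρ.codRestrict _ h)

theorem conjHom_apply {Γ X : Type*} [Group Γ] (ρ : Γ →* Equiv.Perm X)
    (N : Subgroup (Equiv.Perm X)) (h : ∀ σ, ρ σ ∈ Subgroup.normalizer (N : Set (Equiv.Perm X)))
    (σ : Γ) (n : N) : (conjHom ρ N h σ n : Equiv.Perm X) = ρ σ * n * (ρ σ)⁻¹ := rfl

/-! ### The embeddings of L as a Galois set -/

section Embeddings

variable {K : Type u} {L E : Type v} [Field K] [Field L] [Field E] [Algebra K L] [Algebra K E]

/-- The action of the Galois group on the embeddings of `L`. -/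
def galPerm (K : Type u) (L E : Type v) [Field K] [Field L] [Field E] [Algebra K L]
    [Algebra K E] : (E ≃ₐ[K] E) →* Equiv.Perm (L →ₐ[K] E) where
  toFun σ :=
    { toFun := fun x => (σ : E →ₐ[K] E).comp x
      invFun := fun x => ((σ⁻¹ : E ≃ₐ[K] E) : E →ₐ[K] E).comp x
      left_inv := fun x => AlgHom.ext fun y => σ.symm_apply_apply (x y)
      right_inv := fun x => AlgHom.ext fun y => σ.apply_symm_apply (x y) }
  map_one' := rfl
  map_mul' _ _ := rfl

theorem galPerm_apply (σ : E ≃ₐ[K] E) (x : L →ₐ[K] E) (y : L) :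
    galPerm K L E σ x y = σ (x y) := rfl

/-- Two embeddings differ by an isomorphism between their images, which extends to the normal
extension E. -/
theorem exists_galPerm_eq [Normal K E] (x x' : L →ₐ[K] E) :
    ∃ σ : E ≃ₐ[K] E, galPerm K L E σ x = x' := by
  let χ : x.fieldRange ≃ₐ[K] x'.fieldRange := x.equivFieldRange.symm.trans x'.equivFieldRange
  refine ⟨χ.liftNormal E, AlgHom.ext fun y => ?_⟩
  have h1 := χ.liftNormal_commutes E (x.equivFieldRange y)
  have h2 : χ (x.equivFieldRange y) = x'.equivFieldRange y := by simp [χ]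
  rw [h2] at h1
  exact h1

/-- The value at one embedding x₀ is fixed by the stabiliser of x₀, which is the Galois group of E
over x₀(L), so it lies in x₀(L). Transitivity carries the equality to every embedding. Thus L is the
ring of equivariant functions. -/
theorem exists_eq_of_equivariant [FiniteDimensional K E] [IsGalois K E] [Nonempty (L →ₐ[K] E)]
    (F : (L →ₐ[K] E) → E) (hF : ∀ σ x, F (galPerm K L E σ x) = σ (F x)) :
    ∃ y : L, ∀ x, x y = F x := by
  obtain ⟨x₀⟩ := ‹Nonempty (L →ₐ[K] E)›
  have h1 : F x₀ ∈ x₀.fieldRange := by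
    rw [← IsGalois.fixedField_fixingSubgroup x₀.fieldRange]
    rintro ⟨σ, hσ⟩
    have h2 : galPerm K L E σ x₀ = x₀ := AlgHom.ext fun y => hσ ⟨x₀ y, y, rfl⟩
    have h3 := hF σ x₀
    rw [h2] at h3
    exact h3.symm
  obtain ⟨y, hy⟩ := h1
  refine ⟨y, fun x => ?_⟩
  obtain ⟨σ, rfl⟩ := exists_galPerm_eq x₀ x
  rw [hF, galPerm_apply]
  exact congrArg σ hy

end Embeddings

/-! ### The Hopf-Galois structure of a regular subgroup -/

section Construction

open MonoidAlgebra

variable {K : Type u} {L E : Type v} [Field K] [Field L] [Field E] [Algebra K L] [Algebra K E]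
  [FiniteDimensional K E] [IsGalois K E] [Finite (L →ₐ[K] E)]
  (N : Subgroup (Equiv.Perm (L →ₐ[K] E)))

/-- The action of the group algebra on functions on the set of embeddings. -/
noncomputable def permRep : MonoidAlgebra E N →ₐ[E] Module.End E ((L →ₐ[K] E) → E) :=
  MonoidAlgebra.lift E _ N
    { toFun := fun n => LinearMap.funLeft E E fun x => n.1⁻¹ x
      map_one' := rfl
      map_mul' := fun m n => by
        refine LinearMap.ext fun f => funext fun x => ?_
        simp [LinearMap.funLeft_apply, mul_inv_rev] }

theorem permRep_apply [Fintype N] (h : MonoidAlgebra E N) (f : (L →ₐ[K] E) → E) (x : L →ₐ[K] E) :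
    permRep N h f x = ∑ n : N, h.coeff n * f (n.1⁻¹ x) := by
  rw [permRep, lift_apply, Finsupp.sum_fintype _ _ (by simp)]
  simp [LinearMap.sum_apply, LinearMap.funLeft_apply]

/-- The function on the set of embeddings defined by an element of the field. -/
def evalHom (K : Type u) (L E : Type v) [Field K] [Field L] [Field E] [Algebra K L]
    [Algebra K E] : L →ₐ[K] ((L →ₐ[K] E) → E) :=
  AlgHom.pi fun x => x

theorem evalHom_injective [Nonempty (L →ₐ[K] E)] : Function.Injective (evalHom K L E) := by
  obtain ⟨x₀⟩ := ‹Nonempty (L →ₐ[K] E)›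
  intro y y' h
  exact x₀.toRingHom.injective (congrFun h x₀)

variable {N} (hN : ∀ σ, galPerm K L E σ ∈ Subgroup.normalizer (N : Set (Equiv.Perm (L →ₐ[K] E))))
  [Nonempty (L →ₐ[K] E)]

/-- Conjugation by σ permutes N and matches the equivariance of the coefficients of h, so reindexing
the sum shows that the resulting function is again equivariant. -/
theorem exists_fixedAct (h : fixedAlgebra (conjHom (galPerm K L E) N hN)) (y : L) :
    ∃ y' : L, evalHom K L E y' = permRep N h.1 (evalHom K L E y) := by
  classical
  have := Fintype.ofFinite N
  obtain ⟨y', hy'⟩ := exists_eq_of_equivariant (permRep N h.1 (evalHom K L E y)) fun σ x => by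
    rw [permRep_apply, permRep_apply, map_sum,
      ← Equiv.sum_comp (conjHom (galPerm K L E) N hN σ).toEquiv]
    refine Finset.sum_congr rfl fun n _ => ?_
    rw [map_mul, ← coeff_fixedAlgebra h]
    refine congrArg (_ * ·) ?_
    have h1 : ((conjHom (galPerm K L E) N hN σ n : N).1)⁻¹ (galPerm K L E σ x) =
        galPerm K L E σ (n.1⁻¹ x) := by
      rw [conjHom_apply, mul_inv_rev, mul_inv_rev, inv_inv]
      simp
    exact congrFun (congrArg DFunLike.coe h1) y
  exact ⟨y', funext hy'⟩

/-- The action of an element of the fixed algebra. -/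
noncomputable def fixedActFun (h : fixedAlgebra (conjHom (galPerm K L E) N hN)) (y : L) : L :=
  (exists_fixedAct hN h y).choose

theorem evalHom_fixedActFun (h : fixedAlgebra (conjHom (galPerm K L E) N hN)) (y : L) :
    evalHom K L E (fixedActFun hN h y) = permRep N h.1 (evalHom K L E y) :=
  (exists_fixedAct hN h y).choose_spec

/-- The action of the fixed algebra on `L`. -/
noncomputable def fixedAct :
    fixedAlgebra (conjHom (galPerm K L E) N hN) →ₐ[K] Module.End K L where
  toFun h :=
    { toFun := fixedActFun hN h
      map_add' := fun y y' => evalHom_injective (E := E) (K := K) (by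
        simp only [map_add, evalHom_fixedActFun])
      map_smul' := fun k y => evalHom_injective (E := E) (K := K) (by
        simp only [map_smul, evalHom_fixedActFun, RingHom.id_apply]
        exact LinearMap.map_smul_of_tower _ k _) }
  map_one' := LinearMap.ext fun y => evalHom_injective (E := E) (K := K) (by
    refine (evalHom_fixedActFun hN 1 y).trans ?_
    rw [OneMemClass.coe_one, map_one]
    rfl)
  map_mul' h h' := LinearMap.ext fun y => evalHom_injective (E := E) (K := K) (by
    refine (evalHom_fixedActFun hN (h * h') y).trans ?_
    refine Eq.trans ?_ (evalHom_fixedActFun hN h _).symm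
    refine Eq.trans ?_ (congrArg _ (evalHom_fixedActFun hN h' y)).symm
    rw [MulMemClass.coe_mul, map_mul]
    rfl)
  map_zero' := LinearMap.ext fun y => evalHom_injective (E := E) (K := K) (by
    refine (evalHom_fixedActFun hN 0 y).trans ?_
    rw [ZeroMemClass.coe_zero, map_zero, LinearMap.zero_apply, LinearMap.zero_apply, map_zero])
  map_add' h h' := LinearMap.ext fun y => evalHom_injective (E := E) (K := K) (by
    refine (evalHom_fixedActFun hN (h + h') y).trans ?_
    rw [LinearMap.add_apply, map_add]
    refine Eq.trans ?_ (congrArg₂ (· + ·) (evalHom_fixedActFun hN h y)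
      (evalHom_fixedActFun hN h' y)).symm
    rw [AddMemClass.coe_add, map_add]
    rfl)
  commutes' k := LinearMap.ext fun y => evalHom_injective (E := E) (K := K) (by
    refine (evalHom_fixedActFun hN (algebraMap K _ k) y).trans ?_
    rw [Module.algebraMap_end_apply, map_smul]
    have h1 : ((algebraMap K (fixedAlgebra (conjHom (galPerm K L E) N hN)) k).1) =
        algebraMap E _ (algebraMap K E k) := IsScalarTower.algebraMap_apply K E _ k
    rw [h1, AlgHom.commutes, Module.algebraMap_end_apply, algebraMap_smul])

/-- This explicit formula for the action is what the axioms of a Hopf–Galois structure are checked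
with. -/
theorem apply_fixedAct [Fintype N] (h : fixedAlgebra (conjHom (galPerm K L E) N hN)) (y : L)
    (x : L →ₐ[K] E) : x (fixedAct hN h y) = ∑ n : N, h.1.coeff n * (n.1⁻¹ x) y := by
  refine (congrFun (evalHom_fixedActFun hN h y) x).trans ?_
  rw [permRep_apply]
  rfl

end Construction

section Construction

open MonoidAlgebra

variable {K : Type u} {L E : Type v} [Field K] [Field L] [Field E] [Algebra K L] [Algebra K E]
  [FiniteDimensional K E] [IsGalois K E] [Finite (L →ₐ[K] E)]
  {N : Subgroup (Equiv.Perm (L →ₐ[K] E))}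
  (hN : ∀ σ, galPerm K L E σ ∈ Subgroup.normalizer (N : Set (Equiv.Perm (L →ₐ[K] E))))
  [Nonempty (L →ₐ[K] E)]

theorem augHom_eq_sum {M : Type*} [Group M] [Fintype M] (x : MonoidAlgebra E M) :
    augHom K E M x = ∑ m, x.coeff m := by
  classical
  induction x using MonoidAlgebra.induction_linear with
  | zero => simp
  | add x y hx hy => simp [hx, hy, Finset.sum_add_distrib]
  | single n e => simp [augHom_single, Finsupp.single_apply]

theorem fixedAct_mul (h : fixedAlgebra (conjHom (galPerm K L E) N hN)) (y z : L) :
    fixedAct hN h (y * z) = LinearMap.mul' K L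
      (TensorProduct.map ((fixedAct hN).toLinearMap.flip y) ((fixedAct hN).toLinearMap.flip z)
        (Coalgebra.comul (R := K) h)) := by
  classical
  have := Fintype.ofFinite N
  have h1 : ∀ (x : L →ₐ[K] E) t, x (LinearMap.mul' K L
      (TensorProduct.map ((fixedAct hN).toLinearMap.flip y)
        ((fixedAct hN).toLinearMap.flip z) t)) = ∑ n : N, ∑ m : N,
        (fixedPair (conjHom (galPerm K L E) N hN) t).coeff (n, m) *
          ((n.1⁻¹ x) y * (m.1⁻¹ x) z) := by
    intro x t
    induction t using TensorProduct.induction_on with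
    | zero => simp
    | add t s ht hs =>
      simp only [map_add, ht, hs, coeff_add, Finsupp.add_apply, add_mul, Finset.sum_add_distrib]
    | tmul a b =>
      rw [TensorProduct.map_tmul, LinearMap.mul'_apply, map_mul]
      refine (congrArg₂ (· * ·) (apply_fixedAct hN a y x) (apply_fixedAct hN b z x)).trans ?_
      rw [Finset.sum_mul_sum]
      refine Finset.sum_congr rfl fun n _ => Finset.sum_congr rfl fun m _ => ?_
      rw [fixedPair, coeff_pairHom_tmul, mul_mul_mul_comm]
      rfl
  refine evalHom_injective (K := K) (E := E) (funext fun x => ?_)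
  refine (apply_fixedAct hN h _ x).trans (Eq.trans ?_ (h1 x _).symm)
  rw [comul_fixedAlgebra, fixedPair_fixedComul]
  refine Finset.sum_congr rfl fun n _ => ?_
  -- The comultiplication is supported on the diagonal, so only the terms with m = n survive.
  rw [Finset.sum_eq_single n]
  · rw [coeff_diagHom, if_pos rfl, map_mul]
  · intro m _ hm
    rw [coeff_diagHom, if_neg hm.symm, zero_mul]
  · simp

theorem fixedAct_algebraMap (h : fixedAlgebra (conjHom (galPerm K L E) N hN)) (k : K) :
    fixedAct hN h (algebraMap K L k) = algebraMap K L (Coalgebra.counit (R := K) h * k) := by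
  have := Fintype.ofFinite N
  refine evalHom_injective (K := K) (E := E) (funext fun x => ?_)
  refine (apply_fixedAct hN h _ x).trans ?_
  refine Eq.trans ?_ (x.commutes _).symm
  rw [map_mul, counit_fixedAlgebra, algebraMap_fixedCounit, augHom_eq_sum, Finset.sum_mul]
  exact Finset.sum_congr rfl fun n _ => congrArg _ ((n.1⁻¹ x).commutes k)

theorem finrank_fixedAlgebra : Module.finrank K (fixedAlgebra (conjHom (galPerm K L E) N hN)) =
    Nat.card N := by
  have := Fintype.ofFinite N
  rw [← Module.finrank_baseChange (R := E),
    (LinearEquiv.ofBijective (fixedBaseChange (conjHom (galPerm K L E) N hN)).toLinearMap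
      (fixedBaseChange_bijective _)).finrank_eq,
    (MonoidAlgebra.coeffLinearEquiv E : MonoidAlgebra E N ≃ₗ[E] N →₀ E).finrank_eq,
    Module.finrank_finsupp_self, Nat.card_eq_fintype_card]

/-- The map `L ⊗ H → End L` of a Hopf-Galois structure, for the fixed algebra. -/
noncomputable def fixedGalois :
    L ⊗[K] fixedAlgebra (conjHom (galPerm K L E) N hN) →ₗ[K] Module.End K L :=
  TensorProduct.lift (((LinearMap.mul K (Module.End K L)).comp (LinearMap.mul K L)).compl₂
        (fixedAct hN).toLinearMap)

/-- The coefficients of an element of `H ⊗ L` at an embedding of `L`. -/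
noncomputable def sliceAt (x : L →ₐ[K] E) :
    fixedAlgebra (conjHom (galPerm K L E) N hN) ⊗[K] L →ₗ[K] (N → E) :=
  TensorProduct.lift (LinearMap.mk₂ K
    (fun (h : fixedAlgebra (conjHom (galPerm K L E) N hN)) (l : L) =>
      (fun n : N => x l * h.1.coeff n : N → E))
    (fun h h' l => funext fun n => mul_add _ _ _)
    (fun k h l => funext fun n => by
      simp only [Pi.smul_apply]
      exact mul_smul_comm k (x l) (h.1.coeff n))
    (fun h l l' => funext fun n => by simp [add_mul])
    (fun k h l => funext fun n => by simp))

theorem apply_fixedGalois [Fintype N] (x : L →ₐ[K] E) (t) (y : L) :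
    x (fixedGalois hN t y) =
      ∑ n : N, sliceAt hN x ((TensorProduct.comm K _ _) t) n * (n.1⁻¹ x) y := by
  induction t using TensorProduct.induction_on with
  | zero => simp
  | add t s ht hs =>
    simp only [map_add, LinearMap.add_apply, ht, hs, Pi.add_apply, add_mul,
      Finset.sum_add_distrib]
  | tmul l h =>
    have h1 : fixedGalois hN (l ⊗ₜ h) y = l * fixedAct hN h y := rfl
    rw [h1, map_mul, apply_fixedAct, Finset.mul_sum]
    exact Finset.sum_congr rfl fun n _ => (mul_assoc _ _ _).symm

/-- Regularity makes the embeddings n⁻¹x pairwise distinct, hence linearly independent by Dedekind.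
-/
theorem sliceAt_eq_zero (hreg : IsRegularPerm N) (x : L →ₐ[K] E) (t)
    (ht : fixedGalois hN t = 0) : sliceAt hN x ((TensorProduct.comm K _ _) t) = 0 := by
  have := Fintype.ofFinite N
  have hli : LinearIndependent E fun n : N => (n.1⁻¹ x).toLinearMap := by
    refine (linearIndependent_toLinearMap K L E).comp (fun n : N => n.1⁻¹ x) ?_
    intro n m hnm
    exact inv_injective ((hreg x).1 (a₁ := n⁻¹) (a₂ := m⁻¹) hnm)
  refine funext (Fintype.linearIndependent_iff.1 hli _ (LinearMap.ext fun y => ?_))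
  have h4 := apply_fixedGalois hN x t y
  rw [ht, LinearMap.zero_apply, map_zero] at h4
  simp only [LinearMap.sum_apply, LinearMap.smul_apply, smul_eq_mul, LinearMap.zero_apply]
  exact h4.symm

theorem fixedGalois_injective (hreg : IsRegularPerm N) :
    Function.Injective (fixedGalois hN) := by
  rw [← LinearMap.ker_eq_bot, LinearMap.ker_eq_bot']
  intro t ht
  let b := Module.Basis.ofVectorSpace K (fixedAlgebra (conjHom (galPerm K L E) N hN))
  have h1 := tensor_eq_zero (F := E) (A := N → E) (Z := L →ₐ[K] E) (fun h => h.1.coeff) b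
    (linearIndependent_coeff b) (fun x => x.toLinearMap) (fun w hw => ?_) (sliceAt hN)
    (fun x h l => rfl) ((TensorProduct.comm K _ _) t) (fun x => sliceAt_eq_zero hN hreg x t ht)
  · exact (TensorProduct.comm K _ _).map_eq_zero_iff.1 h1
  · obtain ⟨x₀⟩ := ‹Nonempty (L →ₐ[K] E)›
    exact (map_eq_zero x₀).1 (hw x₀)

/-- The fixed algebra has dimension |N| = |X| = [L : K], so both sides have dimension [L : K]² and
injectivity suffices. -/
theorem fixedAct_galois [FiniteDimensional K L]
    (hcard : Nat.card (L →ₐ[K] E) = Module.finrank K L) (hreg : IsRegularPerm N) :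
    Function.Bijective
    (TensorProduct.lift
      (((LinearMap.mul K (Module.End K L)).comp (LinearMap.mul K L)).compl₂
        (fixedAct hN).toLinearMap) :
      L ⊗[K] fixedAlgebra (conjHom (galPerm K L E) N hN) →ₗ[K] Module.End K L) := by
  have hinj := fixedGalois_injective hN hreg
  obtain ⟨x₀⟩ := ‹Nonempty (L →ₐ[K] E)›
  have hNX : Nat.card N = Nat.card (L →ₐ[K] E) := Nat.card_eq_of_bijective _ (hreg x₀)
  have hH : Module.finrank K (fixedAlgebra (conjHom (galPerm K L E) N hN)) =
    Module.finrank K L := by rw [finrank_fixedAlgebra, hNX, hcard]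
  have hfd : FiniteDimensional K (fixedAlgebra (conjHom (galPerm K L E) N hN)) :=
    Module.finite_of_finrank_pos (hH ▸ Module.finrank_pos)
  have hdim : Module.finrank K (L ⊗[K] fixedAlgebra (conjHom (galPerm K L E) N hN)) =
      Module.finrank K (Module.End K L) := by
    rw [Module.finrank_tensorProduct, Module.finrank_linearMap, hH]
  exact ⟨hinj, (LinearMap.injective_iff_surjective_of_finrank_eq_finrank hdim).1 hinj⟩

/-- The Hopf-Galois structure defined by a regular subgroup which is normalised by the Galois
group. -/
noncomputable def HopfGaloisStructure.ofRegular [FiniteDimensional K L]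
    (hcard : Nat.card (L →ₐ[K] E) = Module.finrank K L) (hreg : IsRegularPerm N) :
    HopfGaloisStructure K L where
  H := fixedAlgebra (conjHom (galPerm K L E) N hN)
  act := fixedAct hN
  act_mul := fixedAct_mul hN
  act_algebraMap := fixedAct_algebraMap hN
  galois := fixedAct_galois hN hcard hreg

end Construction

/-! ### The regular subgroup of a Hopf-Galois structure -/

namespace HopfGaloisStructure

variable {K : Type u} {L E : Type v} [Field K] [Field L] [Field E] [Algebra K L] [Algebra K E]
  (S : HopfGaloisStructure K L)

/-- The map `L ⊗ H → End L` of a Hopf-Galois structure. -/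
noncomputable def galoisMap : L ⊗[K] S.H →ₗ[K] Module.End K L :=
  TensorProduct.lift
    (((LinearMap.mul K (Module.End K L)).comp (LinearMap.mul K L)).compl₂ S.act.toLinearMap)

theorem galoisMap_bijective : Function.Bijective S.galoisMap := S.galois

theorem galoisMap_tmul (l : L) (h : S.H) (y : L) : S.galoisMap (l ⊗ₜ h) y = l * S.act h y := rfl

/-- The action of `E ⊗ H` on an embedding of `L` in `E`. -/
noncomputable def hopfEval (x : L →ₐ[K] E) : E ⊗[K] S.H →ₗ[E] (L →ₗ[K] E) :=
  LinearMap.liftBaseChange E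
    ((LinearMap.llcomp K L L E x.toLinearMap).comp S.act.toLinearMap)

theorem hopfEval_tmul (x : L →ₐ[K] E) (e : E) (h : S.H) (y : L) :
    S.hopfEval x (e ⊗ₜ h) y = e * x (S.act h y) := by
  simp [hopfEval]

theorem hopfEval_galoisMap (x : L →ₐ[K] E) (t : L ⊗[K] S.H) :
    S.hopfEval x (TensorProduct.map x.toLinearMap LinearMap.id t) =
      x.toLinearMap.comp (S.galoisMap t) := by
  induction t using TensorProduct.induction_on with
  | zero => simp
  | add t s ht hs => rw [map_add, map_add, map_add, ht, hs, LinearMap.comp_add]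
  | tmul l h =>
    ext y
    rw [TensorProduct.map_tmul, hopfEval_tmul]
    exact (map_mul x l (S.act h y)).symm

/-- The maps x ∘ φ with φ in End_K(L) span Hom_K(L, E) over E, and each lies in the image because
the Galois map of the structure is surjective. -/
theorem hopfEval_surjective [FiniteDimensional K L] (x : L →ₐ[K] E) :
    Function.Surjective (S.hopfEval x) := by
  intro f
  have h1 : ∀ φ : Module.End K L, x.toLinearMap.comp φ ∈ LinearMap.range (S.hopfEval x) := by
    intro φ
    obtain ⟨t, rfl⟩ := S.galoisMap_bijective.2 φ
    exact ⟨_, S.hopfEval_galoisMap x t⟩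
  let b := Module.finBasis K L
  have h2 : f = ∑ j, f (b j) •
      x.toLinearMap.comp ((b.coord j).smulRight (1 : L)) := by
    ext y
    conv_lhs => rw [← b.sum_repr y, map_sum]
    simp only [LinearMap.sum_apply, LinearMap.smul_apply, LinearMap.comp_apply,
      LinearMap.smulRight_apply, map_smul, AlgHom.toLinearMap_apply, map_one]
    refine Finset.sum_congr rfl fun j _ => ?_
    simp [Algebra.smul_def, mul_comm]
  rw [← LinearMap.mem_range, h2]
  exact Submodule.sum_mem _ fun j _ => Submodule.smul_mem _ _ (h1 _)

theorem finrank_H [FiniteDimensional K L] : Module.finrank K S.H = Module.finrank K L := by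
  have h1 := (LinearEquiv.ofBijective _ S.galoisMap_bijective).finrank_eq
  rw [Module.finrank_tensorProduct, Module.finrank_linearMap] at h1
  exact Nat.eq_of_mul_eq_mul_left Module.finrank_pos h1

theorem finiteDimensional_H [FiniteDimensional K L] : FiniteDimensional K S.H :=
  Module.finite_of_finrank_pos (S.finrank_H ▸ Module.finrank_pos)

theorem hopfEval_bijective [FiniteDimensional K L] (x : L →ₐ[K] E) :
    Function.Bijective (S.hopfEval x) := by
  have := S.finiteDimensional_H
  have hdim : Module.finrank E (E ⊗[K] S.H) = Module.finrank E (L →ₗ[K] E) := by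
    rw [Module.finrank_baseChange, S.finrank_H, Module.finrank_linearMap, Module.finrank_self,
      mul_one]
  exact ⟨(LinearMap.injective_iff_surjective_of_finrank_eq_finrank hdim).2
    (S.hopfEval_surjective x), S.hopfEval_surjective x⟩

/-- Elements of E ⊗ H act on embeddings by precomposition, hence on the right: the left factor is
applied first. -/
theorem hopfEval_mul (x x' : L →ₐ[K] E) (θ θ' : E ⊗[K] S.H)
    (hx : S.hopfEval x θ = x'.toLinearMap) : S.hopfEval x (θ * θ') = S.hopfEval x' θ' := by
  induction θ' using TensorProduct.induction_on with
  | zero => simp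
  | add t s ht hs => rw [mul_add, map_add, map_add, ht, hs]
  | tmul e h =>
    have h1 : ∀ (θ : E ⊗[K] S.H) y, S.hopfEval x (θ * e ⊗ₜ h) y =
        e * S.hopfEval x θ (S.act h y) := by
      intro θ y
      induction θ using TensorProduct.induction_on with
      | zero => simp
      | add t s ht hs =>
        rw [add_mul, map_add, LinearMap.add_apply, ht, hs, map_add, LinearMap.add_apply, mul_add]
      | tmul e' h' =>
        rw [Algebra.TensorProduct.tmul_mul_tmul, hopfEval_tmul, hopfEval_tmul, map_mul,
          mul_comm e' e, mul_assoc]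
        rfl
    ext y
    rw [h1, hx, hopfEval_tmul]
    rfl

theorem hopfEval_map (x : L →ₐ[K] E) (σ : E ≃ₐ[K] E) (θ : E ⊗[K] S.H) (y : L) :
    S.hopfEval (galPerm K L E σ x) (TensorProduct.map σ.toLinearMap LinearMap.id θ) y =
      σ (S.hopfEval x θ y) := by
  induction θ using TensorProduct.induction_on with
  | zero => simp
  | add t s ht hs => simp only [map_add, LinearMap.add_apply, ht, hs]
  | tmul e h =>
    rw [TensorProduct.map_tmul, hopfEval_tmul, hopfEval_tmul, map_mul]
    rfl

theorem hopfEval_algebraMap (x : L →ₐ[K] E) (θ : E ⊗[K] S.H) (k : K) :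
    S.hopfEval x θ (algebraMap K L k) = Coalgebra.counit (R := E) θ * algebraMap K E k := by
  induction θ using TensorProduct.induction_on with
  | zero => simp
  | add t s ht hs => rw [map_add, map_add, LinearMap.add_apply, ht, hs, add_mul]
  | tmul e h =>
    rw [hopfEval_tmul, S.act_algebraMap, AlgHom.commutes, map_mul, TensorProduct.counit_tmul,
      CommSemiring.counit_apply, Algebra.smul_def]
    ring

theorem hopfEval_mul_apply (x : L →ₐ[K] E) (θ : E ⊗[K] S.H) (y z : L) :
    S.hopfEval x θ (y * z) = LinearMap.mul' E E (TensorProduct.map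
      ((LinearMap.applyₗ' E y).comp (S.hopfEval x)) ((LinearMap.applyₗ' E z).comp (S.hopfEval x))
      (Coalgebra.comul (R := E) θ)) := by
  induction θ using TensorProduct.induction_on with
  | zero => simp
  | add t s ht hs => rw [map_add, LinearMap.add_apply, ht, hs, map_add, map_add, map_add]
  | tmul e h =>
    have h1 : ∀ t : S.H ⊗[K] S.H, LinearMap.mul' E E (TensorProduct.map
        ((LinearMap.applyₗ' E y).comp (S.hopfEval x))
        ((LinearMap.applyₗ' E z).comp (S.hopfEval x))
        (TensorProduct.AlgebraTensorModule.tensorTensorTensorComm K E K E E E S.H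
            S.H (((1 : E) ⊗ₜ e) ⊗ₜ t))) =
        e * x (LinearMap.mul' K L (TensorProduct.map (S.act.toLinearMap.flip y)
          (S.act.toLinearMap.flip z) t)) := by
      intro t
      induction t using TensorProduct.induction_on with
      | zero =>
        rw [TensorProduct.tmul_zero, LinearEquiv.map_zero, map_zero, map_zero, map_zero, map_zero,
          map_zero, mul_zero]
      | add t s ht hs =>
        rw [TensorProduct.tmul_add, LinearEquiv.map_add, map_add, map_add, ht, hs, map_add,
          map_add, map_add, mul_add]
      | tmul a b =>
        rw [TensorProduct.AlgebraTensorModule.tensorTensorTensorComm_tmul,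
          TensorProduct.map_tmul, TensorProduct.map_tmul, LinearMap.mul'_apply,
          LinearMap.mul'_apply, map_mul]
        have e1 : ((LinearMap.applyₗ' E y).comp (S.hopfEval x)) ((1 : E) ⊗ₜ[K] a) =
          x (S.act a y) := (S.hopfEval_tmul x 1 a y).trans (one_mul _)
        have e2 : ((LinearMap.applyₗ' E z).comp (S.hopfEval x)) (e ⊗ₜ[K] b) =
          e * x (S.act b z) := S.hopfEval_tmul x e b z
        rw [e1, e2, mul_left_comm]
        rfl
    rw [TensorProduct.comul_tmul, CommSemiring.comul_apply, h1, ← S.act_mul, hopfEval_tmul]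

/-- The counit condition makes the K-linear map unital, and Δθ = θ ⊗ θ makes it multiplicative. -/
theorem exists_hopfEval_eq_of_isGroupLikeElem (x : L →ₐ[K] E) (θ : E ⊗[K] S.H)
    (hθ : IsGroupLikeElem E θ) : ∃ x' : L →ₐ[K] E, S.hopfEval x θ = x'.toLinearMap := by
  have h1 : S.hopfEval x θ 1 = 1 := by
    have := S.hopfEval_algebraMap x θ 1
    rwa [map_one (algebraMap K L), hθ.counit_eq_one, map_one (algebraMap K E), mul_one] at this
  have h2 : ∀ y z, S.hopfEval x θ (y * z) = S.hopfEval x θ y * S.hopfEval x θ z := by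
    intro y z
    rw [hopfEval_mul_apply, hθ.comul_eq_tmul_self]
    rfl
  exact ⟨AlgHom.ofLinearMap (S.hopfEval x θ) h1 h2, rfl⟩

section OfType

variable {M : Type*} [Group M] (Φ : (E ⊗[K] S.H) ≃ₐc[E] MonoidAlgebra E M)

/-- The group-like element that corresponds to an element of the group. -/
noncomputable def groupLike (m : M) : E ⊗[K] S.H := Φ.symm (MonoidAlgebra.single m 1)

theorem isGroupLikeElem_groupLike (m : M) : IsGroupLikeElem E (S.groupLike Φ m) :=
  (MonoidAlgebra.isGroupLikeElem_single_one (R := E) (A := E) m).map Φ.symm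

theorem groupLike_mul (m m' : M) : S.groupLike Φ (m * m') =
    S.groupLike Φ m * S.groupLike Φ m' := by
  rw [groupLike, groupLike, groupLike, ← map_mul, MonoidAlgebra.single_mul_single, one_mul]

theorem groupLike_one : S.groupLike Φ 1 = 1 := map_one Φ.symm

/-- The map on embeddings defined by an element of the group. -/
noncomputable def permFun (m : M) (x : L →ₐ[K] E) : L →ₐ[K] E :=
  (S.exists_hopfEval_eq_of_isGroupLikeElem x _ (S.isGroupLikeElem_groupLike Φ m)).choose

theorem hopfEval_groupLike (m : M) (x : L →ₐ[K] E) :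
    S.hopfEval x (S.groupLike Φ m) = (S.permFun Φ m x).toLinearMap :=
  (S.exists_hopfEval_eq_of_isGroupLikeElem x _ (S.isGroupLikeElem_groupLike Φ m)).choose_spec

theorem permFun_one (x : L →ₐ[K] E) : S.permFun Φ 1 x = x := by
  refine AlgHom.toLinearMap_injective ?_
  rw [← hopfEval_groupLike, groupLike_one]
  ext y
  rw [Algebra.TensorProduct.one_def, hopfEval_tmul, one_mul, map_one]
  rfl

theorem permFun_mul (m m' : M) (x : L →ₐ[K] E) :
    S.permFun Φ (m * m') x = S.permFun Φ m' (S.permFun Φ m x) := by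
  refine AlgHom.toLinearMap_injective ?_
  rw [← hopfEval_groupLike, ← hopfEval_groupLike, groupLike_mul]
  exact S.hopfEval_mul _ _ _ _ (S.hopfEval_groupLike Φ m x)

/-- The action of the group of the type on the set of embeddings. -/
noncomputable def permHom : M →* Equiv.Perm (L →ₐ[K] E) where
  toFun m :=
    -- The inverse converts the right action of `permFun_mul` into a homomorphism.
    { toFun := S.permFun Φ m⁻¹
      invFun := S.permFun Φ m
      left_inv := fun x => by rw [← permFun_mul, inv_mul_cancel, permFun_one]
      right_inv := fun x => by rw [← permFun_mul, mul_inv_cancel, permFun_one] }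
  map_one' := Equiv.ext fun x => by
    refine (congrArg (fun m => S.permFun Φ m x) inv_one).trans (S.permFun_one Φ x)
  map_mul' m m' := Equiv.ext fun x => by
    refine (congrArg (fun m => S.permFun Φ m x) (mul_inv_rev m m')).trans
      (S.permFun_mul Φ _ _ x)

theorem permHom_apply (m : M) (x : L →ₐ[K] E) : S.permHom Φ m x = S.permFun Φ m⁻¹ x := rfl

/-- Evaluation at x is injective on E ⊗ H, so distinct group-like elements give distinct embeddings,
and the order of M is dim H = [L : K] = |X|. -/
theorem permFun_bijective [FiniteDimensional K L]
    (hcard : Nat.card (L →ₐ[K] E) = Module.finrank K L) (x : L →ₐ[K] E) :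
    Function.Bijective fun m => S.permFun Φ m x := by
  have hinj : Function.Injective fun m => S.permFun Φ m x := by
    intro m m' h
    have h1 : S.groupLike Φ m = S.groupLike Φ m' := by
      refine (S.hopfEval_bijective x).1 ?_
      rw [hopfEval_groupLike, hopfEval_groupLike]
      exact congrArg _ h
    have h2 := Φ.symm.injective h1
    exact (MonoidAlgebra.single_left_inj one_ne_zero).1 h2
  have hfin : Finite (L →ₐ[K] E) :=
    Nat.finite_of_card_ne_zero (hcard ▸ Module.finrank_pos.ne')
  have hM : Finite M := Finite.of_injective _ hinj
  have := Fintype.ofFinite M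
  have hdim : Nat.card M = Nat.card (L →ₐ[K] E) := by
    rw [hcard, ← S.finrank_H, ← Module.finrank_baseChange (R := E),
      Φ.toCoalgEquiv.toLinearEquiv.finrank_eq,
      (MonoidAlgebra.coeffLinearEquiv E : MonoidAlgebra E M ≃ₗ[E] M →₀ E).finrank_eq,
      Module.finrank_finsupp_self, Nat.card_eq_fintype_card]
  exact (Nat.bijective_iff_injective_and_card _).2 ⟨hinj, hdim⟩

theorem permHom_bijective [FiniteDimensional K L]
    (hcard : Nat.card (L →ₐ[K] E) = Module.finrank K L) (x : L →ₐ[K] E) :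
    Function.Bijective fun m => S.permHom Φ m x :=
  (S.permFun_bijective Φ hcard x).comp (Equiv.inv M).bijective

end OfType

end HopfGaloisStructure

/-! ### The regular subgroup determines the Hopf–Galois structure -/

namespace HopfGaloisStructure

variable {K : Type u} {L E : Type v} [Field K] [Field L] [Field E] [Algebra K L] [Algebra K E]
  (S T : HopfGaloisStructure K L)

/-- The permutations of the embeddings of `L` which are induced by an element of `E ⊗ H`. -/
def permSet (E : Type v) [Field E] [Algebra K E] : Set (Equiv.Perm (L →ₐ[K] E)) :=
  {π | ∃ θ : E ⊗[K] S.H, ∀ x, S.hopfEval x θ = (π x).toLinearMap}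

/-- The right-hand side involves neither M nor Φ, so the regular subgroup is an invariant of the
structure. A permutation induced by θ is recognised at one embedding, where evaluation is injective.
-/
theorem range_permHom [FiniteDimensional K L] {M : Type*} [Group M]
    (hcard : Nat.card (L →ₐ[K] E) = Module.finrank K L) [hne : Nonempty (L →ₐ[K] E)]
    (Φ : (E ⊗[K] S.H) ≃ₐc[E] MonoidAlgebra E M) :
    ((S.permHom Φ).range : Set (Equiv.Perm (L →ₐ[K] E))) = S.permSet E := by
  ext π
  constructor
  · rintro ⟨m, rfl⟩
    exact ⟨S.groupLike Φ m⁻¹, S.hopfEval_groupLike Φ m⁻¹⟩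
  · rintro ⟨θ, hθ⟩
    obtain ⟨x₀⟩ := hne
    obtain ⟨m, hm⟩ := (S.permHom_bijective Φ hcard x₀).2 (π x₀)
    have h1 : θ = S.groupLike Φ m⁻¹ := by
      refine (S.hopfEval_bijective x₀).1 ?_
      rw [hθ, hopfEval_groupLike, ← permHom_apply]
      exact congrArg _ hm.symm
    refine ⟨m, Equiv.ext fun x => AlgHom.toLinearMap_injective ?_⟩
    rw [← hθ, h1, hopfEval_groupLike]
    rfl

theorem conj_mem_permSet (σ : E ≃ₐ[K] E) {π : Equiv.Perm (L →ₐ[K] E)} (hπ : π ∈ S.permSet E) :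
    galPerm K L E σ * π * (galPerm K L E σ)⁻¹ ∈ S.permSet E := by
  obtain ⟨θ, hθ⟩ := hπ
  refine ⟨TensorProduct.map σ.toLinearMap LinearMap.id θ, fun x => LinearMap.ext fun y => ?_⟩
  obtain ⟨x, rfl⟩ := (galPerm K L E σ).surjective x
  rw [hopfEval_map, hθ]
  simp [galPerm_apply]

theorem act_injective : Function.Injective S.act := by
  rw [injective_iff_map_eq_zero]
  intro h hh
  have h1 : (1 : L) ⊗ₜ[K] h = 0 := by
    refine S.galoisMap_bijective.1 (LinearMap.ext fun y => ?_)
    rw [galoisMap_tmul, hh]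
    simp
  have h2 : Function.Injective (Algebra.TensorProduct.includeRight : S.H →ₐ[K] L ⊗[K] S.H) :=
    Algebra.TensorProduct.includeRight_injective (algebraMap K L).injective
  exact h2 (h1.trans (map_zero _).symm)

/-- Write φ as the image of t in L ⊗ H. A common θ for all embeddings forces every x to send t to θ;
comparing x₀ with σx₀ shows that the coordinates of t are Galois invariant, so t comes from H. The
image of H in End_K(L) is thus visible after base change. -/
theorem mem_range_act_iff [FiniteDimensional K L] [FiniteDimensional K E] [IsGalois K E]
    [hne : Nonempty (L →ₐ[K] E)] (φ : Module.End K L) :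
    φ ∈ S.act.range ↔ (fun x : L →ₐ[K] E => x.toLinearMap.comp φ) ∈
      LinearMap.range (LinearMap.pi fun x : L →ₐ[K] E => S.hopfEval x) := by
  constructor
  · rintro ⟨h, rfl⟩
    refine ⟨1 ⊗ₜ h, funext fun x => LinearMap.ext fun y => ?_⟩
    exact (S.hopfEval_tmul x 1 h y).trans (one_mul _)
  · rintro ⟨θ, hθ⟩
    have hθ' : ∀ x, S.hopfEval x θ = x.toLinearMap.comp φ := fun x => congrFun hθ x
    obtain ⟨t, ht⟩ := S.galoisMap_bijective.2 φ
    have h1 : ∀ x : L →ₐ[K] E, TensorProduct.map x.toLinearMap LinearMap.id t = θ := by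
      intro x
      refine (S.hopfEval_bijective x).1 ?_
      rw [hopfEval_galoisMap, ht, hθ']
    have := S.finiteDimensional_H
    let b := Module.finBasis K S.H
    let bL := Algebra.TensorProduct.basis L b
    let bE := Algebra.TensorProduct.basis E b
    have h2 : ∀ (x : L →ₐ[K] E) (t : L ⊗[K] S.H) i,
        bE.repr (TensorProduct.map x.toLinearMap LinearMap.id t) i = x (bL.repr t i) := by
      intro x t i
      induction t using TensorProduct.induction_on with
      | zero => simp
      | add t s ht hs => simp only [map_add, Finsupp.add_apply, ht, hs]
      | tmul l h => simp [bE, bL, Algebra.TensorProduct.basis_repr_tmul]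
    have h3 : ∀ i, ∃ k : K, bL.repr t i = algebraMap K L k := by
      intro i
      obtain ⟨x₀⟩ := hne
      have h4 : x₀ (bL.repr t i) ∈ Set.range (algebraMap K E) := by
        rw [IsGalois.mem_range_algebraMap_iff_fixed]
        intro σ
        have h5 := h2 (galPerm K L E σ x₀) t i
        rw [h1, ← h1 x₀, h2] at h5
        exact h5.symm
      obtain ⟨k, hk⟩ := h4
      refine ⟨k, x₀.toRingHom.injective ?_⟩
      exact hk.symm.trans (x₀.commutes k).symm
    choose k hk using h3
    refine ⟨∑ i, k i • b i, ?_⟩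
    have h5 : t = 1 ⊗ₜ (∑ i, k i • b i) := by
      conv_lhs => rw [← bL.sum_repr t]
      rw [TensorProduct.tmul_sum]
      refine Finset.sum_congr rfl fun i _ => ?_
      rw [hk, TensorProduct.tmul_smul]
      simp [bL]
    rw [← ht]
    refine LinearMap.ext fun y => ?_
    conv_rhs => rw [h5, galoisMap_tmul, one_mul]
    rfl

/-- The group-like elements span E[M], and the permutations that they induce form the whole of
`permSet`. -/
theorem range_pi_hopfEval [FiniteDimensional K L] {M : Type*} [Group M]
    (hcard : Nat.card (L →ₐ[K] E) = Module.finrank K L) [hne : Nonempty (L →ₐ[K] E)]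
    (Φ : (E ⊗[K] S.H) ≃ₐc[E] MonoidAlgebra E M) :
    LinearMap.range (LinearMap.pi fun x : L →ₐ[K] E => S.hopfEval x) =
      Submodule.span E ((fun (π : Equiv.Perm (L →ₐ[K] E)) x => (π x).toLinearMap) ''
        S.permSet E) := by
  apply le_antisymm
  · rintro _ ⟨θ, rfl⟩
    obtain ⟨a, rfl⟩ : ∃ a, θ = Φ.symm a := ⟨Φ θ, (Φ.symm_apply_apply θ).symm⟩
    induction a using MonoidAlgebra.induction_linear with
    | zero => rw [map_zero, map_zero]; exact Submodule.zero_mem _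
    | add a b ha hb => rw [map_add, map_add]; exact Submodule.add_mem _ ha hb
    | single m e =>
      have h1 : Φ.symm (MonoidAlgebra.single m e) = e • S.groupLike Φ m := by
        rw [groupLike, ← map_smul]
        simp
      rw [h1, map_smul]
      refine Submodule.smul_mem _ _ (Submodule.subset_span ?_)
      refine ⟨S.permHom Φ m⁻¹, ?_, ?_⟩
      · rw [← S.range_permHom hcard Φ]
        exact ⟨_, rfl⟩
      · funext x
        refine Eq.trans ?_ (S.hopfEval_groupLike Φ m x).symm
        exact congrArg (fun k => (S.permFun Φ k x).toLinearMap) (inv_inv m)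
  · refine Submodule.span_le.2 ?_
    rintro _ ⟨π, ⟨θ, hθ⟩, rfl⟩
    exact ⟨θ, funext hθ⟩

theorem range_act_eq_of_permSet_eq [FiniteDimensional K L] [FiniteDimensional K E] [IsGalois K E]
    {M M' : Type*} [Group M] [Group M']
    (hcard : Nat.card (L →ₐ[K] E) = Module.finrank K L) [Nonempty (L →ₐ[K] E)]
    (Φ : (E ⊗[K] S.H) ≃ₐc[E] MonoidAlgebra E M)
    (Φ' : (E ⊗[K] T.H) ≃ₐc[E] MonoidAlgebra E M') (h : S.permSet E = T.permSet E) :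
    S.act.range = T.act.range := by
  ext φ
  rw [S.mem_range_act_iff (E := E), T.mem_range_act_iff (E := E),
    S.range_pi_hopfEval hcard Φ, T.range_pi_hopfEval hcard Φ', h]

theorem linearIndependent_act {ι : Type*} (b : Module.Basis ι K S.H) :
    LinearIndependent L fun i => S.act (b i) := by
  rw [linearIndependent_iff']
  intro s g hg i hi
  have h1 : ∑ i ∈ s, g i ⊗ₜ[K] b i = 0 := by
    refine S.galoisMap_bijective.1 ?_
    rw [map_sum, map_zero, ← hg]
    rfl
  have h2 : ∑ i ∈ s, g i • Algebra.TensorProduct.basis L b i = 0 := by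
    rw [← h1]
    refine Finset.sum_congr rfl fun i _ => ?_
    simp [TensorProduct.smul_tmul']
  exact linearIndependent_iff'.1 (Algebra.TensorProduct.basis L b).linearIndependent s g h2 i hi

/-- L-independence of a basis of H inside End_K(L), together with faithfulness of the action, shows
that tensors in H ⊗ H are determined by their effect on products. -/
theorem eq_of_map_act_eq (t s : S.H ⊗[K] S.H)
    (h : ∀ y z, LinearMap.mul' K L (TensorProduct.map (S.act.toLinearMap.flip y)
      (S.act.toLinearMap.flip z) t) = LinearMap.mul' K L (TensorProduct.map
      (S.act.toLinearMap.flip y) (S.act.toLinearMap.flip z) s)) : t = s := by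
  rw [← sub_eq_zero]
  let b := Module.Basis.ofVectorSpace K S.H
  let Φ : L → S.H ⊗[K] S.H →ₗ[K] Module.End K L := fun z =>
    TensorProduct.lift (LinearMap.mk₂ K (fun h h' => (S.act h' z) • S.act h)
      (fun h h' l => by simp [smul_add])
      (fun k h l => by rw [map_smul, smul_comm])
      (fun h l l' => by simp [add_smul])
      (fun k h l => by simp))
  have hΦ : ∀ z t y, Φ z t y = LinearMap.mul' K L (TensorProduct.map
      (S.act.toLinearMap.flip y) (S.act.toLinearMap.flip z) t) := by
    intro z t y
    induction t using TensorProduct.induction_on with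
    | zero => simp
    | add t s ht hs => simp only [map_add, LinearMap.add_apply, ht, hs]
    | tmul a b => exact mul_comm _ _
  refine tensor_eq_zero (F := L) (A := Module.End K L) (Z := L) S.act b
    (S.linearIndependent_act b) (fun z => S.act.toLinearMap.flip z) (fun w hw => ?_) Φ
    (fun _ _ _ => rfl) _ (fun z => LinearMap.ext fun y => ?_)
  · exact S.act_injective ((LinearMap.ext hw).trans (map_zero _).symm)
  · rw [hΦ, map_sub, map_sub, h, sub_self, LinearMap.zero_apply]

/-- The action is faithful, so equal images give an algebra isomorphism. Counit and comultiplication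
are forced by the action on K and on products, so it is automatically one of bialgebras. -/
theorem equivalent_of_range_eq (h : S.act.range = T.act.range) : S.Equivalent T := by
  let f : S.H ≃ₐ[K] T.H := (AlgEquiv.ofInjective S.act S.act_injective).trans
    ((Subalgebra.equivOfEq _ _ h).trans (AlgEquiv.ofInjective T.act T.act_injective).symm)
  have hf : ∀ a, T.act (f a) = S.act a := by
    intro a
    have := (AlgEquiv.ofInjective T.act T.act_injective).apply_symm_apply
      (Subalgebra.equivOfEq _ _ h (AlgEquiv.ofInjective S.act S.act_injective a))
    exact congrArg Subtype.val this
  refine ⟨BialgEquiv.ofAlgEquiv f (AlgHom.ext fun a => ?_) (AlgHom.ext fun a => ?_), hf⟩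
  · have h1 := T.act_algebraMap (f a) 1
    rw [hf, S.act_algebraMap, mul_one, mul_one] at h1
    exact ((algebraMap K L).injective h1).symm
  · refine T.eq_of_map_act_eq _ _ fun y z => ?_
    have h1 := T.act_mul (f a) y z
    rw [hf, S.act_mul] at h1
    refine Eq.trans ?_ h1
    have h2 : ∀ t, LinearMap.mul' K L (TensorProduct.map (T.act.toLinearMap.flip y)
        (T.act.toLinearMap.flip z) (Algebra.TensorProduct.map (f : S.H →ₐ[K] T.H)
          (f : S.H →ₐ[K] T.H) t)) =
        LinearMap.mul' K L (TensorProduct.map (S.act.toLinearMap.flip y)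
        (S.act.toLinearMap.flip z) t) := by
      intro t
      induction t using TensorProduct.induction_on with
      | zero => simp
      | add t s ht hs => simp only [map_add, ht, hs]
      | tmul c d =>
        rw [Algebra.TensorProduct.map_tmul, TensorProduct.map_tmul, TensorProduct.map_tmul]
        exact congrArg₂ (fun (φ ψ : Module.End K L) => φ y * ψ z) (hf c) (hf d)
    exact h2 _

theorem permSet_subset_of_equivalent (h : S.Equivalent T) : S.permSet E ⊆ T.permSet E := by
  obtain ⟨f, hf⟩ := h
  rintro π ⟨θ, hθ⟩
  let F : S.H →ₗ[K] T.H := f.toCoalgEquiv.toLinearEquiv.toLinearMap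
  have hF : ∀ a, T.act (F a) = S.act a := hf
  refine ⟨TensorProduct.map LinearMap.id F θ, fun x => (Eq.trans ?_ (hθ x))⟩
  ext y
  generalize θ = θ
  induction θ using TensorProduct.induction_on with
  | zero => simp
  | add t s ht hs => simp only [map_add, LinearMap.add_apply, ht, hs]
  | tmul e a => rw [TensorProduct.map_tmul, hopfEval_tmul, hopfEval_tmul, hF]; rfl

theorem permSet_eq_of_equivalent (h : S.Equivalent T) : S.permSet E = T.permSet E :=
  (S.permSet_subset_of_equivalent T h).antisymm
    (T.permSet_subset_of_equivalent S (equivalent_equivalence.symm h))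

/-- The group-like element n of E[N] acts on X by n⁻¹ through `permFun`, hence by n through
`permHom`: the construction gives back N. -/
theorem permSet_ofRegular [FiniteDimensional K E] [IsGalois K E] [Finite (L →ₐ[K] E)]
    {N : Subgroup (Equiv.Perm (L →ₐ[K] E))}
    (hN : ∀ σ, galPerm K L E σ ∈ Subgroup.normalizer (N : Set (Equiv.Perm (L →ₐ[K] E))))
    [hne : Nonempty (L →ₐ[K] E)] [FiniteDimensional K L]
    (hcard : Nat.card (L →ₐ[K] E) = Module.finrank K L) (hreg : IsRegularPerm N) :
    (ofRegular hN hcard hreg).permSet E = N := by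
  classical
  have := Fintype.ofFinite N
  let Φ : (E ⊗[K] (ofRegular hN hcard hreg).H) ≃ₐc[E] MonoidAlgebra E N :=
    fixedBaseChangeEquiv (conjHom (galPerm K L E) N hN)
  have h1 : ∀ θ x y, (ofRegular hN hcard hreg).hopfEval x θ y =
      ∑ n : N, (Φ θ).coeff n * (n.1⁻¹ x) y := by
    intro θ x y
    induction θ using TensorProduct.induction_on with
    | zero => simp
    | add t s ht hs =>
      simp only [map_add, LinearMap.add_apply, ht, hs, MonoidAlgebra.coeff_add,
        Finsupp.add_apply, add_mul, Finset.sum_add_distrib]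
    | tmul e h =>
      rw [hopfEval_tmul]
      refine (congrArg (e * ·) (apply_fixedAct hN h y x)).trans ?_
      rw [Finset.mul_sum]
      refine Finset.sum_congr rfl fun n _ => ?_
      rw [← mul_assoc]
      refine congrArg (· * _) ?_
      exact (congrArg (fun a : MonoidAlgebra E N => a.coeff n)
        (fixedBaseChange_tmul (conjHom (galPerm K L E) N hN) e h)).symm
  have h2 : ∀ n : N, ∀ x, (ofRegular hN hcard hreg).permFun Φ n x = n.1⁻¹ x := by
    intro n x
    refine AlgHom.toLinearMap_injective ?_
    rw [← hopfEval_groupLike]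
    ext y
    rw [h1, groupLike, BialgEquiv.apply_symm_apply, Finset.sum_eq_single n]
    · simp
    · intro m _ hm
      simp [hm.symm]
    · simp
  rw [← range_permHom _ hcard Φ]
  have h3 : ∀ n : N, (ofRegular hN hcard hreg).permHom Φ n = n.1 := by
    intro n
    ext1 x
    rw [permHom_apply, h2]
    simp
  ext π
  constructor
  · rintro ⟨n, rfl⟩
    rw [h3]
    exact n.2
  · intro hπ
    exact ⟨⟨π, hπ⟩, h3 _⟩

end HopfGaloisStructure

/-! ### The Greither-Pareigis correspondence -/

/-- The regular subgroups of the symmetric group which are normalised by a group of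
permutations. -/
def regularNormalized {Γ X : Type*} [Group Γ] (ρ : Γ →* Equiv.Perm X) :
    Set (Subgroup (Equiv.Perm X)) :=
  {N | IsRegularPerm N ∧ ∀ σ, ρ σ ∈ Subgroup.normalizer (N : Set (Equiv.Perm X))}

section NormalClosure

variable (K : Type u) (L : Type v) [Field K] [Field L] [Algebra K L] [FiniteDimensional K L]
  [Algebra.IsSeparable K L]

instance isGalois_normalClos : IsGalois K (NormalClos K L) where
  to_isSeparable := by
    have h1 : IntermediateField.normalClosure K L (AlgebraicClosure L) ≤
        separableClosure K (AlgebraicClosure L) := by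
      refine iSup_le fun f => ?_
      rintro _ ⟨y, rfl⟩
      refine mem_separableClosure_iff.2 ?_
      have h2 := Algebra.IsSeparable.isSeparable K y
      rwa [IsSeparable, ← minpoly.algHom_eq f f.injective] at h2
    exact (le_separableClosure_iff _ _ _).1 h1
  to_normal := inferInstance

instance nonempty_algHom_normalClos : Nonempty (L →ₐ[K] NormalClos K L) :=
  ⟨IsScalarTower.toAlgHom K L _⟩

theorem card_algHom_normalClos :
    Nat.card (L →ₐ[K] NormalClos K L) = Module.finrank K L := by
  have := Fintype.ofEquiv _ (normalClosure.algHomEquiv K L (AlgebraicClosure L)).symm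
  rw [← AlgHom.card K L (AlgebraicClosure L), ← Nat.card_eq_fintype_card]
  exact Nat.card_congr (normalClosure.algHomEquiv K L (AlgebraicClosure L))

instance finite_algHom_normalClos : Finite (L →ₐ[K] NormalClos K L) :=
  Nat.finite_of_card_ne_zero (card_algHom_normalClos K L ▸ Module.finrank_pos.ne')

/-- The action of the Galois group of the normal closure on the embeddings. -/
noncomputable abbrev normalClosPerm : (NormalClos K L ≃ₐ[K] NormalClos K L) →*
    Equiv.Perm (L →ₐ[K] NormalClos K L) :=
  galPerm K L (NormalClos K L)

variable {K L}

theorem HopfGaloisStructure.exists_mulEquiv_of_isOfType (S : HopfGaloisStructure K L) {M : Type}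
    [Group M] (h : S.IsOfType M) :
    ∃ N ∈ regularNormalized (normalClosPerm K L), Nonempty (M ≃* N) ∧
      (N : Set (Equiv.Perm (L →ₐ[K] NormalClos K L))) = S.permSet (NormalClos K L) := by
  obtain ⟨Φ⟩ := h
  have hr := S.range_permHom (card_algHom_normalClos K L) Φ
  have hb := S.permHom_bijective Φ (card_algHom_normalClos K L)
  have hinj : Function.Injective (S.permHom Φ) := by
    intro a b hab
    obtain ⟨x₀⟩ := nonempty_algHom_normalClos K L
    exact (hb x₀).1 (congrArg (fun f : Equiv.Perm _ => f x₀) hab)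
  have hmem : ∀ π, π ∈ (S.permHom Φ).range ↔ π ∈ S.permSet (NormalClos K L) := fun π => by
    rw [← hr]; rfl
  refine ⟨(S.permHom Φ).range, ⟨fun x => ⟨?_, ?_⟩, fun σ => ?_⟩,
    ⟨MonoidHom.ofInjective hinj⟩, hr⟩
  · rintro ⟨_, a, rfl⟩ ⟨_, b, rfl⟩ hab
    exact Subtype.ext (congrArg (S.permHom Φ) ((hb x).1 hab))
  · intro y
    obtain ⟨m, hm⟩ := (hb x).2 y
    exact ⟨⟨_, m, rfl⟩, hm⟩
  · rw [Subgroup.mem_normalizer_iff]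
    intro π
    refine ⟨fun h => ?_, fun h => ?_⟩
    · exact (hmem _).2 (S.conj_mem_permSet σ ((hmem _).1 h))
    · have h1 := S.conj_mem_permSet σ⁻¹ ((hmem _).1 h)
      rw [map_inv] at h1
      refine (hmem _).2 ?_
      convert h1 using 1
      group

/-- Types are groups in `Type`; N is finite, so it can be shrunk to that universe. -/
theorem isOfType_ofRegular {N : Subgroup (Equiv.Perm (L →ₐ[K] NormalClos K L))}
    (hN : N ∈ regularNormalized (normalClosPerm K L)) :
    (HopfGaloisStructure.ofRegular hN.2 (card_algHom_normalClos K L) hN.1).IsOfType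
      (Shrink.{0} N) :=
  ⟨(fixedBaseChangeEquiv (conjHom (galPerm K L (NormalClos K L)) N hN.2)).trans
    (MonoidAlgebra.domCongrBialgEquiv (R := NormalClos K L) (A := NormalClos K L)
      (Shrink.mulEquiv : Shrink.{0} N ≃* N).symm)⟩

theorem exists_hopfGaloisStructure_iff
    (P : ∀ (M : Type) [Group M], Prop) (Q : Subgroup (Equiv.Perm (L →ₐ[K] NormalClos K L)) → Prop)
    (hPQ : ∀ (M : Type) [Group M] (N : Subgroup (Equiv.Perm (L →ₐ[K] NormalClos K L)))
      (_ : M ≃* N), P M ↔ Q N) :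
    (∃ S : HopfGaloisStructure K L, ∃ (M : Type) (_ : Group M), P M ∧ S.IsOfType M) ↔
      ∃ N ∈ regularNormalized (normalClosPerm K L), Q N := by
  constructor
  · rintro ⟨S, M, _, hP, hS⟩
    obtain ⟨N, hN, ⟨f⟩, -⟩ := S.exists_mulEquiv_of_isOfType hS
    exact ⟨N, hN, (hPQ M N f).1 hP⟩
  · rintro ⟨N, hN, hQ⟩
    exact ⟨_, Shrink.{0} N, inferInstance, (hPQ _ N Shrink.mulEquiv).2 hQ, isOfType_ofRegular hN⟩

/-- The bijection sends N to the class of `ofRegular`: N is recovered as the set of induced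
permutations, and two structures with the same set of induced permutations are equivalent. -/
theorem ncard_hopfGaloisStructure
    (P : ∀ (M : Type) [Group M], Prop) (Q : Subgroup (Equiv.Perm (L →ₐ[K] NormalClos K L)) → Prop)
    (hPQ : ∀ (M : Type) [Group M] (N : Subgroup (Equiv.Perm (L →ₐ[K] NormalClos K L)))
      (_ : M ≃* N), P M ↔ Q N) :
    Set.ncard {c : Quotient (HopfGaloisStructure.isoSetoid K L) |
      ∃ S : HopfGaloisStructure K L, (∃ (M : Type) (_ : Group M), P M ∧ S.IsOfType M) ∧
      Quotient.mk (HopfGaloisStructure.isoSetoid K L) S = c} =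
    Set.ncard {N | N ∈ regularNormalized (normalClosPerm K L) ∧ Q N} := by
  symm
  refine Set.ncard_congr (fun N hN => Quotient.mk (HopfGaloisStructure.isoSetoid K L)
    (HopfGaloisStructure.ofRegular hN.1.2 (card_algHom_normalClos K L) hN.1.1)) ?_ ?_ ?_
  · rintro N ⟨hN, hQ⟩
    exact ⟨_, ⟨Shrink.{0} N, inferInstance, (hPQ _ N Shrink.mulEquiv).2 hQ,
      isOfType_ofRegular hN⟩, rfl⟩
  · rintro N N' ⟨hN, _⟩ ⟨hN', _⟩ h
    have h1 := HopfGaloisStructure.permSet_eq_of_equivalent (E := NormalClos K L) _ _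
      (Quotient.exact h)
    rw [HopfGaloisStructure.permSet_ofRegular, HopfGaloisStructure.permSet_ofRegular] at h1
    exact SetLike.coe_injective h1
  · rintro _ ⟨S, ⟨M, _, hP, hS⟩, rfl⟩
    obtain ⟨N, hN, ⟨f⟩, hs⟩ := S.exists_mulEquiv_of_isOfType hS
    refine ⟨N, ⟨hN, (hPQ M N f).1 hP⟩, Quotient.sound ?_⟩
    obtain ⟨Φ⟩ := hS
    obtain ⟨Ψ⟩ := isOfType_ofRegular hN
    refine HopfGaloisStructure.equivalent_of_range_eq _ _
      (HopfGaloisStructure.range_act_eq_of_permSet_eq (E := NormalClos K L) _ _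
        (card_algHom_normalClos K L) Ψ Φ ?_)
    rw [HopfGaloisStructure.permSet_ofRegular, hs]

end NormalClosure

/-! ### Transport along isomorphisms of permutation groups -/

/-- Both actions are transitive with the same point stabiliser, so both are the action on its
cosets. -/
theorem exists_equivariant_equiv {G X Y : Type*} [Group G] [MulAction G X]
    [MulAction.IsPretransitive G X] (ρ : G →* Equiv.Perm Y) (hρ : ∀ a b, ∃ g, ρ g a = b) (x : X)
    (y : Y) (h : ∀ g : G, g • x = x ↔ ρ g y = y) :
    ∃ e : X ≃ Y, ∀ (g : G) z, e (g • z) = ρ g (e z) := by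
  have h1 : ∀ g k : G, g • x = k • x ↔ ρ g y = ρ k y := by
    intro g k
    rw [← inv_smul_eq_iff, smul_smul, h, map_mul, Equiv.Perm.mul_apply, map_inv,
      Equiv.Perm.inv_eq_iff_eq]
  choose s hs using fun z => MulAction.exists_smul_eq G x z
  have h2 : ∀ (g : G) z, ρ (s (g • z)) y = ρ g (ρ (s z) y) := by
    intro g z
    rw [← Equiv.Perm.mul_apply, ← map_mul, ← h1, hs, mul_smul, hs]
  refine ⟨Equiv.ofBijective (fun z => ρ (s z) y) ⟨fun a b hab => ?_, fun b => ?_⟩, h2⟩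
  · rw [← hs a, ← hs b]
    exact (h1 _ _).2 hab
  · obtain ⟨g, hg⟩ := hρ y b
    exact ⟨g • x, by rw [← hg]; exact (h1 _ _).1 (hs _)⟩

theorem map_mem_regularNormalized {Γ Γ' X Y : Type*} [Group Γ] [Group Γ'] (e : X ≃ Y)
    {ρ : Γ →* Equiv.Perm X} {ρ' : Γ' →* Equiv.Perm Y} {θ : Γ → Γ'}
    (hθ : Function.Surjective θ) (h : ∀ g x, e (ρ g x) = ρ' (θ g) (e x))
    {N : Subgroup (Equiv.Perm X)} :
    N.map e.permCongrHom.toMonoidHom ∈ regularNormalized ρ' ↔ N ∈ regularNormalized ρ := by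
  have hmem : ∀ π : Equiv.Perm X,
      e.permCongrHom π ∈ N.map e.permCongrHom.toMonoidHom ↔ π ∈ N := fun π =>
    Subgroup.mem_map_iff_mem (f := e.permCongrHom.toMonoidHom) e.permCongrHom.injective
  have hρ : ∀ g, ρ' (θ g) = e.permCongrHom (ρ g) := by
    intro g
    ext y
    obtain ⟨x, rfl⟩ := e.surjective y
    rw [← h]
    simp
  refine and_congr ⟨fun hr x => ⟨fun a b hab => ?_, fun b => ?_⟩,
    fun hr y => ⟨fun a b hab => ?_, fun b => ?_⟩⟩ ?_
  · have h1 := (hr (e x)).1 (a₁ := ⟨_, (hmem a.1).2 a.2⟩) (a₂ := ⟨_, (hmem b.1).2 b.2⟩)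
      (by simpa using hab)
    exact Subtype.ext (e.permCongrHom.injective (congrArg Subtype.val h1))
  · obtain ⟨⟨_, n, hn, rfl⟩, h1⟩ := (hr (e x)).2 (e b)
    exact ⟨⟨n, hn⟩, by simpa using h1⟩
  · obtain ⟨x, rfl⟩ := e.surjective y
    obtain ⟨_, n, hn, rfl⟩ := a
    obtain ⟨_, m, hm, rfl⟩ := b
    have h1 := (hr x).1 (a₁ := ⟨n, hn⟩) (a₂ := ⟨m, hm⟩) (by simpa using hab)
    exact Subtype.ext (congrArg e.permCongrHom (congrArg Subtype.val h1))
  · obtain ⟨x, rfl⟩ := e.surjective y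
    obtain ⟨b, rfl⟩ := e.surjective b
    obtain ⟨⟨n, hn⟩, h1⟩ := (hr x).2 b
    exact ⟨⟨_, n, hn, rfl⟩, by simpa using h1⟩
  · rw [hθ.forall]
    refine forall_congr' fun g => ?_
    -- Only surjectivity of θ matters here: the normalising permutations on Y are exactly the
    -- transports of those on X.
    rw [hρ, Subgroup.mem_normalizer_iff, Subgroup.mem_normalizer_iff,
      e.permCongrHom.surjective.forall]
    refine forall_congr' fun π => ?_
    have h3 : e.permCongrHom (ρ g) * e.permCongrHom π * (e.permCongrHom (ρ g))⁻¹ =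
      e.permCongrHom (ρ g * π * (ρ g)⁻¹) := by simp only [map_mul, map_inv]
    simp only [h3, hmem]

theorem regularNormalized_eq_image {Γ Γ' X Y : Type*} [Group Γ] [Group Γ'] (e : X ≃ Y)
    {ρ : Γ →* Equiv.Perm X} {ρ' : Γ' →* Equiv.Perm Y} {θ : Γ → Γ'}
    (hθ : Function.Surjective θ) (h : ∀ g x, e (ρ g x) = ρ' (θ g) (e x))
    {Q : Subgroup (Equiv.Perm X) → Prop} {Q' : Subgroup (Equiv.Perm Y) → Prop}
    (hQ : ∀ (N : Subgroup (Equiv.Perm X)) (N' : Subgroup (Equiv.Perm Y)), N ≃* N' →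
      (Q N ↔ Q' N')) :
    {N | N ∈ regularNormalized ρ' ∧ Q' N} =
      (Subgroup.map e.permCongrHom.toMonoidHom) '' {N | N ∈ regularNormalized ρ ∧ Q N} := by
  ext N'
  constructor
  · rintro ⟨hN', hQ'⟩
    have h1 : (N'.map e.permCongrHom.symm.toMonoidHom).map e.permCongrHom.toMonoidHom = N' := by
      rw [Subgroup.map_map]
      convert Subgroup.map_id N'
      ext1 π
      exact e.permCongrHom.apply_symm_apply π
    refine ⟨N'.map e.permCongrHom.symm.toMonoidHom, ⟨?_, ?_⟩, h1⟩
    · rw [← map_mem_regularNormalized e hθ h, h1]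
      exact hN'
    · exact (hQ _ _ (N'.equivMapOfInjective _ e.permCongrHom.symm.injective).symm).2 hQ'
  · rintro ⟨N, ⟨hN, hQN⟩, rfl⟩
    exact ⟨(map_mem_regularNormalized e hθ h).2 hN,
      (hQ _ _ (N.equivMapOfInjective _ e.permCongrHom.injective)).1 hQN⟩

theorem ncard_regularNormalized {Γ Γ' X Y : Type*} [Group Γ] [Group Γ'] (e : X ≃ Y)
    {ρ : Γ →* Equiv.Perm X} {ρ' : Γ' →* Equiv.Perm Y} {θ : Γ → Γ'}
    (hθ : Function.Surjective θ) (h : ∀ g x, e (ρ g x) = ρ' (θ g) (e x))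
    {Q : Subgroup (Equiv.Perm X) → Prop} {Q' : Subgroup (Equiv.Perm Y) → Prop}
    (hQ : ∀ (N : Subgroup (Equiv.Perm X)) (N' : Subgroup (Equiv.Perm Y)), N ≃* N' →
      (Q N ↔ Q' N')) :
    Set.ncard {N | N ∈ regularNormalized ρ ∧ Q N} =
      Set.ncard {N | N ∈ regularNormalized ρ' ∧ Q' N} := by
  rw [regularNormalized_eq_image e hθ h hQ]
  exact (Set.ncard_image_of_injective _ (Subgroup.map_injective e.permCongrHom.injective)).symm

theorem exists_regularNormalized_iff {Γ Γ' X Y : Type*} [Group Γ] [Group Γ'] (e : X ≃ Y)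
    {ρ : Γ →* Equiv.Perm X} {ρ' : Γ' →* Equiv.Perm Y} {θ : Γ → Γ'}
    (hθ : Function.Surjective θ) (h : ∀ g x, e (ρ g x) = ρ' (θ g) (e x))
    {Q : Subgroup (Equiv.Perm X) → Prop} {Q' : Subgroup (Equiv.Perm Y) → Prop}
    (hQ : ∀ (N : Subgroup (Equiv.Perm X)) (N' : Subgroup (Equiv.Perm Y)), N ≃* N' →
      (Q N ↔ Q' N')) :
    (∃ N ∈ regularNormalized ρ, Q N) ↔ ∃ N ∈ regularNormalized ρ', Q' N := by
  have h1 : {N | N ∈ regularNormalized ρ' ∧ Q' N}.Nonempty ↔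
      {N | N ∈ regularNormalized ρ ∧ Q N}.Nonempty := by
    rw [regularNormalized_eq_image e hθ h hQ, Set.image_nonempty]
  exact h1.symm

theorem isCyclic_congr' {M N : Type*} [Group M] [Group N] (f : M ≃* N) :
    IsCyclic M ↔ IsCyclic N := f.isCyclic

theorem exists_mul_ne_congr {M N : Type*} [Group M] [Group N] (f : M ≃* N) :
    (∃ a b : M, a * b ≠ b * a) ↔ ∃ a b : N, a * b ≠ b * a := by
  rw [f.surjective.exists]
  refine exists_congr fun a => ?_
  rw [f.surjective.exists]
  refine exists_congr fun b => ?_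
  rw [← map_mul, ← map_mul, f.injective.ne_iff]

/-! ### Hopf–Galois structures counted on the abstract permutation group -/

section Realises

variable {K : Type u} {L : Type v} [Field K] [Field L] [Algebra K L] [FiniteDimensional K L]
  [Algebra.IsSeparable K L] {G : Type w} {X : Type z} [Group G] [MulAction G X]

theorem mem_galSubgroup (σ : NormalClos K L ≃ₐ[K] NormalClos K L) :
    σ ∈ galSubgroup K L ↔ normalClosPerm K L σ (IsScalarTower.toAlgHom K L (NormalClos K L)) =
      IsScalarTower.toAlgHom K L (NormalClos K L) := by
  rw [galSubgroup, IntermediateField.mem_fixingSubgroup_iff, AlgHom.ext_iff]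
  constructor
  · intro h y
    exact h _ ⟨y, rfl⟩
  · rintro h _ ⟨y, rfl⟩
    exact h y

theorem Realises.exists_equiv [MulAction.IsPretransitive G X] (h : Realises K L G X) :
    ∃ (θ : G ≃* (NormalClos K L ≃ₐ[K] NormalClos K L)) (e : X ≃ (L →ₐ[K] NormalClos K L)),
      ∀ g x, e (MulAction.toPermHom G X g x) = normalClosPerm K L (θ g) (e x) := by
  obtain ⟨x, θ, hθ⟩ := h
  obtain ⟨e, he⟩ := exists_equivariant_equiv ((normalClosPerm K L).comp θ.toMonoidHom)
    (fun a b => by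
      obtain ⟨σ, hσ⟩ := exists_galPerm_eq (K := K) a b
      obtain ⟨g, rfl⟩ := θ.surjective σ
      exact ⟨g, hσ⟩) x (IsScalarTower.toAlgHom K L (NormalClos K L)) (fun g => by
      refine Iff.trans ?_ (mem_galSubgroup (θ g))
      rw [← hθ]
      exact (Subgroup.mem_map_iff_mem (f := θ.toMonoidHom) (K := MulAction.stabilizer G x)
        (x := g) θ.injective).symm)
  exact ⟨θ, e, he⟩

theorem Realises.numCyclicType_eq [MulAction.IsPretransitive G X] (h : Realises K L G X) :
    numCyclicType K L = Set.ncard {N | N ∈ regularNormalized (MulAction.toPermHom G X) ∧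
      IsCyclic N} := by
  obtain ⟨θ, e, he⟩ := h.exists_equiv
  rw [ncard_regularNormalized e θ.surjective he (Q' := fun N => IsCyclic N)
    (fun N N' f => isCyclic_congr' f)]
  exact ncard_hopfGaloisStructure (fun M _ => IsCyclic M) _ (fun M _ N f => isCyclic_congr' f)

theorem Realises.numNonabelianType_eq [MulAction.IsPretransitive G X] (h : Realises K L G X) :
    numNonabelianType K L = Set.ncard {N | N ∈ regularNormalized (MulAction.toPermHom G X) ∧
      ∃ a b : N, a * b ≠ b * a} := by
  obtain ⟨θ, e, he⟩ := h.exists_equiv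
  rw [ncard_regularNormalized e θ.surjective he (Q' := fun N => ∃ a b : N, a * b ≠ b * a)
    (fun N N' f => exists_mul_ne_congr f)]
  exact ncard_hopfGaloisStructure (fun M _ => ∃ a b : M, a * b ≠ b * a) _
    (fun M _ N f => exists_mul_ne_congr f)

theorem Realises.exists_isOfCyclicType_iff [MulAction.IsPretransitive G X]
    (h : Realises K L G X) : (∃ S : HopfGaloisStructure K L, S.IsOfCyclicType) ↔
      ∃ N ∈ regularNormalized (MulAction.toPermHom G X), IsCyclic N := by
  obtain ⟨θ, e, he⟩ := h.exists_equiv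
  rw [exists_regularNormalized_iff e θ.surjective he (Q' := fun N => IsCyclic N)
    (fun N N' f => isCyclic_congr' f)]
  exact exists_hopfGaloisStructure_iff (fun M _ => IsCyclic M) _ (fun M _ N f => isCyclic_congr' f)

theorem Realises.exists_isOfNonabelianType_iff [MulAction.IsPretransitive G X]
    (h : Realises K L G X) : (∃ S : HopfGaloisStructure K L, S.IsOfNonabelianType) ↔
      ∃ N ∈ regularNormalized (MulAction.toPermHom G X), ∃ a b : N, a * b ≠ b * a := by
  obtain ⟨θ, e, he⟩ := h.exists_equiv
  rw [exists_regularNormalized_iff e θ.surjective he (Q' := fun N => ∃ a b : N, a * b ≠ b * a)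
    (fun N N' f => exists_mul_ne_congr f)]
  exact exists_hopfGaloisStructure_iff (fun M _ => ∃ a b : M, a * b ≠ b * a) _
    (fun M _ N f => exists_mul_ne_congr f)

theorem Realises.isAlmostClassicallyGalois (h : Realises K L G X) (C : Subgroup G) [C.Normal]
    (hC : ∀ x : X, C.IsComplement' (MulAction.stabilizer G x)) :
    IsAlmostClassicallyGalois K L := by
  obtain ⟨x, θ, hθ⟩ := h
  refine ⟨C.map θ.toMonoidHom, Subgroup.Normal.map ‹_› _ θ.surjective, ?_⟩
  rw [← hθ]
  rw [Subgroup.isComplement'_def, Subgroup.isComplement_iff_existsUnique]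
  intro σ
  obtain ⟨g, rfl⟩ := θ.surjective σ
  obtain ⟨⟨a, b⟩, hab, huniq⟩ := (Subgroup.isComplement_iff_existsUnique.1 (hC x)) g
  refine ⟨⟨⟨θ a, a, a.2, rfl⟩, ⟨θ b, b, b.2, rfl⟩⟩, ?_, ?_⟩
  · exact (map_mul θ _ _).symm.trans (congrArg θ hab)
  · rintro ⟨⟨_, a', ha', rfl⟩, ⟨_, b', hb', rfl⟩⟩ h1
    have h2 := huniq ⟨⟨a', ha'⟩, ⟨b', hb'⟩⟩ (θ.injective ((map_mul θ _ _).trans h1))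
    rw [Prod.mk.injEq] at h2
    obtain ⟨rfl, rfl⟩ := h2
    rfl

end Realises

/-! ### Extensions which realise a permutation group -/

section IsGaloisGroup

variable {K : Type u} {L : Type v} {E : Type*} [Field K] [Field L] [Field E] [Algebra K L]
  [Algebra K E] {G : Type w} {X : Type z} [Group G] [MulAction G X] [Finite G]
  [MulSemiringAction G E] [IsGaloisGroup G K E]

theorem mem_stabilizer_iff_of_fieldRange {ι : L →ₐ[K] E} {x : X}
    (hι : ι.fieldRange = FixedPoints.intermediateField (MulAction.stabilizer G x)) (g : G) :
    g ∈ MulAction.stabilizer G x ↔ ∀ y, g • ι y = ι y := by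
  have h1 := IsGaloisGroup.fixingSubgroup_fixedPoints G K E (MulAction.stabilizer G x)
  rw [← h1, ← hι, mem_fixingSubgroup_iff]
  constructor
  · intro h y
    exact h _ ⟨y, rfl⟩
  · rintro h _ ⟨y, rfl⟩
    exact h y

/-- An element fixing the normal closure fixes every conjugate k • ι(L), so it lies in every point
stabiliser and is trivial by faithfulness. -/
theorem isNormalClosure_of_fieldRange [FaithfulSMul G X] [MulAction.IsPretransitive G X]
    {ι : L →ₐ[K] E} {x : X}
    (hι : ι.fieldRange = FixedPoints.intermediateField (MulAction.stabilizer G x)) :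
    IsNormalClosure K L E := by
  have hgal : IsGalois K E := IsGaloisGroup.isGalois G K E
  have hfin : FiniteDimensional K E := IsGaloisGroup.finiteDimensional G K E
  have hfinL : FiniteDimensional K L := Module.Finite.of_injective ι.toLinearMap ι.injective
  refine Algebra.IsAlgebraic.isNormalClosure_iff.2 ⟨fun y => ?_, ?_⟩
  · rw [← minpoly.algHom_eq ι ι.injective]
    exact Normal.splits inferInstance (ι y)
  · rw [← IsGalois.fixedField_fixingSubgroup (IntermediateField.normalClosure K L E)]
    have h1 : (IntermediateField.normalClosure K L E).fixingSubgroup = ⊥ := by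
      rw [eq_bot_iff]
      intro σ hσ
      obtain ⟨g, rfl⟩ := (IsGaloisGroup.mulEquivAlgEquiv G K E).surjective σ
      rw [IntermediateField.mem_fixingSubgroup_iff] at hσ
      have h2 : ∀ z : X, g • z = z := by
        intro z
        obtain ⟨k, rfl⟩ := MulAction.exists_smul_eq G x z
        have h3 : k⁻¹ * g * k ∈ MulAction.stabilizer G x := by
          rw [mem_stabilizer_iff_of_fieldRange hι]
          intro y
          have h4 := hσ (k • ι y) (AlgHom.fieldRange_le_normalClosure
            ((IsGaloisGroup.mulEquivAlgEquiv G K E k).toAlgHom.comp ι) ⟨y, rfl⟩)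
          rw [mul_smul, mul_smul, inv_smul_eq_iff]
          exact h4
        rw [MulAction.mem_stabilizer_iff, mul_smul, mul_smul, inv_smul_eq_iff] at h3
        exact h3
      have h5 : g = 1 := FaithfulSMul.eq_of_smul_eq_smul (α := X) fun z => by rw [h2, one_smul]
      rw [h5, map_one]
      exact Subgroup.mem_bot.2 rfl
    rw [h1, IntermediateField.fixedField_bot]

theorem realises_of_isGaloisGroup [FaithfulSMul G X] [MulAction.IsPretransitive G X]
    {ι : L →ₐ[K] E} {x : X}
    (hι : ι.fieldRange = FixedPoints.intermediateField (MulAction.stabilizer G x)) :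
    FiniteDimensional K L ∧ Algebra.IsSeparable K L ∧ Realises K L G X := by
  have hgal : IsGalois K E := IsGaloisGroup.isGalois G K E
  have hfin : FiniteDimensional K E := IsGaloisGroup.finiteDimensional G K E
  have hfinL : FiniteDimensional K L := Module.Finite.of_injective ι.toLinearMap ι.injective
  have hsep : Algebra.IsSeparable K L := Algebra.IsSeparable.of_algHom K E ι
  have hn := isNormalClosure_of_fieldRange hι
  refine ⟨hfinL, hsep, x, ?_⟩
  let ε₀ : E ≃ₐ[K] NormalClos K L := IsNormalClosure.equiv (F := K) (K := L)
  -- The identification of the two normal closures is corrected by σ so that ι becomes the standard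
  -- inclusion of L.
  obtain ⟨σ, hσ⟩ := exists_galPerm_eq (K := K) (ε₀.toAlgHom.comp ι)
    (IsScalarTower.toAlgHom K L (NormalClos K L))
  let ε := ε₀.trans σ
  have hε : ∀ y, ε (ι y) = IsScalarTower.toAlgHom K L (NormalClos K L) y := fun y =>
    congrArg (fun f : L →ₐ[K] NormalClos K L => f y) hσ
  refine ⟨(IsGaloisGroup.mulEquivAlgEquiv G K E).trans (AlgEquiv.autCongr ε), ?_⟩
  ext τ
  obtain ⟨g, rfl⟩ := ((IsGaloisGroup.mulEquivAlgEquiv G K E).trans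
    (AlgEquiv.autCongr ε)).surjective τ
  refine (Subgroup.mem_map_iff_mem (MulEquiv.injective _)).trans ?_
  rw [mem_stabilizer_iff_of_fieldRange hι, mem_galSubgroup, AlgHom.ext_iff]
  refine forall_congr' fun y => ?_
  rw [galPerm_apply, ← hε]
  have h1 : ((IsGaloisGroup.mulEquivAlgEquiv G K E).trans (AlgEquiv.autCongr ε)) g (ε (ι y)) =
      ε (g • ι y) := by
    change ε ((IsGaloisGroup.mulEquivAlgEquiv G K E g) (ε.symm (ε (ι y)))) = _
    rw [ε.symm_apply_apply]
    rfl
  rw [h1, ε.injective.eq_iff]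

end IsGaloisGroup

/-- The action of permutations on polynomials. -/
noncomputable def permPolynomial (X : Type*) :
    Equiv.Perm X →* (MvPolynomial X ℚ ≃ₐ[ℚ] MvPolynomial X ℚ) where
  toFun σ := MvPolynomial.renameEquiv ℚ σ
  map_one' := MvPolynomial.renameEquiv_refl ℚ
  map_mul' σ τ := (MvPolynomial.renameEquiv_trans ℚ τ σ).symm

theorem permPolynomial_injective (X : Type*) : Function.Injective (permPolynomial X) := by
  intro σ τ h
  ext1 x
  have h1 := congrArg (fun f : MvPolynomial X ℚ ≃ₐ[ℚ] MvPolynomial X ℚ => f (MvPolynomial.X x)) h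
  have h2 : (MvPolynomial.X (σ x) : MvPolynomial X ℚ) = MvPolynomial.X (τ x) := by
    simpa [permPolynomial] using h1
  exact MvPolynomial.X_injective h2

/-- Take K to be the fixed field of G and L the fixed field of a point stabiliser; `ULift` places
them in the prescribed universes. -/
theorem exists_realises_of_mulSemiringAction {G : Type w} {X : Type z} {E : Type} [Group G]
    [Finite G] [MulAction G X] [FaithfulSMul G X] [MulAction.IsPretransitive G X] [Field E]
    [MulSemiringAction G E] [hf : FaithfulSMul G E] (x : X) :
    ∃ (K : Type u) (L : Type v) (_ : Field K) (_ : Field L) (_ : Algebra K L),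
      FiniteDimensional K L ∧ Algebra.IsSeparable K L ∧ Realises K L G X := by
  let K := ULift.{u} (FixedPoints.subfield G E)
  let : Algebra K E :=
    ((FixedPoints.subfield G E).subtype.comp ULift.ringEquiv.toRingHom).toAlgebra
  have hG : IsGaloisGroup G K E :=
    { faithful := hf
      commutes := ⟨fun g a b => by
        have h1 : g • (a.down : E) = a.down := a.down.2 g
        change g • ((a.down : E) * b) = (a.down : E) * g • b
        rw [smul_mul', h1]⟩
      isInvariant := ⟨fun b hb => ⟨⟨⟨b, hb⟩⟩, rfl⟩⟩ }
  let M : IntermediateField K E := FixedPoints.intermediateField (MulAction.stabilizer G x)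
  let ι : ULift.{v} M →ₐ[K] E := M.val.comp ULift.algEquiv.toAlgHom
  have hι : ι.fieldRange = FixedPoints.intermediateField (MulAction.stabilizer G x) := by
    ext y
    constructor
    · rintro ⟨a, rfl⟩
      exact a.down.2
    · intro hy
      exact ⟨⟨⟨y, hy⟩⟩, rfl⟩
  exact ⟨_, _, _, _, _, realises_of_isGaloisGroup hι⟩

/-- H acts faithfully on the field of rational functions in n variables over ℚ by permuting the
variables. -/
theorem exists_realises {n : ℕ} (H : Subgroup (Equiv.Perm (Fin n)))
    [MulAction.IsPretransitive H (Fin n)] (x : Fin n) :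
    ∃ (K : Type u) (L : Type v) (_ : Field K) (_ : Field L) (_ : Algebra K L),
      FiniteDimensional K L ∧ Algebra.IsSeparable K L ∧ Realises K L H (Fin n) := by
  let E := FractionRing (MvPolynomial (Fin n) ℚ)
  let φ : H →* (E ≃ₐ[ℚ] E) := (IsFractionRing.fieldEquivOfAlgEquivHom ℚ E).comp
    ((permPolynomial (Fin n)).comp H.subtype)
  have hφ : Function.Injective φ := (IsFractionRing.fieldEquivOfAlgEquivHom_injective _ _ _ _).comp
    ((permPolynomial_injective _).comp H.subtype_injective)
  let : MulSemiringAction H E := MulSemiringAction.compHom E φ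
  have hf : FaithfulSMul H E := ⟨fun h => hφ (AlgEquiv.ext h)⟩
  exact exists_realises_of_mulSemiringAction (E := E) x

theorem Realises.of_permGroupIso {K : Type u} {L : Type v} [Field K] [Field L] [Algebra K L]
    {G : Type w} {X : Type z} [Group G] [MulAction G X] {G' X' : Type*} [Group G']
    [MulAction G' X'] (hG : PermGroupIso G X G' X') (h : Realises K L G' X') :
    Realises K L G X := by
  obtain ⟨θ, e, he⟩ := hG
  obtain ⟨x, θ', h⟩ := h
  refine ⟨e.symm x, θ.trans θ', ?_⟩
  rw [← h]
  ext σ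
  obtain ⟨g, rfl⟩ := (θ.trans θ').surjective σ
  refine (Subgroup.mem_map_iff_mem (MulEquiv.injective _)).trans (Iff.trans ?_
    (Subgroup.mem_map_iff_mem (MulEquiv.injective _)).symm)
  rw [MulAction.mem_stabilizer_iff, MulAction.mem_stabilizer_iff, ← e.injective.eq_iff, he,
    e.apply_symm_apply]
  rfl

/-! ### Characters of `ZMod q` with values in `ZMod p` -/

section Characters

variable {p q : ℕ} [Fact p.Prime] [Fact q.Prime]

theorem addChar_apply_eq_pow (χ : AddChar (ZMod q) (ZMod p)) (n : ℕ) :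
    χ (n : ZMod q) = χ 1 ^ n := by
  rw [← χ.map_nsmul_eq_pow, nsmul_one]

theorem addChar_ext_one {χ ω : AddChar (ZMod q) (ZMod p)} (h : χ 1 = ω 1) : χ = ω := by
  ext j
  obtain ⟨n, rfl⟩ := ZMod.natCast_zmod_surjective j
  rw [addChar_apply_eq_pow, addChar_apply_eq_pow, h]

theorem addChar_pow_eq_one (χ : AddChar (ZMod q) (ZMod p)) (j : ZMod q) : χ j ^ q = 1 := by
  rw [← χ.map_nsmul_eq_pow]
  simp

theorem addChar_ne_zero (χ : AddChar (ZMod q) (ZMod p)) (j : ZMod q) : χ j ≠ 0 :=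
  (χ.val_isUnit j).ne_zero

theorem exists_addChar_one_eq {a : ZMod p} (ha : a ^ q = 1) :
    ∃ χ : AddChar (ZMod q) (ZMod p), χ 1 = a := by
  refine ⟨AddChar.zmodChar q ha, ?_⟩
  have h1 := AddChar.zmodChar_apply' ha 1
  simpa using h1

theorem addChar_one_ne_one {χ : AddChar (ZMod q) (ZMod p)} (h : χ ≠ 1) : χ 1 ≠ 1 :=
  (AddChar.zmod_char_ne_one_iff q χ).1 h

theorem addChar_injective {χ : AddChar (ZMod q) (ZMod p)} (h : χ ≠ 1) :
    Function.Injective χ := by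
  have h1 := AddChar.IsPrimitive.of_ne_one h
  rw [AddChar.injective_iff]
  intro x hx
  by_contra hx0
  refine h1 hx0 (addChar_ext_one ?_)
  rw [AddChar.mulShift_apply, mul_one, hx, AddChar.one_apply]

/-- A nontrivial character is injective, so its q values exhaust the at most q roots of X^q - 1. -/
theorem exists_addChar_eq {χ : AddChar (ZMod q) (ZMod p)} (h : χ ≠ 1) {a : ZMod p}
    (ha : a ^ q = 1) : ∃ j, χ j = a := by
  have h1 : (Finset.univ.image χ) = Polynomial.nthRootsFinset q (1 : ZMod p) := by
    refine Finset.eq_of_subset_of_card_le (fun b hb => ?_) ?_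
    · obtain ⟨j, -, rfl⟩ := Finset.mem_image.1 hb
      rw [Polynomial.mem_nthRootsFinset (Fact.out : q.Prime).pos]
      exact addChar_pow_eq_one χ j
    · rw [Finset.card_image_of_injective _ (addChar_injective h), Finset.card_univ, ZMod.card]
      exact (@Multiset.toFinset_card_le _ (Classical.decEq _) _).trans (Polynomial.card_nthRoots _ _)
  have h2 : a ∈ Finset.univ.image χ := by
    rw [h1, Polynomial.mem_nthRootsFinset (Fact.out : q.Prime).pos]
    exact ha
  obtain ⟨j, -, hj⟩ := Finset.mem_image.1 h2
  exact ⟨j, hj⟩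

theorem card_rootsOfUnity_zmod {d : ℕ} (hd : d ∣ p - 1) :
    Nat.card (rootsOfUnity d (ZMod p)) = d := by
  have hp1 : 0 < p - 1 := Nat.sub_pos_of_lt (Fact.out : p.Prime).one_lt
  have : NeZero d := ⟨fun h => by simp [h] at hd; omega⟩
  rw [card_rootsOfUnity_eq_iff_exists_isPrimitiveRoot]
  obtain ⟨g, hg⟩ := IsCyclic.exists_generator (α := (ZMod p)ˣ)
  obtain ⟨k, hk⟩ := hd
  have h1 : orderOf g = p - 1 := by
    rw [orderOf_eq_card_of_forall_mem_zpowers hg, Nat.card_eq_fintype_card, ZMod.card_units]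
  have h2 : IsPrimitiveRoot g (p - 1) := h1 ▸ IsPrimitiveRoot.orderOf g
  refine ⟨((g ^ k : (ZMod p)ˣ) : ZMod p), IsPrimitiveRoot.coe_units_iff.2 ?_⟩
  exact h2.pow hp1 (by rw [hk, mul_comm])

/-- A character is determined by its value at 1, which may be any q-th root of unity. -/
theorem card_addChar (hd : q ∣ p - 1) : Nat.card (AddChar (ZMod q) (ZMod p)) = q := by
  refine Eq.trans ?_ (card_rootsOfUnity_zmod hd)
  refine Nat.card_eq_of_bijective (fun χ => rootsOfUnity.mkOfPowEq (χ 1) (addChar_pow_eq_one χ 1))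
    ⟨fun χ ω h => addChar_ext_one ?_, fun u => ?_⟩
  · have h1 := congrArg (fun u : rootsOfUnity q (ZMod p) => (u.1 : ZMod p)) h
    simpa using h1
  · obtain ⟨χ, hχ⟩ := exists_addChar_one_eq (p := p) (q := q) (a := u.1) (by
      have := u.2
      rw [mem_rootsOfUnity'] at this
      exact this)
    refine ⟨χ, Subtype.ext (Units.ext ?_)⟩
    simpa using hχ

instance finite_addChar : Finite (AddChar (ZMod q) (ZMod p)) :=
  Finite.of_injective (fun χ : AddChar (ZMod q) (ZMod p) => χ 1) fun _ _ h => addChar_ext_one h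

end Characters

/-! ### Permutations of `ZMod p × ZMod q` -/

section Shear

variable {p q : ℕ} [Fact p.Prime] [Fact q.Prime]

theorem addChar_neg_mul (χ : AddChar (ZMod q) (ZMod p)) (i : ZMod q) : χ (-i) * χ i = 1 := by
  rw [← AddChar.map_add_eq_mul, neg_add_cancel, AddChar.map_zero_eq_one]

/-- The permutation `(x, j) ↦ (ω i * x + t * χ j, j + i)`. -/
def shear (χ ω : AddChar (ZMod q) (ZMod p)) (i : ZMod q) (t : ZMod p) :
    Equiv.Perm (ZMod p × ZMod q) where
  toFun z := (ω i * z.1 + t * χ z.2, z.2 + i)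
  invFun z := (ω (-i) * (z.1 - t * χ (z.2 - i)), z.2 - i)
  left_inv z := by
    ext
    · simp only [add_sub_cancel_right]
      rw [← mul_assoc, addChar_neg_mul, one_mul]
    · simp
  right_inv z := by
    ext
    · simp only
      rw [← mul_assoc, mul_comm (ω i), addChar_neg_mul]
      ring
    · simp

variable (χ ω : AddChar (ZMod q) (ZMod p))

theorem shear_apply (i : ZMod q) (t : ZMod p) (x : ZMod p) (j : ZMod q) :
    shear χ ω i t (x, j) = (ω i * x + t * χ j, j + i) := rfl

theorem shear_mul (i i' : ZMod q) (t t' : ZMod p) :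
    shear χ ω i t * shear χ ω i' t' = shear χ ω (i' + i) (ω i * t' + t * χ i') := by
  ext1 ⟨x, j⟩
  rw [Equiv.Perm.mul_apply, shear_apply, shear_apply, shear_apply, AddChar.map_add_eq_mul,
    AddChar.map_add_eq_mul]
  ext
  · simp only
    ring
  · simp only
    ring

theorem shear_zero_zero : shear χ ω 0 0 = 1 := by
  ext1 ⟨x, j⟩
  simp [shear_apply]

/-- The group of the permutations `(x, j) ↦ (ω i * x + t * χ j, j + i)`. -/
def shearGroup : Subgroup (Equiv.Perm (ZMod p × ZMod q)) where
  carrier := {g | ∃ i t, g = shear χ ω i t}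
  mul_mem' := by
    rintro _ _ ⟨i, t, rfl⟩ ⟨i', t', rfl⟩
    exact ⟨_, _, shear_mul χ ω i i' t t'⟩
  one_mem' := ⟨0, 0, (shear_zero_zero χ ω).symm⟩
  inv_mem' := by
    rintro _ ⟨i, t, rfl⟩
    refine ⟨-i, -(ω (-i) * t * χ (-i)), ?_⟩
    rw [inv_eq_iff_mul_eq_one, shear_mul, neg_add_cancel, ← shear_zero_zero χ ω]
    congr 1
    have := addChar_neg_mul ω i
    linear_combination (-t * χ (-i)) * this

variable {χ ω}

theorem shear_mem (i : ZMod q) (t : ZMod p) : shear χ ω i t ∈ shearGroup χ ω := ⟨i, t, rfl⟩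

theorem shear_injective {i i' : ZMod q} {t t' x : ZMod p} {j : ZMod q}
    (h : shear χ ω i t (x, j) = shear χ ω i' t' (x, j)) : i = i' ∧ t = t' := by
  rw [shear_apply, shear_apply, Prod.mk.injEq] at h
  obtain ⟨h1, h2⟩ := h
  obtain rfl := add_left_cancel h2
  exact ⟨rfl, mul_right_cancel₀ (addChar_ne_zero χ j) (add_left_cancel h1)⟩

theorem isRegularPerm_shearGroup : IsRegularPerm (shearGroup χ ω) := by
  rintro ⟨x, j⟩
  constructor
  · rintro ⟨_, i, t, rfl⟩ ⟨_, i', t', rfl⟩ h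
    obtain ⟨rfl, rfl⟩ := shear_injective h
    rfl
  · rintro ⟨x', j'⟩
    refine ⟨⟨_, shear_mem (j' - j) ((x' - ω (j' - j) * x) * (χ j)⁻¹)⟩, ?_⟩
    change shear χ ω _ _ (x, j) = _
    rw [shear_apply]
    ext
    · simp only
      rw [mul_assoc, inv_mul_cancel₀ (addChar_ne_zero χ j)]
      ring
    · simp

theorem shearGroup_injective {χ' ω' : AddChar (ZMod q) (ZMod p)}
    (h : shearGroup χ ω = shearGroup χ' ω') : χ = χ' ∧ ω = ω' := by
  constructor
  · obtain ⟨i, t, h1⟩ : shear χ ω 0 1 ∈ shearGroup χ' ω' := h ▸ shear_mem 0 1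
    have h2 : ∀ j, shear χ ω 0 1 (0, j) = shear χ' ω' i t (0, j) := fun j => by rw [h1]
    simp only [shear_apply, Prod.mk.injEq] at h2
    have h3 : t = 1 := by simpa using (h2 0).1.symm
    ext j
    simpa [h3] using (h2 j).1
  · obtain ⟨i, t, h1⟩ : shear χ ω 1 0 ∈ shearGroup χ' ω' := h ▸ shear_mem 1 0
    have h2 : ∀ x, shear χ ω 1 0 (x, 0) = shear χ' ω' i t (x, 0) := fun j => by rw [h1]
    simp only [shear_apply, Prod.mk.injEq] at h2
    have h3 : i = 1 := by simpa using (h2 0).2.symm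
    have h4 : t = 0 := by simpa using (h2 0).1.symm
    refine addChar_ext_one ?_
    simpa [h3, h4] using (h2 1).1

theorem shearGroup_commute_iff (h : χ = 1 ∨ ω = 1) :
    (∃ a b : shearGroup χ ω, a * b ≠ b * a) ↔ ¬(χ = 1 ∧ ω = 1) := by
  constructor
  · rintro ⟨⟨_, i, t, rfl⟩, ⟨_, i', t', rfl⟩, hab⟩ ⟨rfl, rfl⟩
    refine hab (Subtype.ext ?_)
    change shear 1 1 i t * shear 1 1 i' t' = shear 1 1 i' t' * shear 1 1 i t
    rw [shear_mul, shear_mul, add_comm i i']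
    congr 1
    simp [add_comm]
  · intro h1
    refine ⟨⟨_, shear_mem 0 1⟩, ⟨_, shear_mem 1 0⟩, fun h2 => h1 ?_⟩
    have h3 : shear χ ω 0 1 * shear χ ω 1 0 = shear χ ω 1 0 * shear χ ω 0 1 :=
      congrArg Subtype.val h2
    rw [shear_mul, shear_mul] at h3
    have h4 := (shear_injective (x := 0) (j := 0) (DFunLike.congr_fun h3 (0, 0))).2
    -- Commutation of these two elements equates the characters; one of them is trivial, so both
    -- are.
    have h5 : χ = ω := addChar_ext_one (by simpa using h4)
    subst h5
    simpa using h

theorem isCyclic_shearGroup_iff (h : χ = 1 ∨ ω = 1) (hpq : p ≠ q) :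
    IsCyclic (shearGroup χ ω) ↔ χ = 1 ∧ ω = 1 := by
  constructor
  · intro hc
    by_contra h1
    obtain ⟨a, b, hab⟩ := (shearGroup_commute_iff h).2 h1
    exact hab ((IsCyclic.isMulCommutative (α := shearGroup χ ω)).is_comm.comm a b)
  · rintro ⟨rfl, rfl⟩
    let f : Multiplicative (ZMod p × ZMod q) →* shearGroup (1 : AddChar (ZMod q) (ZMod p)) 1 :=
      { toFun := fun z => ⟨_, shear_mem z.toAdd.2 z.toAdd.1⟩
        map_one' := Subtype.ext (shear_zero_zero _ _)
        map_mul' := fun a b => by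
          refine Subtype.ext ?_
          change shear 1 1 _ _ = shear 1 1 _ _ * shear 1 1 _ _
          rw [shear_mul]
          congr 1
          · exact add_comm _ _
          · simp [add_comm] }
    have hf : Function.Surjective f := by
      rintro ⟨_, i, t, rfl⟩
      exact ⟨Multiplicative.ofAdd (t, i), rfl⟩
    have hcop : p.Coprime q := (Nat.coprime_primes Fact.out Fact.out).2 hpq
    have : IsCyclic (Multiplicative (ZMod p × ZMod q)) :=
      isCyclic_of_surjective (AddEquiv.toMultiplicative (ZMod.chineseRemainder hcop).toAddEquiv)
        (AddEquiv.toMultiplicative (ZMod.chineseRemainder hcop).toAddEquiv).surjective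
    exact isCyclic_of_surjective f hf

end Shear

/-! ### Groups of prime order, and groups of order `p * q` -/

/-- Conjugation by g raises a generator to a power r; g^l = 1 gives r^l ≡ 1 mod l, and Fermat's
little theorem gives r ≡ 1. -/
theorem commute_of_conj_mem_of_card_prime {Γ : Type*} [Group Γ] {H : Subgroup Γ} {l : ℕ}
    (hl : l.Prime) (hcard : Nat.card H = l) {g x : Γ} (hg : ∀ y ∈ H, g * y * g⁻¹ ∈ H)
    (hgl : g ^ l = 1) (hx : x ∈ H) : g * x = x * g := by
  have := Fact.mk hl
  by_cases hx1 : x = 1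
  · rw [hx1, mul_one, one_mul]
  have hgen : Subgroup.zpowers (⟨x, hx⟩ : H) = ⊤ :=
    zpowers_eq_top_of_prime_card hcard fun h => hx1 (congrArg Subtype.val h)
  have hfin : Finite H := Nat.finite_of_card_ne_zero (hcard ▸ hl.ne_zero)
  have hord : orderOf x = l := by
    rw [← hcard, ← Subgroup.orderOf_mk x hx]
    exact orderOf_eq_card_of_zpowers_eq_top hgen
  obtain ⟨r, hr⟩ : ∃ r : ℕ, g * x * g⁻¹ = x ^ r := by
    have h1 : (⟨g * x * g⁻¹, hg x hx⟩ : H) ∈ Subgroup.zpowers (⟨x, hx⟩ : H) := hgen ▸ trivial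
    obtain ⟨r, hr⟩ := mem_powers_iff_mem_zpowers.2 h1
    exact ⟨r, (congrArg Subtype.val hr).symm⟩
  have h2 : ∀ n : ℕ, g ^ n * x * (g ^ n)⁻¹ = x ^ r ^ n := by
    intro n
    induction n with
    | zero => simp
    | succ n ih =>
      have h3 : g ^ (n + 1) * x * (g ^ (n + 1))⁻¹ = g * (g ^ n * x * (g ^ n)⁻¹) * g⁻¹ := by
        rw [pow_succ']
        group
      rw [h3, ih, ← conj_pow, hr, ← pow_mul, pow_succ']
  have h4 := h2 l
  rw [hgl, one_mul, inv_one, mul_one] at h4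
  have h5 : r ^ l ≡ 1 [MOD l] := by
    rw [← hord, ← pow_eq_pow_iff_modEq, hord, ← h4, pow_one]
  have h6 : r ≡ 1 [MOD l] := by
    rw [← ZMod.natCast_eq_natCast_iff] at h5 ⊢
    rw [Nat.cast_pow, ZMod.pow_card] at h5
    exact h5
  rw [← hord, ← pow_eq_pow_iff_modEq, pow_one, ← hr] at h6
  exact mul_inv_eq_iff_eq_mul.1 h6

/-- A subgroup of order p has index q, the least prime factor of the order, so it is normal. In the
quotient an element y with y^p = 1 is killed by p and by q. So this subgroup is stable under every
automorphism. -/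
theorem exists_orderOf_eq_prime_of_card_mul {M : Type*} [Group M] {p q : ℕ} (hp : p.Prime)
    (hq : q.Prime) (hqp : q < p) (hcard : Nat.card M = p * q) :
    ∃ ρ : M, orderOf ρ = p ∧ ∀ y : M, y ^ p = 1 → y ∈ Subgroup.zpowers ρ := by
  have := Fact.mk hp
  have hfin : Finite M :=
    Nat.finite_of_card_ne_zero (hcard ▸ Nat.mul_ne_zero hp.ne_zero hq.ne_zero)
  obtain ⟨ρ, hρ⟩ := exists_prime_orderOf_dvd_card' (G := M) p (hcard ▸ dvd_mul_right p q)
  refine ⟨ρ, hρ, fun y hy => ?_⟩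
  have hidx : (Subgroup.zpowers ρ).index = q := by
    have h1 := (Subgroup.zpowers ρ).card_mul_index
    rw [Nat.card_zpowers, hρ, hcard] at h1
    exact Nat.eq_of_mul_eq_mul_left hp.pos h1
  have hn : (Subgroup.zpowers ρ).Normal := by
    refine Subgroup.normal_of_index_eq_minFac_card ?_
    rw [hidx, hcard]
    refine le_antisymm ?_ (Nat.minFac_le_of_dvd hq.two_le (dvd_mul_left q p))
    have hm := Nat.minFac_prime (n := p * q) (fun h => hp.one_lt.ne' (Nat.dvd_one.1 (Dvd.intro q h)))
    rcases hm.dvd_mul.1 (Nat.minFac_dvd (p * q)) with h1 | h1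
    · rw [(Nat.prime_dvd_prime_iff_eq hm hp).1 h1]
      exact hqp.le
    · rw [(Nat.prime_dvd_prime_iff_eq hm hq).1 h1]
  rw [← QuotientGroup.eq_one_iff]
  have h2 : (y : M ⧸ Subgroup.zpowers ρ) ^ p = 1 := by
    rw [← QuotientGroup.mk_pow, hy, QuotientGroup.mk_one]
  have h3 : (y : M ⧸ Subgroup.zpowers ρ) ^ q = 1 := by
    rw [← hidx]
    exact pow_card_eq_one'
  have h4 := Nat.dvd_gcd (orderOf_dvd_of_pow_eq_one h2) (orderOf_dvd_of_pow_eq_one h3)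
  rw [(Nat.coprime_primes hp hq).2 hqp.ne'] at h4
  exact orderOf_eq_one_iff.1 (Nat.dvd_one.1 h4)

/-! ### Regular permutation groups -/

section Regular

variable {X : Type*} {N M : Subgroup (Equiv.Perm X)}

theorem IsRegularPerm.eq_of_apply_eq (h : IsRegularPerm N) {a b : Equiv.Perm X} (ha : a ∈ N)
    (hb : b ∈ N) {x : X} (hab : a x = b x) : a = b :=
  congrArg Subtype.val ((h x).1 (a₁ := ⟨a, ha⟩) (a₂ := ⟨b, hb⟩) hab)

theorem IsRegularPerm.exists_apply_eq (h : IsRegularPerm N) (x y : X) : ∃ a ∈ N, a x = y := by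
  obtain ⟨⟨a, ha⟩, h1⟩ := (h x).2 y
  exact ⟨a, ha, h1⟩

theorem IsRegularPerm.eq_of_le (h : IsRegularPerm N) (hM : IsRegularPerm M) (hle : M ≤ N)
    [hne : Nonempty X] : N = M := by
  refine le_antisymm (fun a ha => ?_) hle
  obtain ⟨x⟩ := hne
  obtain ⟨b, hb, hab⟩ := hM.exists_apply_eq x (a x)
  rwa [h.eq_of_apply_eq ha (hle hb) hab.symm]

theorem IsRegularPerm.card_eq (h : IsRegularPerm N) [hne : Nonempty X] :
    Nat.card N = Nat.card X := by
  obtain ⟨x⟩ := hne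
  exact Nat.card_eq_of_bijective _ (h x)

theorem IsRegularPerm.map_conj (h : IsRegularPerm N) (f : Equiv.Perm X) :
    IsRegularPerm (N.map (MulAut.conj f).toMonoidHom) := by
  intro x
  constructor
  · rintro ⟨_, a, ha, rfl⟩ ⟨_, b, hb, rfl⟩ hab
    have h1 : a = b := h.eq_of_apply_eq ha hb (x := f⁻¹ x) (by simpa using hab)
    subst h1
    rfl
  · intro y
    obtain ⟨a, ha, hab⟩ := h.exists_apply_eq (f⁻¹ x) (f⁻¹ y)
    refine ⟨⟨_, a, ha, rfl⟩, ?_⟩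
    change f (a (f⁻¹ x)) = y
    rw [hab]
    exact f.apply_symm_apply y

end Regular

/-! ### Regular groups normalised by affine permutations -/

section Affine

variable {p q : ℕ} [hp : Fact p.Prime] [hq : Fact q.Prime]

/-- The permutation `(x, j) ↦ (a * x + b, d * j + e)`. -/
def affPerm (a : (ZMod p)ˣ) (b : ZMod p) (d : (ZMod q)ˣ) (e : ZMod q) :
    Equiv.Perm (ZMod p × ZMod q) where
  toFun z := (a * z.1 + b, d * z.2 + e)
  invFun z := (((a⁻¹ : (ZMod p)ˣ) : ZMod p) * (z.1 - b), ((d⁻¹ : (ZMod q)ˣ) : ZMod q) * (z.2 - e))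
  left_inv z := by
    simp only [add_sub_cancel_right, Units.inv_mul_cancel_left]
  right_inv z := by
    simp only [Units.mul_inv_cancel_left, sub_add_cancel]

theorem affPerm_apply (a : (ZMod p)ˣ) (b : ZMod p) (d : (ZMod q)ˣ) (e : ZMod q) (x j) :
    affPerm a b d e (x, j) = (a * x + b, d * j + e) := rfl

theorem shear_zero_pow (χ ω : AddChar (ZMod q) (ZMod p)) (t : ZMod p) (n : ℕ) :
    shear χ ω 0 t ^ n = shear χ ω 0 (n * t) := by
  induction n with
  | zero => simp [shear_zero_zero]
  | succ n ih =>
    rw [pow_succ', ih, shear_mul, add_zero]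
    congr 1
    simp
    ring

theorem exists_addChar_of_translation {f : ZMod q → ZMod p} {r : ZMod p} (h0 : f 0 = 1)
    (h : ∀ j, f (j + 1) = r * f j) : ∃ χ : AddChar (ZMod q) (ZMod p), ∀ j, f j = χ j := by
  have h1 : ∀ n : ℕ, f n = r ^ n := by
    intro n
    induction n with
    | zero => simpa using h0
    | succ n ih => rw [Nat.cast_succ, h, ih, pow_succ']
  -- f lives on Z/q, so f(q) = f(0) = 1.
  have h2 : r ^ q = 1 := by rw [← h1, ZMod.natCast_self, h0]
  obtain ⟨χ, hχ⟩ := exists_addChar_one_eq h2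
  refine ⟨χ, fun j => ?_⟩
  obtain ⟨n, rfl⟩ := ZMod.natCast_zmod_surjective j
  rw [h1, addChar_apply_eq_pow, hχ]

/-- The period divides p, and it cannot be p since there are only q < p points. -/
theorem eq_of_iterate_eq_of_card_lt {f : ZMod q → ZMod q} (hqp : q < p) {j : ZMod q}
    (h : f^[p] j = j) : f j = j := by
  have h1 : Function.IsPeriodicPt f p j := h
  rcases (Nat.dvd_prime hp.out).1 h1.minimalPeriod_dvd with h2 | h2
  · exact Function.minimalPeriod_eq_one_iff_isFixedPt.1 h2
  · exfalso
    have h3 := Function.iterate_injOn_Iio_minimalPeriod (f := f) (x := j)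
    rw [h2] at h3
    have h4 : Function.Injective fun i : Fin p => f^[i.1] j :=
      fun a b hab => Fin.ext (h3 a.2 b.2 hab)
    have h5 := Fintype.card_le_of_injective _ h4
    rw [Fintype.card_fin, ZMod.card] at h5
    omega

/-- Let ρ generate the subgroup of order p of N. The translation has order p and normalises ⟨ρ⟩, so
it commutes with ρ, which gives ρ the form (x + f(j), j). Normalisation by g makes f(j + 1) a
constant multiple of f(j), so f is a multiple of a character. -/
theorem exists_shear_mem {N : Subgroup (Equiv.Perm (ZMod p × ZMod q))} (hqp : q < p)
    (hreg : IsRegularPerm N) (hs : ∀ y ∈ N, shear 1 1 0 1 * y * (shear 1 1 0 1)⁻¹ ∈ N)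
    {a : (ZMod p)ˣ} (hg : ∀ y ∈ N, affPerm a 0 1 1 * y * (affPerm a 0 1 1)⁻¹ ∈ N) :
    ∃ χ : AddChar (ZMod q) (ZMod p), (∀ t, shear χ 1 0 t ∈ N) ∧
      ∀ n ∈ N, ∃ c, n * shear χ 1 0 1 = shear χ 1 0 c * n := by
  have hcard : Nat.card N = p * q := by
    rw [hreg.card_eq, Nat.card_prod, Nat.card_zmod, Nat.card_zmod]
  obtain ⟨⟨ρ, hρN⟩, hρ, hall⟩ := exists_orderOf_eq_prime_of_card_mul hp.out hq.out hqp hcard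
  rw [Subgroup.orderOf_mk] at hρ
  have hall' : ∀ y ∈ N, y ^ p = 1 → y ∈ Subgroup.zpowers ρ := by
    intro y hy hyp
    obtain ⟨n, hn⟩ := hall ⟨y, hy⟩ (Subtype.ext hyp)
    exact ⟨n, congrArg Subtype.val hn⟩
  have hρp : ρ ^ p = 1 := (congrArg (ρ ^ ·) hρ.symm).trans (pow_orderOf_eq_one ρ)
  have hconj : ∀ g : Equiv.Perm (ZMod p × ZMod q), (∀ y ∈ N, g * y * g⁻¹ ∈ N) →
      ∀ y ∈ Subgroup.zpowers ρ, g * y * g⁻¹ ∈ Subgroup.zpowers ρ := by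
    intro g hgN y hy
    have hyN : y ∈ N := (Subgroup.zpowers_le.2 hρN) hy
    refine hall' _ (hgN y hyN) ?_
    obtain ⟨n, rfl⟩ := hy
    change (g * ρ ^ n * g⁻¹) ^ p = 1
    rw [conj_pow, ← zpow_natCast, ← zpow_mul, mul_comm, zpow_mul, zpow_natCast, hρp, one_zpow,
      mul_one, mul_inv_cancel]
  have hsp : (shear 1 1 0 1 : Equiv.Perm (ZMod p × ZMod q)) ^ p = 1 := by
    rw [shear_zero_pow, ZMod.natCast_self, zero_mul, shear_zero_zero]
  have hcomm := commute_of_conj_mem_of_card_prime hp.out (by rw [Nat.card_zpowers, hρ])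
    (hconj _ hs) hsp (Subgroup.mem_zpowers ρ)
  have h1 : ∀ x j, ρ (x, j) = ((ρ (0, j)).1 + x, (ρ (0, j)).2) := by
    intro x j
    obtain ⟨n, rfl⟩ := ZMod.natCast_zmod_surjective x
    induction n with
    | zero => simp
    | succ n ih =>
      have h2 := DFunLike.congr_fun hcomm ((n : ZMod p), j)
      rw [Equiv.Perm.mul_apply, Equiv.Perm.mul_apply, ih, shear_apply, shear_apply] at h2
      simp only [AddChar.one_apply, one_mul, mul_one, add_zero] at h2
      rw [Nat.cast_succ, ← h2, add_assoc]
  -- ρ induces a self-map of the second coordinate whose p-th iterate is the identity; on q < p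
  -- points it is the identity.
  have h2 : ∀ j, (ρ (0, j)).2 = j := by
    intro j
    refine eq_of_iterate_eq_of_card_lt (f := fun j => (ρ (0, j)).2) hqp ?_
    have h3 : ∀ n : ℕ, ∀ j, ((ρ ^ n) (0, j)).2 = (fun j => (ρ (0, j)).2)^[n] j := by
      intro n
      induction n with
      | zero => simp
      | succ n ih =>
        intro j
        rw [pow_succ', Equiv.Perm.mul_apply, Function.iterate_succ_apply', ← ih]
        conv_lhs => rw [← Prod.mk.eta (p := (ρ ^ n) (0, j)), h1]
    rw [← h3, hρp]
    rfl
  let f : ZMod q → ZMod p := fun j => (ρ (0, j)).1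
  have h3 : ∀ x j, ρ (x, j) = (x + f j, j) := by
    intro x j
    rw [h1, h2, add_comm]
  have hf : ∀ j, f j ≠ 0 := by
    intro j hj
    have h4 : ρ = 1 := hreg.eq_of_apply_eq hρN N.one_mem (x := (0, j)) (by rw [h3, hj]; simp)
    rw [h4, orderOf_one] at hρ
    exact hp.out.one_lt.ne hρ
  have hpow : ∀ (n : ℕ) x j, (ρ ^ n) (x, j) = (x + n * f j, j) := by
    intro n
    induction n with
    | zero => simp
    | succ n ih =>
      intro x j
      rw [pow_succ', Equiv.Perm.mul_apply, ih, h3, Nat.cast_succ]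
      ext
      · simp only
        ring
      · rfl
  have hzp : ∀ y ∈ Subgroup.zpowers ρ, ∃ n : ℕ, y = ρ ^ n := by
    intro y hy
    obtain ⟨n, hn⟩ := mem_powers_iff_mem_zpowers.2 hy
    exact ⟨n, hn.symm⟩
  obtain ⟨n, hn⟩ := hzp _ (hconj _ hg ρ (Subgroup.mem_zpowers ρ))
  -- Conjugating ρ by g gives a power ρ^n, so f rescales by the constant a / n under j ↦ j + 1.
  have h4 : ∀ j, (a : ZMod p) * f j = n * f (j + 1) := by
    intro j
    have h5 := DFunLike.congr_fun (mul_inv_eq_iff_eq_mul.1 hn) (0, j)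
    rw [Equiv.Perm.mul_apply, Equiv.Perm.mul_apply, h3, affPerm_apply, affPerm_apply, hpow] at h5
    simpa using congrArg Prod.fst h5
  have hn0 : (n : ZMod p) ≠ 0 := by
    intro h5
    have h6 := h4 0
    rw [h5, zero_mul] at h6
    exact (mul_ne_zero a.ne_zero (hf 0)) h6
  obtain ⟨χ, hχ⟩ := exists_addChar_of_translation (f := fun j => f j / f 0)
    (r := a / n) (div_self (hf 0)) (fun j => by
      have := h4 j
      have := hf 0
      field_simp
      rw [mul_comm, ← h4 j])
  have hfχ : ∀ j, f j = f 0 * χ j := fun j => by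
    rw [← hχ]
    exact (mul_div_cancel₀ (f j) (hf 0)).symm
  have hpow' : ∀ n : ℕ, ρ ^ n = shear χ 1 0 (n * f 0) := by
    intro n
    ext1 ⟨x, j⟩
    rw [hpow, shear_apply, hfχ]
    simp [mul_assoc]
  have hmem : ∀ t, ∃ n : ℕ, shear χ 1 0 t = ρ ^ n := by
    intro t
    obtain ⟨n, hn⟩ := ZMod.natCast_zmod_surjective (t / f 0)
    exact ⟨n, by rw [hpow', hn, div_mul_cancel₀ _ (hf 0)]⟩
  refine ⟨χ, fun t => ?_, fun y hy => ?_⟩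
  · obtain ⟨n, hn⟩ := hmem t
    exact hn ▸ N.pow_mem hρN n
  · obtain ⟨m, hm⟩ := hmem 1
    obtain ⟨n, hn⟩ := hzp _ (hconj y (fun z hz => N.mul_mem (N.mul_mem hy hz) (N.inv_mem hy))
      (shear χ 1 0 1) (hm ▸ Subgroup.pow_mem _ (Subgroup.mem_zpowers ρ) m))
    exact ⟨_, by rw [← hpow']; exact mul_inv_eq_iff_eq_mul.1 hn⟩

end Affine

/-! ### The action on the second coordinates -/

section Fibres

variable {p q : ℕ} [hp : Fact p.Prime] [hq : Fact q.Prime]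
  {N : Subgroup (Equiv.Perm (ZMod p × ZMod q))} {χ : AddChar (ZMod q) (ZMod p)}

theorem exists_mul_shear (hN : ∀ n ∈ N, ∃ c, n * shear χ 1 0 1 = shear χ 1 0 c * n)
    {n : Equiv.Perm (ZMod p × ZMod q)} (hn : n ∈ N) :
    ∃ c, ∀ t, n * shear χ 1 0 t = shear χ 1 0 (c * t) * n := by
  obtain ⟨c, hc⟩ := hN n hn
  refine ⟨c, fun t => ?_⟩
  obtain ⟨m, rfl⟩ := ZMod.natCast_zmod_surjective t
  have h1 : SemiconjBy n (shear χ 1 0 1) (shear χ 1 0 c) := hc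
  have h2 := h1.pow_right m
  rw [shear_zero_pow, shear_zero_pow, mul_one] at h2
  rw [mul_comm]
  exact h2

theorem shear_div_apply (x : ZMod p) (j : ZMod q) : shear χ 1 0 (x / χ j) (0, j) = (x, j) := by
  rw [shear_apply, div_mul_cancel₀ _ (addChar_ne_zero χ j)]
  simp

/-- The fibres of the second coordinate are the orbits of the normal subgroup of the maps (x +
tχ(j), j), so N permutes them. -/
theorem snd_apply_eq (hN : ∀ n ∈ N, ∃ c, n * shear χ 1 0 1 = shear χ 1 0 c * n)
    {n : Equiv.Perm (ZMod p × ZMod q)} (hn : n ∈ N) (x : ZMod p) (j : ZMod q) :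
    (n (x, j)).2 = (n (0, j)).2 := by
  obtain ⟨c, hc⟩ := exists_mul_shear hN hn
  have h1 := DFunLike.congr_fun (hc (x / χ j)) (0, j)
  rw [Equiv.Perm.mul_apply, Equiv.Perm.mul_apply, shear_div_apply] at h1
  rw [h1, ← Prod.mk.eta (p := n (0, j)), shear_apply]
  simp

/-- The permutation group on the second coordinates. -/
def sndHom (hN : ∀ n ∈ N, ∃ c, n * shear χ 1 0 1 = shear χ 1 0 c * n) :
    N →* Equiv.Perm (ZMod q) where
  toFun n :=
    { toFun := fun j => (n.1 (0, j)).2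
      invFun := fun j => (n.1⁻¹ (0, j)).2
      left_inv := fun j => by
        change (n.1⁻¹ (0, (n.1 (0, j)).2)).2 = j
        rw [← snd_apply_eq hN (N.inv_mem n.2) (n.1 (0, j)).1, Prod.mk.eta]
        exact congrArg Prod.snd (n.1.symm_apply_apply (0, j))
      right_inv := fun j => by
        change (n.1 (0, (n.1⁻¹ (0, j)).2)).2 = j
        rw [← snd_apply_eq hN n.2 (n.1⁻¹ (0, j)).1, Prod.mk.eta]
        exact congrArg Prod.snd (n.1.apply_symm_apply (0, j)) }
  map_one' := rfl
  map_mul' n m := by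
    ext1 j
    change (n.1 (m.1 (0, j))).2 = (n.1 (0, (m.1 (0, j)).2)).2
    rw [← snd_apply_eq hN n.2 (m.1 (0, j)).1, Prod.mk.eta]

theorem sndHom_apply (hN : ∀ n ∈ N, ∃ c, n * shear χ 1 0 1 = shear χ 1 0 c * n) (n : N)
    (z : ZMod p × ZMod q) : sndHom hN n z.2 = (n.1 z).2 :=
  (snd_apply_eq hN n.2 z.1 z.2).symm

theorem exists_eq_shear (hreg : IsRegularPerm N) (hχ : ∀ t, shear χ 1 0 t ∈ N)
    {n : Equiv.Perm (ZMod p × ZMod q)} (hn : n ∈ N) {z : ZMod p × ZMod q} (h : (n z).2 = z.2) :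
    ∃ t, n = shear χ 1 0 t := by
  refine ⟨((n z).1 - z.1) / χ z.2, hreg.eq_of_apply_eq hn (hχ _) (x := z) ?_⟩
  rw [← Prod.mk.eta (p := z), shear_apply]
  ext
  · simp [div_mul_cancel₀ _ (addChar_ne_zero χ z.2)]
  · simpa using h

theorem card_ker_sndHom (hreg : IsRegularPerm N) (hχ : ∀ t, shear χ 1 0 t ∈ N)
    (hN : ∀ n ∈ N, ∃ c, n * shear χ 1 0 1 = shear χ 1 0 c * n) :
    Nat.card (sndHom hN).ker = p := by
  refine Eq.trans ?_ (Nat.card_zmod p)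
  symm
  refine Nat.card_eq_of_bijective (fun t => ⟨⟨_, hχ t⟩, ?_⟩) ⟨fun t s h => ?_, ?_⟩
  · ext1 j
    change (shear χ 1 0 t (0, j)).2 = j
    rw [shear_apply]
    simp
  · have h1 : shear χ 1 0 t = shear χ 1 0 s := congrArg (fun a => a.1.1) h
    exact (shear_injective (x := 0) (j := 0) (DFunLike.congr_fun h1 (0, 0))).2
  · rintro ⟨⟨n, hn⟩, hk⟩
    obtain ⟨t, rfl⟩ := exists_eq_shear hreg hχ hn (z := (0, 0)) (DFunLike.congr_fun hk 0)
    exact ⟨t, rfl⟩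

theorem card_range_sndHom (hreg : IsRegularPerm N) (hχ : ∀ t, shear χ 1 0 t ∈ N)
    (hN : ∀ n ∈ N, ∃ c, n * shear χ 1 0 1 = shear χ 1 0 c * n) :
    Nat.card (sndHom hN).range = q := by
  have h1 := (sndHom hN).ker.card_mul_index
  rw [card_ker_sndHom hreg hχ hN, Subgroup.index_ker, hreg.card_eq, Nat.card_prod, Nat.card_zmod,
    Nat.card_zmod] at h1
  exact Nat.eq_of_mul_eq_mul_left hp.out.pos h1

/-- The image of N in Perm(Z/q) has order q and is normalised by j ↦ j + 1, which has order q. Hence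
they commute, and the image consists of translations. -/
theorem snd_apply_eq_add (hreg : IsRegularPerm N) (hχ : ∀ t, shear χ 1 0 t ∈ N)
    (hN : ∀ n ∈ N, ∃ c, n * shear χ 1 0 1 = shear χ 1 0 c * n) {a : (ZMod p)ˣ}
    (hg : ∀ y ∈ N, affPerm a 0 1 1 * y * (affPerm a 0 1 1)⁻¹ ∈ N)
    {n : Equiv.Perm (ZMod p × ZMod q)} (hn : n ∈ N) (x : ZMod p) (j : ZMod q) :
    (n (x, j)).2 = j + (n (0, 0)).2 := by
  have hγ : ∀ y ∈ (sndHom hN).range,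
      Equiv.addRight (1 : ZMod q) * y * (Equiv.addRight (1 : ZMod q))⁻¹ ∈ (sndHom hN).range := by
    rintro _ ⟨m, rfl⟩
    refine ⟨⟨_, hg _ m.2⟩, ?_⟩
    rw [eq_mul_inv_iff_mul_eq]
    ext1 i
    have h1 : (Equiv.addRight (1 : ZMod q)) i = (affPerm a 0 1 1 (0, i)).2 := by
      rw [affPerm_apply]; simp
    rw [Equiv.Perm.mul_apply, Equiv.Perm.mul_apply, h1, sndHom_apply]
    have h2 : (affPerm a 0 1 1 * m.1 * (affPerm a 0 1 1)⁻¹ : Equiv.Perm (ZMod p × ZMod q)) (affPerm a 0 1 1 (0, i)) =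
        affPerm a 0 1 1 (m.1 (0, i)) :=
      congrArg (fun z => affPerm a 0 1 1 (m.1 z)) (Equiv.symm_apply_apply _ _)
    rw [h2]
    change _ = (m.1 (0, i)).2 + 1
    rw [← Prod.mk.eta (p := m.1 (0, i)), affPerm_apply]
    simp
  have hγq : ∀ k : ℕ, ∀ i : ZMod q, (Equiv.addRight (1 : ZMod q) ^ k) i = i + k := by
    intro k
    induction k with
    | zero => simp
    | succ k ih =>
      intro i
      rw [pow_succ', Equiv.Perm.mul_apply, ih, Nat.cast_succ, ← add_assoc]
      rfl
  have hcomm := commute_of_conj_mem_of_card_prime hq.out (card_range_sndHom hreg hχ hN) hγ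
    (by ext1 i; rw [hγq]; simp) (x := sndHom hN ⟨n, hn⟩) ⟨_, rfl⟩
  rw [snd_apply_eq hN hn]
  obtain ⟨k, rfl⟩ := ZMod.natCast_zmod_surjective j
  induction k with
  | zero => simp
  | succ k ih =>
    have h1 := DFunLike.congr_fun hcomm (k : ZMod q)
    have h2 : (n (0, (k : ZMod q))).2 + 1 = (n (0, (k : ZMod q) + 1)).2 := h1
    rw [Nat.cast_succ, ← h2, ih]
    ring

end Fibres

/-! ### Recognising shear groups and their conjugates -/

section ShearCriterion

variable {p q : ℕ} [hp : Fact p.Prime] [hq : Fact q.Prime]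
  {N : Subgroup (Equiv.Perm (ZMod p × ZMod q))} {χ ω : AddChar (ZMod q) (ZMod p)}

/-- For regular groups an inclusion is an equality, and `shearGroup χ ω` is generated by the maps (x
+ tχ(j), j) and one element that shifts j by 1. -/
theorem eq_shearGroup_of_mem (hreg : IsRegularPerm N) (hχ : ∀ t, shear χ 1 0 t ∈ N) {μ : ZMod p}
    (h : shear χ ω 1 μ ∈ N) : N = shearGroup χ ω := by
  refine hreg.eq_of_le isRegularPerm_shearGroup ?_
  have h0 : ∀ t, shear χ ω 0 t ∈ N := fun t => by
    convert hχ t using 1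
    ext1 ⟨x, j⟩
    simp [shear_apply]
  have h1 : shear χ ω 1 0 ∈ N := by
    have h2 := N.mul_mem (h0 (-μ / χ 1)) h
    rw [shear_mul] at h2
    convert h2 using 2
    · simp
    · simp [div_mul_cancel₀ _ (addChar_ne_zero χ 1)]
  have h3 : ∀ n : ℕ, shear χ ω 1 0 ^ n = shear χ ω n 0 := by
    intro n
    induction n with
    | zero => simp [shear_zero_zero]
    | succ n ih =>
      rw [pow_succ', ih, shear_mul]
      congr 1
      · simp
      · simp
  rintro _ ⟨i, t, rfl⟩
  obtain ⟨n, rfl⟩ := ZMod.natCast_zmod_surjective i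
  have h4 := N.mul_mem (h0 (t / χ n)) (N.pow_mem h1 n)
  rw [h3, shear_mul] at h4
  convert h4 using 2
  · simp
  · simp [div_mul_cancel₀ _ (addChar_ne_zero χ _)]

/-- The conjugate of the group `shearGroup χ ω` by `(x, j) ↦ (x + l * β j, j)`. -/
def skewGroup (β : AddChar (ZMod q) (ZMod p)) (l : ZMod p) (χ ω : AddChar (ZMod q) (ZMod p)) :
    Subgroup (Equiv.Perm (ZMod p × ZMod q)) :=
  (shearGroup χ ω).map (MulAut.conj (shear β 1 0 l)).toMonoidHom

theorem shear_zero_inv (β ω : AddChar (ZMod q) (ZMod p)) (l : ZMod p) :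
    (shear β ω 0 l)⁻¹ = shear β ω 0 (-l) := by
  rw [inv_eq_iff_mul_eq_one, shear_mul, ← shear_zero_zero β ω]
  simp

/-- Conjugation by `shear β 1 0 l` fixes each map (x + tχ(j), j), so only the shifting element τ has
to be brought to standard form. -/
theorem eq_skewGroup_of_mem (hreg : IsRegularPerm N) (hχ : ∀ t, shear χ 1 0 t ∈ N)
    {β : AddChar (ZMod q) (ZMod p)} {l μ : ZMod p} {τ : Equiv.Perm (ZMod p × ZMod q)}
    (hτ : τ ∈ N) (h : shear β 1 0 l * shear χ ω 1 μ = τ * shear β 1 0 l) :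
    N = skewGroup β l χ ω := by
  have h1 : N.map (MulAut.conj (shear β 1 0 l)⁻¹).toMonoidHom = shearGroup χ ω := by
    refine eq_shearGroup_of_mem (μ := μ) (hreg.map_conj _) (fun t => ⟨_, hχ t, ?_⟩) ⟨_, hτ, ?_⟩
    · change (shear β 1 0 l)⁻¹ * _ * (shear β 1 0 l)⁻¹⁻¹ = _
      rw [inv_inv, mul_assoc, inv_mul_eq_iff_eq_mul]
      ext1 ⟨x, j⟩
      simp only [Equiv.Perm.mul_apply, shear_apply]
      ext
      · simp
        ring
      · simp
    · change (shear β 1 0 l)⁻¹ * _ * (shear β 1 0 l)⁻¹⁻¹ = _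
      rw [inv_inv, mul_assoc, inv_mul_eq_iff_eq_mul, h]
  rw [skewGroup, ← h1, Subgroup.map_map]
  convert (Subgroup.map_id N).symm
  ext1 y
  change shear β 1 0 l * ((shear β 1 0 l)⁻¹ * y * (shear β 1 0 l)⁻¹⁻¹) * (shear β 1 0 l)⁻¹ = y
  group

end ShearCriterion

/-! ### Linear recursions of first order -/

section Recursion

variable {F : Type*} [Field F] {k : ℕ → F} {a κ ζ : F}

/-- This is the resonant case k n = nκa^(n-1), multiplied by a to avoid the exponent n - 1. -/
theorem recursion_of_eq (h0 : k 0 = 0) (h : ∀ n, k (n + 1) = a * k n + κ * a ^ n) (n : ℕ) :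
    a * k n = n * (κ * a ^ n) := by
  induction n with
  | zero => simp [h0]
  | succ n ih =>
    rw [h, mul_add, ih, Nat.cast_succ]
    ring

theorem recursion_of_ne (h0 : k 0 = 0) (h : ∀ n, k (n + 1) = a * k n + κ * ζ ^ n) (n : ℕ) :
    (a - ζ) * k n = κ * (a ^ n - ζ ^ n) := by
  induction n with
  | zero => simp [h0]
  | succ n ih =>
    rw [h]
    linear_combination a * ih

/-- S records the first coordinate of τ^n (0, 0) in the case where τ also has linear coefficient a;
the resonant term n a^n then survives at n = q. -/
theorem recursion_sum {S : ℕ → F} (h0 : k 0 = 0) (h : ∀ n, k (n + 1) = a * k n + κ * ζ ^ n)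
    (hS0 : S 0 = 0) (hS : ∀ n, S (n + 1) = a * S n + k n) (n : ℕ) :
    a * (a - ζ) ^ 2 * S n = κ * (n * a ^ n * (a - ζ) - a * (a ^ n - ζ ^ n)) := by
  induction n with
  | zero => simp [hS0]
  | succ n ih =>
    rw [hS, Nat.cast_succ]
    linear_combination a * ih + a * (a - ζ) * recursion_of_ne h0 h n

end Recursion

/-! ### Solving for the regular groups -/

section RegularNormalized

variable {p q : ℕ} [hp : Fact p.Prime] [hq : Fact q.Prime]

/-- A regular group which is normalised by a translation and by `(x, j) ↦ (a * x, j + 1)`. -/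
theorem exists_eq_shearGroup {N : Subgroup (Equiv.Perm (ZMod p × ZMod q))} (hqp : q < p)
    (hreg : IsRegularPerm N) (hs : ∀ y ∈ N, shear 1 1 0 1 * y * (shear 1 1 0 1)⁻¹ ∈ N)
    {a : (ZMod p)ˣ} (hg : ∀ y ∈ N, affPerm a 0 1 1 * y * (affPerm a 0 1 1)⁻¹ ∈ N) :
    ∃ χ ω : AddChar (ZMod q) (ZMod p), (χ = 1 ∨ ω = 1) ∧ (N = shearGroup χ ω ∨
      ∃ (β : AddChar (ZMod q) (ZMod p)) (l : ZMod p), β 1 = a ∧ β ≠ χ ∧ β ≠ ω ∧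
        N = skewGroup β l χ ω) := by
  obtain ⟨χ, hχ, hN⟩ := exists_shear_mem hqp hreg hs hg
  -- N is generated by its subgroup of order p and τ, which turns out to be (x, j) ↦ (vx + k(j), j +
  -- 1) with k(0) = 0.
  obtain ⟨τ, hτ, hτ0⟩ := hreg.exists_apply_eq (0, 0) (0, 1)
  obtain ⟨c, hc⟩ := exists_mul_shear hN hτ
  obtain ⟨v, hv⟩ : ∃ v, v = c * χ 1 := ⟨_, rfl⟩
  obtain ⟨k, hk⟩ : ∃ k : ZMod q → ZMod p, ∀ j, k j = (τ (0, j)).1 := ⟨_, fun j => rfl⟩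
  have hτj : ∀ j, τ (0, j) = (k j, j + 1) := by
    intro j
    have h1 := snd_apply_eq_add hreg hχ hN hg hτ 0 j
    rw [hτ0] at h1
    exact Prod.ext (hk j).symm h1
  have hτx : ∀ x j, τ (x, j) = (v * x + k j, j + 1) := by
    intro x j
    have h1 := DFunLike.congr_fun (hc (x / χ j)) (0, j)
    rw [Equiv.Perm.mul_apply, Equiv.Perm.mul_apply, shear_div_apply, hτj, shear_apply] at h1
    rw [h1, hv, AddChar.map_add_eq_mul]
    have := addChar_ne_zero χ j
    ext
    · simp only [AddChar.one_apply, one_mul]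
      field_simp
      ring
    · simp
  have hk0 : k 0 = 0 := by rw [hk, hτ0]
  have hcoset : ∀ m ∈ N, ∀ z, (m z).2 = (τ z).2 → ∃ t, m = shear χ 1 0 t * τ := by
    intro m hm z hz
    obtain ⟨t, ht⟩ := exists_eq_shear hreg hχ (N.mul_mem hm (N.inv_mem hτ)) (z := τ z) (by
      rw [← hz]
      exact congrArg (fun z => (m z).2) (τ.symm_apply_apply z))
    exact ⟨t, mul_inv_eq_iff_eq_mul.1 ht⟩
  have happ : ∀ g m : Equiv.Perm (ZMod p × ZMod q), ∀ z, (g * m * g⁻¹) (g z) = g (m z) :=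
    fun g m z => congrArg (fun z => g (m z)) (g.symm_apply_apply z)
  -- commutation with the translation
  have hv1 : v ≠ 1 → χ = 1 := by
    intro hv1
    have h1 : ∀ j, (shear 1 1 0 1 * τ * (shear 1 1 0 1)⁻¹ : Equiv.Perm (ZMod p × ZMod q)) (1, j) =
        (k j + 1, j + 1) := by
      intro j
      have h2 := happ (shear 1 1 0 1) τ (0, j)
      rw [hτj, shear_apply, shear_apply] at h2
      simpa using h2
    obtain ⟨t, ht⟩ := hcoset _ (hs τ hτ) (1, 0) (by rw [h1, hτx])
    -- Conjugating by the translation changes τ by 1 - v in every fibre, and the change must be a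
    -- multiple of χ; if it is nonzero, χ is constant.
    have h3 : ∀ j, 1 - v = t * χ (j + 1) := by
      intro j
      have h4 := h1 j
      rw [ht, Equiv.Perm.mul_apply, hτx, shear_apply] at h4
      have h5 := congrArg Prod.fst h4
      simp only [AddChar.one_apply] at h5
      linear_combination -h5
    have ht0 : t ≠ 0 := by
      intro ht0
      have h4 := h3 0
      rw [ht0, zero_mul] at h4
      exact hv1 (sub_eq_zero.1 h4).symm
    refine addChar_ext_one (mul_left_cancel₀ ht0 ?_)
    have h6 := (h3 0).symm.trans (h3 (-1))
    simpa using h6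
  -- commutation with the affine permutation
  obtain ⟨κ, hκ⟩ : ∃ κ, ∀ j, k (j + 1) = a * k j + κ * χ j := by
    have h1 : ∀ j, (affPerm a 0 1 1 * τ * (affPerm a 0 1 1)⁻¹ : Equiv.Perm (ZMod p × ZMod q))
        (0, j + 1) = (a * k j, j + 1 + 1) := by
      intro j
      have h2 := happ (affPerm a 0 1 1) τ (0, j)
      rw [hτj, affPerm_apply, affPerm_apply] at h2
      simpa using h2
    obtain ⟨t, ht⟩ := hcoset _ (hg τ hτ) (0, 0 + 1) (by rw [h1, hτx])
    -- The identity is read off in the fibre over j + 2, and χ(j + 2) = χ(2)χ(j).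
    refine ⟨-t * χ 2, fun j => ?_⟩
    have h4 := h1 j
    rw [ht, Equiv.Perm.mul_apply, hτx, shear_apply] at h4
    have h5 := congrArg Prod.fst h4
    have h6 : χ (j + 1 + 1) = χ 2 * χ j := by
      rw [← AddChar.map_add_eq_mul]
      congr 1
      ring
    simp only [AddChar.one_apply, h6] at h5
    linear_combination h5
  obtain ⟨S, hS⟩ : ∃ S : ℕ → ZMod p, ∀ n, S n = ((τ ^ n) (0, 0)).1 := ⟨_, fun n => rfl⟩
  have hτn : ∀ n : ℕ, (∀ x, (τ ^ n) (x, 0) = (v ^ n * x + S n, (n : ZMod q))) ∧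
      S (n + 1) = v * S n + k n := by
    intro n
    have h1 : ∀ x, (τ ^ n) (x, 0) = (v ^ n * x + S n, (n : ZMod q)) := by
      induction n with
      | zero => simp [hS]
      | succ n ih =>
        intro x
        have h2 : ∀ x, (τ ^ (n + 1)) (x, 0) =
            (v * (v ^ n * x + S n) + k n, (n : ZMod q) + 1) := fun x => by
          rw [pow_succ', Equiv.Perm.mul_apply, ih, hτx]
        have h3 : S (n + 1) = v * S n + k n := by
          rw [hS, h2, mul_zero, zero_add]
        rw [h2, h3]
        ext
        · simp only
          ring
        · simp
    refine ⟨h1, ?_⟩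
    rw [hS, pow_succ', Equiv.Perm.mul_apply, h1, hτx, mul_zero, zero_add]
  have hS0 : S 0 = 0 := by simp [hS]
  -- τ^q fixes the second coordinate, so it is (x + tχ(j), j). Its linear part gives v^q = 1 and its
  -- translation part gives S q = t.
  obtain ⟨t, ht⟩ := exists_eq_shear hreg hχ (N.pow_mem hτ q) (z := (0, 0))
    (by rw [(hτn q).1]; simp)
  have hSq : S q = t := by
    rw [hS, ht, shear_apply]
    simp
  have hvq : v ^ q = 1 := by
    have h1 := (hτn q).1 1
    rw [ht, shear_apply, hSq] at h1
    have h2 := congrArg Prod.fst h1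
    simp only [AddChar.map_zero_eq_one] at h2
    linear_combination -h2
  obtain ⟨ω, hω⟩ := exists_addChar_one_eq hvq
  obtain ⟨s, hsk⟩ : ∃ s : ℕ → ZMod p, ∀ n, s n = k n := ⟨_, fun n => rfl⟩
  have hs0 : s 0 = 0 := by rw [hsk, Nat.cast_zero, hk0]
  have hrec : ∀ n : ℕ, s (n + 1) = a * s n + κ * χ 1 ^ n := by
    intro n
    rw [hsk, hsk, Nat.cast_succ, hκ, addChar_apply_eq_pow]
  have hsq : s q = 0 := by rw [hsk, ZMod.natCast_self, hk0]
  refine ⟨χ, ω, ?_, ?_⟩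
  · by_cases h1 : v = 1
    · exact Or.inr (addChar_ext_one (by rw [hω, h1]; rfl))
    · exact Or.inl (hv1 h1)
  by_cases hκ0 : κ = 0
  · left
    have h1 : ∀ n : ℕ, k n = 0 := by
      intro n
      induction n with
      | zero => simpa using hk0
      | succ n ih => rw [Nat.cast_succ, hκ, ih, hκ0, mul_zero, zero_mul, zero_add]
    refine eq_shearGroup_of_mem hreg hχ (μ := 0) ?_
    convert hτ using 1
    ext1 ⟨x, j⟩
    obtain ⟨n, rfl⟩ := ZMod.natCast_zmod_surjective j
    rw [hτx, shear_apply, h1, hω, zero_mul]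
  right
  have hq0 : (q : ZMod p) ≠ 0 := by
    rw [Ne, ZMod.natCast_eq_zero_iff]
    exact fun h => hqp.not_ge (Nat.le_of_dvd hq.out.pos h)
  -- In the resonant case a · k(q) would be qκa^q, which is nonzero, whereas k(q) = k(0) = 0.
  have haχ : (a : ZMod p) ≠ χ 1 := by
    intro h1
    have h2 := recursion_of_eq hs0 (a := (a : ZMod p)) (κ := κ)
      (fun n => by rw [hrec n, ← h1]) q
    rw [hsq, mul_zero] at h2
    exact (mul_ne_zero hq0 (mul_ne_zero hκ0 (pow_ne_zero q a.ne_zero))) h2.symm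
  have haq : (a : ZMod p) ^ q = 1 := by
    have h2 := recursion_of_ne hs0 hrec q
    rw [hsq, mul_zero] at h2
    have h3 := (mul_eq_zero.1 h2.symm).resolve_left hκ0
    rw [addChar_pow_eq_one] at h3
    exact sub_eq_zero.1 h3
  obtain ⟨β, hβ⟩ := exists_addChar_one_eq haq
  -- τ commutes with its power τ^q, so t(v - χ(1)) = 0. If a = v this forces t = 0, but the closed
  -- form of S q = t is then nonzero.
  have hav : (a : ZMod p) ≠ v := by
    intro h1
    have h2 : τ * shear χ 1 0 t = shear χ 1 0 t * τ := by
      rw [← ht, ← pow_succ, pow_succ']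
    have h3 := congrArg Prod.fst (DFunLike.congr_fun h2 (0, 0))
    rw [Equiv.Perm.mul_apply, Equiv.Perm.mul_apply, hτ0, shear_apply, hτx, shear_apply] at h3
    simp only [AddChar.map_zero_eq_one, add_zero, hk0] at h3
    have h4 : t * (v - χ 1) = 0 := by linear_combination h3
    have h5 : t = 0 := (mul_eq_zero.1 h4).resolve_right (sub_ne_zero.2 (h1 ▸ haχ))
    have h6 := recursion_sum hs0 hrec hS0 (fun n => by rw [(hτn n).2, h1, hsk]) q
    rw [hSq, h5, haq, addChar_pow_eq_one, sub_self, mul_zero, mul_zero, sub_zero, mul_one] at h6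
    exact (mul_ne_zero hκ0 (mul_ne_zero hq0 (sub_ne_zero.2 haχ))) h6.symm
  have h1 := sub_ne_zero.2 haχ
  have h2 := sub_ne_zero.2 hav
  -- Conjugating (vx + μχ(j), j + 1) by (x + lβ(j), j) gives k(j) = μχ(j) + l(a - v)β(j). Comparison
  -- with the solution κ(a^n - χ(1)^n) / (a - χ(1)) of the recursion gives l and μ.
  refine ⟨β, κ / ((a - v) * (a - χ 1)), hβ, fun h => haχ (by rw [← hβ, h]),
    fun h => hav (by rw [← hβ, h, hω]), ?_⟩
  refine eq_skewGroup_of_mem hreg hχ hτ (μ := -κ / (a - χ 1)) ?_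
  ext1 ⟨x, j⟩
  obtain ⟨n, rfl⟩ := ZMod.natCast_zmod_surjective j
  have h3 := recursion_of_ne hs0 hrec n
  rw [Equiv.Perm.mul_apply, Equiv.Perm.mul_apply, shear_apply, shear_apply, shear_apply, hτx, hω,
    AddChar.map_add_eq_mul, hβ, addChar_apply_eq_pow, addChar_apply_eq_pow, hβ]
  have h4 : k (n : ZMod q) = κ * ((a : ZMod p) ^ n - χ 1 ^ n) / (a - χ 1) := by
    rw [← h3, mul_div_cancel_left₀ _ h1, hsk]
  ext
  · simp only [AddChar.one_apply, add_zero, h4]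
    field_simp
    ring
  · simp

end RegularNormalized

theorem mem_regularNormalized_subtype {X : Type*} {G N : Subgroup (Equiv.Perm X)} :
    N ∈ regularNormalized G.subtype ↔ IsRegularPerm N ∧ ∀ g ∈ G, ∀ y ∈ N, g * y * g⁻¹ ∈ N := by
  refine and_congr_right fun _ => ⟨fun h g hg y hy => ?_, fun h g => ?_⟩
  · exact (Subgroup.mem_normalizer_iff.1 (h ⟨g, hg⟩) y).1 hy
  · rw [Subgroup.mem_normalizer_iff]
    intro y
    refine ⟨h g g.2 y, fun hy => ?_⟩
    have h1 := h _ (G.inv_mem g.2) _ hy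
    convert h1 using 1
    simp [mul_assoc]

/-! ### Groups of affine maps that translate the second coordinate -/

section AffGroup

variable {p q : ℕ} [hp : Fact p.Prime] [hq : Fact q.Prime]

theorem affPerm_mul (a a' : (ZMod p)ˣ) (b b' : ZMod p) (d d' : (ZMod q)ˣ) (e e' : ZMod q) :
    affPerm a b d e * affPerm a' b' d' e' = affPerm (a * a') (a * b' + b) (d * d') (d * e' + e) := by
  ext1 ⟨x, j⟩
  rw [Equiv.Perm.mul_apply, affPerm_apply, affPerm_apply, affPerm_apply]
  ext
  · simp only [Units.val_mul]
    ring
  · simp only [Units.val_mul]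
    ring

theorem affPerm_one : affPerm (1 : (ZMod p)ˣ) 0 (1 : (ZMod q)ˣ) 0 = 1 := by
  ext1 ⟨x, j⟩
  simp [affPerm_apply]

/-- The group of the permutations `(x, j) ↦ (a * x + b, j + e)` with `(a, e)` in `B`. -/
def affGroup (B : Subgroup ((ZMod p)ˣ × Multiplicative (ZMod q))) :
    Subgroup (Equiv.Perm (ZMod p × ZMod q)) where
  carrier := {g | ∃ u ∈ B, ∃ b, g = affPerm u.1 b 1 u.2.toAdd}
  mul_mem' := by
    rintro _ _ ⟨u, hu, b, rfl⟩ ⟨u', hu', b', rfl⟩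
    refine ⟨u * u', B.mul_mem hu hu', u.1 * b' + b, (affPerm_mul _ _ _ _ _ _ _ _).trans ?_⟩
    congr 1
    · simp
    · simp [add_comm]
  one_mem' := ⟨1, B.one_mem, 0, affPerm_one.symm⟩
  inv_mem' := by
    rintro _ ⟨u, hu, b, rfl⟩
    refine ⟨u⁻¹, B.inv_mem hu, -((u.1⁻¹ : (ZMod p)ˣ) * b), ?_⟩
    rw [inv_eq_iff_mul_eq_one, affPerm_mul, ← affPerm_one]
    congr 1
    · exact mul_inv_cancel _
    · rw [mul_neg, Units.mul_inv_cancel_left, neg_add_cancel]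
    · exact mul_one _
    · simp

variable {B : Subgroup ((ZMod p)ˣ × Multiplicative (ZMod q))}

theorem affPerm_mem {u : (ZMod p)ˣ × Multiplicative (ZMod q)} (hu : u ∈ B) (b : ZMod p) :
    affPerm u.1 b 1 u.2.toAdd ∈ affGroup B := ⟨u, hu, b, rfl⟩

theorem shear_one_one_eq (i : ZMod q) (t : ZMod p) : shear 1 1 i t = affPerm 1 t 1 i := by
  ext1 ⟨x, j⟩
  simp [affPerm_apply, shear_apply]

theorem affPerm_mul_shear {χ ω : AddChar (ZMod q) (ZMod p)} (h : χ = 1 ∨ ω = 1) (a : (ZMod p)ˣ)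
    (b : ZMod p) (e i : ZMod q) (t : ZMod p) :
    ∃ s, affPerm a b 1 e * shear χ ω i t = shear χ ω i s * affPerm a b 1 e := by
  rcases h with rfl | rfl
  · refine ⟨a * t + (1 - ω i) * b, ?_⟩
    ext1 ⟨x, j⟩
    rw [Equiv.Perm.mul_apply, Equiv.Perm.mul_apply, affPerm_apply, shear_apply, affPerm_apply,
      shear_apply]
    ext
    · simp only [AddChar.one_apply]
      ring
    · simp only [Units.val_one]
      ring
  · refine ⟨a * t * χ (-e), ?_⟩
    ext1 ⟨x, j⟩
    rw [Equiv.Perm.mul_apply, Equiv.Perm.mul_apply, affPerm_apply, shear_apply, affPerm_apply,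
      shear_apply]
    ext
    · simp only [Units.val_one, one_mul, AddChar.map_add_eq_mul, AddChar.one_apply]
      linear_combination (-(a * t * χ j)) * addChar_neg_mul χ e
    · simp only [Units.val_one]
      ring

theorem shearGroup_mem_regularNormalized {χ ω : AddChar (ZMod q) (ZMod p)} (h : χ = 1 ∨ ω = 1) :
    shearGroup χ ω ∈ regularNormalized (affGroup B).subtype := by
  rw [mem_regularNormalized_subtype]
  refine ⟨isRegularPerm_shearGroup, ?_⟩
  rintro _ ⟨u, -, b, rfl⟩ _ ⟨i, t, rfl⟩
  obtain ⟨s, hs⟩ := affPerm_mul_shear h u.1 b u.2.toAdd i t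
  rw [hs, mul_inv_cancel_right]
  exact shear_mem i s

theorem exists_eq_shearGroup_of_mem_regularNormalized (hqp : q < p) {a : (ZMod p)ˣ}
    (ha : (a, Multiplicative.ofAdd 1) ∈ B) {N : Subgroup (Equiv.Perm (ZMod p × ZMod q))}
    (hN : N ∈ regularNormalized (affGroup B).subtype) :
    ∃ χ ω : AddChar (ZMod q) (ZMod p), (χ = 1 ∨ ω = 1) ∧ (N = shearGroup χ ω ∨
      ∃ (β : AddChar (ZMod q) (ZMod p)) (l : ZMod p), β 1 = a ∧ β ≠ χ ∧ β ≠ ω ∧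
        N = skewGroup β l χ ω) := by
  rw [mem_regularNormalized_subtype] at hN
  refine exists_eq_shearGroup hqp hN.1 (hN.2 _ ?_) (hN.2 _ (affPerm_mem ha 0))
  rw [shear_one_one_eq]
  exact affPerm_mem (u := 1) B.one_mem 1

theorem regularNormalized_affGroup (hqp : q < p) {a : (ZMod p)ˣ}
    (ha : (a, Multiplicative.ofAdd 1) ∈ B)
    (hβ : ∀ β : AddChar (ZMod q) (ZMod p), β 1 = a → β = 1) :
    regularNormalized (affGroup B).subtype =
      {N | ∃ χ ω : AddChar (ZMod q) (ZMod p), (χ = 1 ∨ ω = 1) ∧ N = shearGroup χ ω} := by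
  ext N
  constructor
  · intro hN
    obtain ⟨χ, ω, h, hN | ⟨β, l, h1, h2, h3, -⟩⟩ :=
      exists_eq_shearGroup_of_mem_regularNormalized hqp ha hN
    · exact ⟨χ, ω, h, hN⟩
    -- Here β is trivial, but it must differ from χ and from ω, one of which is trivial too.
    · rw [hβ β h1] at h2 h3
      exact (h.elim h2.symm h3.symm).elim
  · rintro ⟨χ, ω, h, rfl⟩
    exact shearGroup_mem_regularNormalized h

theorem skewGroup_zero (β χ ω : AddChar (ZMod q) (ZMod p)) :
    skewGroup β 0 χ ω = shearGroup χ ω := by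
  rw [skewGroup, shear_zero_zero, map_one]
  exact Subgroup.map_id _

/-- Since a = α(e) on B, scaling by a matches α(j + e) = aα(j): the maps (x + lα(j), j) centralise
the group, so their conjugates of normalised subgroups are again normalised. -/
theorem regularNormalized_affGroup_graph (hqp : q < p) {α : AddChar (ZMod q) (ZMod p)}
    {a : (ZMod p)ˣ} (ha : (a, Multiplicative.ofAdd 1) ∈ B) (hα : α 1 = a)
    (hB : ∀ u ∈ B, (u.1 : ZMod p) = α u.2.toAdd) :
    regularNormalized (affGroup B).subtype =
      {N | ∃ (l : ZMod p) (χ ω : AddChar (ZMod q) (ZMod p)), (χ = 1 ∨ ω = 1) ∧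
        N = skewGroup α l χ ω} := by
  ext N
  constructor
  · intro hN
    obtain ⟨χ, ω, h, hN | ⟨β, l, h1, h2, h3, hN⟩⟩ :=
      exists_eq_shearGroup_of_mem_regularNormalized hqp ha hN
    · exact ⟨0, χ, ω, h, hN.trans (skewGroup_zero _ _ _).symm⟩
    · obtain rfl : β = α := addChar_ext_one (h1.trans hα.symm)
      exact ⟨l, χ, ω, h, hN⟩
  · rintro ⟨l, χ, ω, h, rfl⟩
    have h1 := mem_regularNormalized_subtype.1 (shearGroup_mem_regularNormalized (B := B) h)
    rw [mem_regularNormalized_subtype]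
    refine ⟨h1.1.map_conj _, ?_⟩
    rintro g hg _ ⟨y, hy, rfl⟩
    refine ⟨_, h1.2 g hg y hy, ?_⟩
    obtain ⟨u, hu, b, rfl⟩ := hg
    have h2 : affPerm u.1 b 1 u.2.toAdd * shear α 1 0 l = shear α 1 0 l *
        affPerm u.1 b 1 u.2.toAdd := by
      ext1 ⟨x, j⟩
      rw [Equiv.Perm.mul_apply, Equiv.Perm.mul_apply, affPerm_apply, shear_apply, affPerm_apply,
        shear_apply, hB u hu]
      ext
      · simp only [Units.val_one, one_mul, AddChar.map_add_eq_mul, AddChar.one_apply]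
        ring
      · simp only [Units.val_one]
        ring
    generalize affPerm u.1 b 1 u.2.toAdd = g at h2
    change shear α 1 0 l * (g * y * g⁻¹) * (shear α 1 0 l)⁻¹ =
      g * (shear α 1 0 l * y * (shear α 1 0 l)⁻¹) * g⁻¹
    have h3 : g⁻¹ * (shear α 1 0 l)⁻¹ = (shear α 1 0 l)⁻¹ * g⁻¹ := by
      rw [← mul_inv_rev, ← h2, mul_inv_rev]
    calc shear α 1 0 l * (g * y * g⁻¹) * (shear α 1 0 l)⁻¹
        = shear α 1 0 l * g * y * (g⁻¹ * (shear α 1 0 l)⁻¹) := by group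
      _ = g * shear α 1 0 l * y * ((shear α 1 0 l)⁻¹ * g⁻¹) := by rw [h2, h3]
      _ = g * (shear α 1 0 l * y * (shear α 1 0 l)⁻¹) * g⁻¹ := by group

end AffGroup

/-! ### Counting -/

section Counting

variable {p q : ℕ} [hp : Fact p.Prime] [hq : Fact q.Prime]
  {B : Subgroup ((ZMod p)ˣ × Multiplicative (ZMod q))}

theorem mem_skewGroup {β χ ω : AddChar (ZMod q) (ZMod p)} {l : ZMod p}
    {g : Equiv.Perm (ZMod p × ZMod q)} : g ∈ skewGroup β l χ ω ↔
      ∃ i t, ∀ x j, g (x, j) = (ω i * x + t * χ j + l * (β i - ω i) * β j, j + i) := by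
  have h1 : ∀ i t x j, (shear β 1 0 l * shear χ ω i t * (shear β 1 0 l)⁻¹) (x, j) =
      (ω i * x + t * χ j + l * (β i - ω i) * β j, j + i) := by
    intro i t x j
    rw [shear_zero_inv, Equiv.Perm.mul_apply, Equiv.Perm.mul_apply, shear_apply, shear_apply,
      shear_apply]
    ext
    · simp only [AddChar.map_add_eq_mul, AddChar.map_zero_eq_one]
      ring
    · simp
  constructor
  · rintro ⟨_, ⟨i, t, rfl⟩, rfl⟩
    exact ⟨i, t, h1 i t⟩
  · rintro ⟨i, t, h⟩
    refine ⟨_, shear_mem i t, ?_⟩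
    ext1 ⟨x, j⟩
    exact (h1 i t x j).trans (h x j).symm

/-- When β = χ the conjugating element already lies in `shearGroup χ ω`. -/
theorem skewGroup_eq_left (χ ω : AddChar (ZMod q) (ZMod p)) (l : ZMod p) :
    skewGroup χ l χ ω = shearGroup χ ω := by
  rw [← skewGroup_zero χ χ ω]
  ext g
  rw [mem_skewGroup, mem_skewGroup]
  constructor
  · rintro ⟨i, t, h⟩
    refine ⟨i, t + l * (χ i - ω i), fun x j => (h x j).trans ?_⟩
    ext <;> ring
  · rintro ⟨i, t, h⟩
    refine ⟨i, t - l * (χ i - ω i), fun x j => (h x j).trans ?_⟩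
    ext <;> ring

/-- When β = ω the conjugating element centralises `shearGroup χ ω`. -/
theorem skewGroup_eq_right (χ ω : AddChar (ZMod q) (ZMod p)) (l : ZMod p) :
    skewGroup ω l χ ω = shearGroup χ ω := by
  rw [← skewGroup_zero ω χ ω]
  ext g
  rw [mem_skewGroup, mem_skewGroup]
  simp

theorem skewGroup_injective {β χ ω χ' ω' : AddChar (ZMod q) (ZMod p)} {l l' : ZMod p}
    (h : skewGroup β l χ ω = skewGroup β l' χ' ω') :
    χ = χ' ∧ ω = ω' ∧ (β ≠ χ → β ≠ ω → l = l') := by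
  have hmem : ∀ i t, ∃ i' t', ∀ x j, ω i * x + t * χ j + l * (β i - ω i) * β j =
      ω' i' * x + t' * χ' j + l' * (β i' - ω' i') * β j ∧ i = i' := by
    intro i t
    have h1 : shear β 1 0 l * shear χ ω i t * (shear β 1 0 l)⁻¹ ∈ skewGroup β l χ ω :=
      ⟨_, shear_mem i t, rfl⟩
    obtain ⟨i₁, t₁, h2⟩ := mem_skewGroup.1 h1
    obtain ⟨i', t', h3⟩ := mem_skewGroup.1 (h ▸ h1)
    have h4 : ∀ x j, (shear β 1 0 l * shear χ ω i t * (shear β 1 0 l)⁻¹) (x, j) =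
      (ω i * x + t * χ j + l * (β i - ω i) * β j, j + i) := by
      intro x j
      rw [shear_zero_inv, Equiv.Perm.mul_apply, Equiv.Perm.mul_apply, shear_apply, shear_apply,
        shear_apply]
      ext
      · simp only [AddChar.map_add_eq_mul, AddChar.map_zero_eq_one]
        ring
      · simp
    refine ⟨i', t', fun x j => ?_⟩
    have h5 := (h4 x j).symm.trans (h3 x j)
    rw [Prod.mk.injEq] at h5
    exact ⟨h5.1, add_left_cancel h5.2⟩
  -- The elements with parameters (i, t) = (0, 1) determine χ; those with (1, 0) then determine ω
  -- and, when possible, l.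
  have hχ : χ = χ' := by
    obtain ⟨i', t', h1⟩ := hmem 0 1
    have h2 := (h1 0 0).2
    subst h2
    have h3 : ∀ j, χ j = t' * χ' j := fun j => by simpa using (h1 0 j).1
    have h4 := h3 0
    simp only [AddChar.map_zero_eq_one, mul_one] at h4
    ext j
    rw [h3, ← h4, one_mul]
  subst hχ
  obtain ⟨i', t', h1⟩ := hmem 1 0
  have h2 := (h1 0 0).2
  subst h2
  have hω : ω = ω' := by
    refine addChar_ext_one ?_
    linear_combination (h1 1 0).1 - (h1 0 0).1
  subst hω
  refine ⟨rfl, rfl, fun hβχ hβω => ?_⟩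
  by_contra hl
  have h3 : (l - l') * (β 1 - ω 1) ≠ 0 :=
    mul_ne_zero (sub_ne_zero.2 hl) (sub_ne_zero.2 fun h => hβω (addChar_ext_one h))
  -- If l and l' differ, comparing the fibres over 0 and 1 shows that β(1) = χ(1).
  refine hβχ (addChar_ext_one (mul_left_cancel₀ h3 ?_))
  have h4 := (h1 0 0).1
  have h5 := (h1 0 1).1
  simp only [AddChar.map_zero_eq_one] at h4
  linear_combination h5 - χ 1 * h4

theorem isCyclic_skewGroup_iff {β χ ω : AddChar (ZMod q) (ZMod p)} {l : ZMod p}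
    (h : χ = 1 ∨ ω = 1) (hpq : p ≠ q) : IsCyclic (skewGroup β l χ ω) ↔ χ = 1 ∧ ω = 1 := by
  rw [← isCyclic_shearGroup_iff h hpq]
  exact isCyclic_congr' ((shearGroup χ ω).equivMapOfInjective _ (MulEquiv.injective _)).symm

theorem skewGroup_commute_iff {β χ ω : AddChar (ZMod q) (ZMod p)} {l : ZMod p}
    (h : χ = 1 ∨ ω = 1) :
    (∃ a b : skewGroup β l χ ω, a * b ≠ b * a) ↔ ¬(χ = 1 ∧ ω = 1) := by
  rw [← shearGroup_commute_iff h]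
  exact exists_mul_ne_congr ((shearGroup χ ω).equivMapOfInjective _ (MulEquiv.injective _)).symm

theorem ncard_pairs (s : Set (AddChar (ZMod q) (ZMod p))) (hs : 1 ∉ s) :
    Set.ncard {c : AddChar (ZMod q) (ZMod p) × AddChar (ZMod q) (ZMod p) |
      (c.1 = 1 ∧ c.2 ∈ s) ∨ (c.1 ∈ s ∧ c.2 = 1)} = 2 * s.ncard := by
  have h1 : {c : AddChar (ZMod q) (ZMod p) × AddChar (ZMod q) (ZMod p) |
      (c.1 = 1 ∧ c.2 ∈ s) ∨ (c.1 ∈ s ∧ c.2 = 1)} = ({1} ×ˢ s) ∪ (s ×ˢ {1}) := by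
    ext c
    simp
  rw [h1, Set.ncard_union_eq, Set.ncard_prod, Set.ncard_prod, Set.ncard_singleton, one_mul,
    mul_one, two_mul]
  rw [Set.disjoint_left]
  rintro c ⟨hc, -⟩ ⟨hc', -⟩
  rw [Set.mem_singleton_iff.1 hc] at hc'
  exact hs hc'

theorem ncard_compl_one (hd : q ∣ p - 1) :
    ({1}ᶜ : Set (AddChar (ZMod q) (ZMod p))).ncard = q - 1 := by
  rw [Set.ncard_compl, Set.ncard_singleton, card_addChar hd]

theorem ncard_compl_pair (hd : q ∣ p - 1) {α : AddChar (ZMod q) (ZMod p)} (hα : α ≠ 1) :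
    ({1, α}ᶜ : Set (AddChar (ZMod q) (ZMod p))).ncard = q - 2 := by
  rw [Set.ncard_compl, Set.ncard_pair hα.symm, card_addChar hd]

theorem ncard_cyclic_affGroup (hqp : q < p) {a : (ZMod p)ˣ}
    (ha : (a, Multiplicative.ofAdd 1) ∈ B)
    (hβ : ∀ β : AddChar (ZMod q) (ZMod p), β 1 = a → β = 1) :
    Set.ncard {N | N ∈ regularNormalized (affGroup B).subtype ∧ IsCyclic N} = 1 := by
  rw [regularNormalized_affGroup hqp ha hβ, Set.ncard_eq_one]
  refine ⟨shearGroup 1 1, Set.ext fun N => ?_⟩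
  constructor
  · rintro ⟨⟨χ, ω, h, rfl⟩, hc⟩
    obtain ⟨rfl, rfl⟩ := (isCyclic_shearGroup_iff h hqp.ne').1 hc
    rfl
  · rintro rfl
    exact ⟨⟨1, 1, Or.inl rfl, rfl⟩, (isCyclic_shearGroup_iff (Or.inl rfl) hqp.ne').2 ⟨rfl, rfl⟩⟩

theorem ncard_nonabelian_affGroup (hqp : q < p) (hd : q ∣ p - 1) {a : (ZMod p)ˣ}
    (ha : (a, Multiplicative.ofAdd 1) ∈ B)
    (hβ : ∀ β : AddChar (ZMod q) (ZMod p), β 1 = a → β = 1) :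
    Set.ncard {N | N ∈ regularNormalized (affGroup B).subtype ∧ ∃ a b : N, a * b ≠ b * a} =
      2 * (q - 1) := by
  rw [regularNormalized_affGroup hqp ha hβ, ← ncard_compl_one (p := p) hd, ← ncard_pairs {1}ᶜ (by simp)]
  symm
  refine Set.ncard_congr (fun c _ => shearGroup c.1 c.2) ?_ ?_ ?_
  · rintro ⟨χ, ω⟩ h
    have h1 : χ = 1 ∨ ω = 1 := h.imp And.left And.right
    refine ⟨⟨χ, ω, h1, rfl⟩, (shearGroup_commute_iff h1).2 ?_⟩
    rintro ⟨h2, h3⟩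
    rcases h with h | h
    · exact h.2 h3
    · exact h.1 h2
  · rintro ⟨χ, ω⟩ ⟨χ', ω'⟩ - - h
    obtain ⟨rfl, rfl⟩ := shearGroup_injective h
    rfl
  · rintro _ ⟨⟨χ, ω, h, rfl⟩, h1⟩
    rw [shearGroup_commute_iff h] at h1
    refine ⟨(χ, ω), ?_, rfl⟩
    rcases h with rfl | rfl
    · exact Or.inl ⟨rfl, fun h => h1 ⟨rfl, h⟩⟩
    · exact Or.inr ⟨fun h => h1 ⟨h, rfl⟩, rfl⟩

theorem ncard_cyclic_affGroup_graph (hqp : q < p) {α : AddChar (ZMod q) (ZMod p)} (hα1 : α ≠ 1)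
    {a : (ZMod p)ˣ} (ha : (a, Multiplicative.ofAdd 1) ∈ B) (hα : α 1 = a)
    (hB : ∀ u ∈ B, (u.1 : ZMod p) = α u.2.toAdd) :
    Set.ncard {N | N ∈ regularNormalized (affGroup B).subtype ∧ IsCyclic N} = p := by
  rw [regularNormalized_affGroup_graph hqp ha hα hB]
  have h1 : Set.ncard (Set.univ : Set (ZMod p)) = p := by rw [Set.ncard_univ, Nat.card_zmod]
  refine Eq.trans (Eq.symm ?_) h1
  refine Set.ncard_congr (fun l _ => skewGroup α l 1 1) ?_ ?_ ?_
  · intro l _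
    exact ⟨⟨l, 1, 1, Or.inl rfl, rfl⟩,
      (isCyclic_skewGroup_iff (Or.inl rfl) hqp.ne').2 ⟨rfl, rfl⟩⟩
  · intro l l' _ _ h
    exact (skewGroup_injective h).2.2 hα1 hα1
  · rintro _ ⟨⟨l, χ, ω, h, rfl⟩, hc⟩
    obtain ⟨rfl, rfl⟩ := (isCyclic_skewGroup_iff h hqp.ne').1 hc
    exact ⟨l, trivial, rfl⟩

theorem ncard_nonabelian_affGroup_graph (hqp : q < p) (hd : q ∣ p - 1)
    {α : AddChar (ZMod q) (ZMod p)} (hα1 : α ≠ 1)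
    {a : (ZMod p)ˣ} (ha : (a, Multiplicative.ofAdd 1) ∈ B) (hα : α 1 = a)
    (hB : ∀ u ∈ B, (u.1 : ZMod p) = α u.2.toAdd) :
    Set.ncard {N | N ∈ regularNormalized (affGroup B).subtype ∧ ∃ a b : N, a * b ≠ b * a} =
      2 * p * (q - 2) + 2 := by
  rw [regularNormalized_affGroup_graph hqp ha hα hB]
  -- The 2(q - 2) pairs whose nontrivial member is not α give p distinct conjugates each; the two
  -- pairs containing α give one group each.
  have h1 : {N | (N ∈ {N | ∃ (l : ZMod p) (χ ω : AddChar (ZMod q) (ZMod p)), (χ = 1 ∨ ω = 1) ∧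
        N = skewGroup α l χ ω}) ∧ ∃ a b : N, a * b ≠ b * a} =
      (fun c : ZMod p × (AddChar (ZMod q) (ZMod p) × AddChar (ZMod q) (ZMod p)) =>
        skewGroup α c.1 c.2.1 c.2.2) '' (Set.univ ×ˢ {c | (c.1 = 1 ∧ c.2 ∈ ({1, α}ᶜ : Set _)) ∨
          (c.1 ∈ ({1, α}ᶜ : Set _) ∧ c.2 = 1)}) ∪ {shearGroup 1 α, shearGroup α 1} := by
    ext N
    constructor
    · rintro ⟨⟨l, χ, ω, h, rfl⟩, h1⟩
      rw [skewGroup_commute_iff h] at h1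
      by_cases hχ : χ = α
      · subst hχ
        right
        rw [skewGroup_eq_left]
        have hω : ω = 1 := h.resolve_left hα1
        rw [hω]
        exact Or.inr rfl
      by_cases hω : ω = α
      · subst hω
        right
        rw [skewGroup_eq_right]
        have hχ : χ = 1 := h.resolve_right hα1
        rw [hχ]
        exact Or.inl rfl
      left
      refine ⟨(l, χ, ω), ⟨trivial, ?_⟩, rfl⟩
      rcases h with rfl | rfl
      · exact Or.inl ⟨rfl, by simpa using ⟨fun h => h1 ⟨rfl, h⟩, hω⟩⟩
      · exact Or.inr ⟨by simpa using ⟨fun h => h1 ⟨h, rfl⟩, hχ⟩, rfl⟩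
    · rintro (⟨⟨l, χ, ω⟩, ⟨-, h⟩, rfl⟩ | h)
      · have h1 : χ = 1 ∨ ω = 1 := h.imp And.left And.right
        refine ⟨⟨l, χ, ω, h1, rfl⟩, (skewGroup_commute_iff h1).2 ?_⟩
        rintro ⟨h2, h3⟩
        rcases h with h | h
        · exact h.2 (Or.inl h3)
        · exact h.1 (Or.inl h2)
      · rcases h with rfl | rfl
        · exact ⟨⟨0, 1, α, Or.inl rfl, (skewGroup_zero _ _ _).symm⟩,
            (shearGroup_commute_iff (Or.inl rfl)).2 fun h => hα1 h.2⟩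
        · exact ⟨⟨0, α, 1, Or.inr rfl, (skewGroup_zero _ _ _).symm⟩,
            (shearGroup_commute_iff (Or.inr rfl)).2 fun h => hα1 h.1⟩
  rw [h1, Set.ncard_union_eq, Set.InjOn.ncard_image, Set.ncard_prod, ncard_pairs _ (by simp),
    ncard_compl_pair hd hα1, Set.ncard_univ, Nat.card_zmod, Set.ncard_pair]
  · ring
  · intro h
    exact hα1 (shearGroup_injective h).2
  · rintro ⟨l, χ, ω⟩ ⟨-, h⟩ ⟨l', χ', ω'⟩ - hl
    obtain ⟨rfl, rfl, h2⟩ := skewGroup_injective hl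
    have h3 : l = l' := by
      refine h2 ?_ ?_
      · rintro rfl
        rcases h with h | h
        · exact hα1 h.1
        · exact h.1 (Or.inr rfl)
      · rintro rfl
        rcases h with h | h
        · exact h.2 (Or.inr rfl)
        · exact hα1 h.2
    rw [h3]
  · rw [Set.disjoint_left]
    rintro _ ⟨⟨l, χ, ω⟩, ⟨-, h⟩, rfl⟩ h1
    simp only [← skewGroup_zero α] at h1
    rcases h1 with h1 | h1
    · obtain ⟨rfl, rfl, -⟩ := skewGroup_injective h1
      rcases h with h | h
      · exact h.2 (Or.inr rfl)
      · exact hα1 h.2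
    · obtain ⟨rfl, rfl, -⟩ := skewGroup_injective h1
      rcases h with h | h
      · exact hα1 h.1
      · exact h.1 (Or.inr rfl)

end Counting

/-! ### The six groups -/

section SixGroups

variable {p q : ℕ} [hp : Fact p.Prime] [hq : Fact q.Prime]

/-- The pairs `(a, e)` with `a ^ d = 1`. -/
def rootSub (p q d : ℕ) : Subgroup ((ZMod p)ˣ × Multiplicative (ZMod q)) where
  carrier := {u | u.1 ^ d = 1}
  mul_mem' := fun {u v} (hu : u.1 ^ d = 1) (hv : v.1 ^ d = 1) => by
    change (u.1 * v.1) ^ d = 1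
    rw [mul_pow, hu, hv, one_mul]
  one_mem' := one_pow d
  inv_mem' := fun {u} (hu : u.1 ^ d = 1) => by
    change (u.1⁻¹) ^ d = 1
    rw [inv_pow, hu, inv_one]

theorem mem_rootSub {d : ℕ} {u : (ZMod p)ˣ × Multiplicative (ZMod q)} :
    u ∈ rootSub p q d ↔ u.1 ^ d = 1 := Iff.rfl

/-- The pairs `(a, e)` with `a ^ (q + 1) = α e`. -/
def graphSub (α : AddChar (ZMod q) (ZMod p)) :
    Subgroup ((ZMod p)ˣ × Multiplicative (ZMod q)) where
  carrier := {u | (u.1 : ZMod p) ^ (q + 1) = α u.2.toAdd}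
  mul_mem' := fun {u v} (hu : (u.1 : ZMod p) ^ (q + 1) = _) (hv : (v.1 : ZMod p) ^ (q + 1) = _) => by
    change ((u.1 * v.1 : (ZMod p)ˣ) : ZMod p) ^ (q + 1) = α (u.2.toAdd + v.2.toAdd)
    rw [Units.val_mul, mul_pow, hu, hv, AddChar.map_add_eq_mul]
  one_mem' := by
    change ((1 : (ZMod p)ˣ) : ZMod p) ^ (q + 1) = α 0
    rw [Units.val_one, one_pow, AddChar.map_zero_eq_one]
  inv_mem' := fun {u} (hu : (u.1 : ZMod p) ^ (q + 1) = _) => by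
    change ((u.1⁻¹ : (ZMod p)ˣ) : ZMod p) ^ (q + 1) = α (-u.2.toAdd)
    rw [AddChar.map_neg_eq_inv, ← hu, Units.val_inv_eq_inv_val, inv_pow]

theorem mem_graphSub {α : AddChar (ZMod q) (ZMod p)}
    {u : (ZMod p)ˣ × Multiplicative (ZMod q)} :
    u ∈ graphSub α ↔ (u.1 : ZMod p) ^ (q + 1) = α u.2.toAdd := Iff.rfl

/-- The six subgroups of `(ZMod p)ˣ × ZMod q` that occur. -/
def sixSub (α : AddChar (ZMod q) (ZMod p)) :
    Fin 6 → Subgroup ((ZMod p)ˣ × Multiplicative (ZMod q)) :=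
  ![rootSub p q (2 * q), rootSub p q q, rootSub p q (2 * q) ⊓ graphSub α, rootSub p q 2,
    rootSub p q q ⊓ graphSub α, rootSub p q 1]

theorem units_pow_two_mul (hpq : p = 2 * q + 1) (a : (ZMod p)ˣ) : a ^ (2 * q) = 1 := by
  have h1 := ZMod.units_pow_card_sub_one_eq_one p a
  have h2 : p - 1 = 2 * q := by omega
  rwa [h2] at h1

theorem units_pow_eq (hpq : p = 2 * q + 1) (a : (ZMod p)ˣ) : a ^ q = 1 ∨ a ^ q = -1 := by
  have h1 := units_pow_two_mul hpq a
  rw [mul_comm, pow_mul] at h1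
  have h2 : ((a ^ q : (ZMod p)ˣ) : ZMod p) ^ 2 = 1 := by
    rw [← Units.val_pow_eq_pow_val, h1, Units.val_one]
  rcases sq_eq_sq_iff_eq_or_eq_neg.1 (h2.trans (one_pow 2).symm) with h | h
  · exact Or.inl (Units.ext h)
  · exact Or.inr (Units.ext h)

variable {B : Subgroup ((ZMod p)ˣ × Multiplicative (ZMod q))}

theorem multiplicative_pow_card (e : Multiplicative (ZMod q)) : e ^ q = 1 := by
  change Multiplicative.ofAdd (q • e.toAdd) = 1
  simp

/-- u is u^(q+1) times the inverse of u^q. For p = 2q + 1 with q odd these are its components of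
exponent q and 2, so B splits into a 2-part and a q-part. -/
theorem mem_iff_of_pow (u : (ZMod p)ˣ × Multiplicative (ZMod q)) :
    u ∈ B ↔ (u.1 ^ q, 1) ∈ B ∧ (u.1 ^ (q + 1), u.2) ∈ B := by
  have h1 : u ^ q = (u.1 ^ q, 1) := Prod.ext rfl (multiplicative_pow_card u.2)
  have h2 : u ^ (q + 1) = (u.1 ^ (q + 1), u.2) :=
    Prod.ext rfl (by rw [Prod.pow_snd, pow_succ, multiplicative_pow_card, one_mul])
  rw [← h1, ← h2]
  refine ⟨fun h => ⟨B.pow_mem h _, B.pow_mem h _⟩, fun ⟨h, h'⟩ => ?_⟩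
  rw [pow_succ] at h'
  exact (B.mul_mem_cancel_left h).1 h'

theorem char_mem {χ : AddChar (ZMod q) (ZMod p)} {w : (ZMod p)ˣ} {e₀ : Multiplicative (ZMod q)}
    (hw : (w, e₀) ∈ B) (hχ : χ 1 = w) (a : (ZMod p)ˣ) (j : ZMod q) (ha : (a : ZMod p) = χ j) :
    (a, e₀ ^ j.val) ∈ B := by
  have h1 : (w, e₀) ^ j.val = (a, e₀ ^ j.val) := by
    refine Prod.ext (Units.ext ?_) rfl
    rw [ha, Prod.pow_fst, Units.val_pow_eq_pow_val, ← hχ, ← addChar_apply_eq_pow,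
      ZMod.natCast_zmod_val]
  exact h1 ▸ B.pow_mem hw _

/-- The 2-part of B is trivial or {±1}. The q-part projects onto Z/q, so it is all of μ_q × Z/q or
the graph of a character, trivial or not. A nontrivial character is α after rescaling Z/q by c. -/
theorem exists_sixSub (hpq : p = 2 * q + 1) (hq2 : q ≠ 2) {α : AddChar (ZMod q) (ZMod p)}
    (hα : α ≠ 1) {a₀ : (ZMod p)ˣ} (ha₀ : (a₀, Multiplicative.ofAdd 1) ∈ B) :
    ∃ (i : Fin 6) (c : (ZMod q)ˣ), ∀ (a : (ZMod p)ˣ) (e : ZMod q),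
      (a, Multiplicative.ofAdd e) ∈ B ↔ (a, Multiplicative.ofAdd (c * e)) ∈ sixSub α i := by
  have hodd : Odd q := hq.out.odd_of_ne_two hq2
  have hpowq : ∀ a : (ZMod p)ˣ, (a ^ (q + 1)) ^ q = 1 := by
    intro a
    obtain ⟨k, hk⟩ := hodd.add_one
    rw [← pow_mul, show (q + 1) * q = 2 * q * k by rw [hk]; ring, pow_mul,
      units_pow_two_mul hpq, one_pow]
  have hD : ∀ a : (ZMod p)ˣ, (a ^ q, 1) ∈ B ↔ a ^ q = 1 ∨
      (-1, (1 : Multiplicative (ZMod q))) ∈ B := by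
    intro a
    constructor
    · intro h
      exact (units_pow_eq hpq a).imp_right fun h1 => by rwa [h1] at h
    · rintro (h | h)
      · rw [h]
        exact B.one_mem
      · rcases units_pow_eq hpq a with h1 | h1
        · rw [h1]
          exact B.one_mem
        · rwa [h1]
  -- χ is the character whose graph is generated by the q-component of (a₀, 1); the q-part of B
  -- always contains this graph.
  obtain ⟨χ, hχ⟩ := exists_addChar_one_eq (p := p) (q := q) (a := (a₀ ^ (q + 1) : (ZMod p)ˣ))
    (by rw [← Units.val_pow_eq_pow_val, hpowq, Units.val_one])
  have ha₁ : (a₀ ^ (q + 1), Multiplicative.ofAdd (1 : ZMod q)) ∈ B :=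
    ((mem_iff_of_pow _).1 ha₀).2
  have hofAdd : ∀ e : ZMod q, Multiplicative.ofAdd (1 : ZMod q) ^ e.val = Multiplicative.ofAdd e := by
    intro e
    rw [← ofAdd_nsmul, nsmul_one, ZMod.natCast_zmod_val]
  have hgraph : ∀ (a : (ZMod p)ˣ) (e : ZMod q), (a : ZMod p) = χ e →
      (a, Multiplicative.ofAdd e) ∈ B := by
    intro a e h
    have h1 := char_mem ha₁ hχ a e h
    rwa [hofAdd] at h1
  obtain ⟨χu, hχu⟩ : ∃ χu : ZMod q → (ZMod p)ˣ, ∀ e, (χu e : ZMod p) = χ e :=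
    ⟨fun e => (χ.val_isUnit e).unit, fun e => (χ.val_isUnit e).unit_spec⟩
  have hχuq : ∀ e, χu e ^ q = 1 := fun e => Units.ext (by
    rw [Units.val_pow_eq_pow_val, hχu, addChar_pow_eq_one, Units.val_one])
  have hquot : ∀ (a : (ZMod p)ˣ) (e : ZMod q), (a, Multiplicative.ofAdd e) ∈ B ↔
      (a * (χu e)⁻¹, 1) ∈ B := by
    intro a e
    have h1 := hgraph (χu e) e (hχu e)
    have h2 : (a, Multiplicative.ofAdd e) = (a * (χu e)⁻¹, 1) * (χu e, Multiplicative.ofAdd e) := by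
      ext1
      · simp
      · simp
    rw [h2, B.mul_mem_cancel_right h1]
  -- If B contains some (w, 1) with w a nontrivial q-th root of unity, its powers give all of μ_q
  -- and the q-part is full; otherwise the q-part is exactly the graph of χ.
  by_cases hcase : ∃ w : (ZMod p)ˣ, w ≠ 1 ∧ w ^ q = 1 ∧ (w, (1 : Multiplicative (ZMod q))) ∈ B
  · obtain ⟨w, hw1, hwq, hw⟩ := hcase
    obtain ⟨ψ, hψ⟩ := exists_addChar_one_eq (p := p) (q := q) (a := (w : ZMod p))
      (by rw [← Units.val_pow_eq_pow_val, hwq, Units.val_one])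
    have hψ1 : ψ ≠ 1 := by
      rintro rfl
      exact hw1 (Units.ext hψ.symm)
    have hall : ∀ z : (ZMod p)ˣ, z ^ q = 1 → (z, (1 : Multiplicative (ZMod q))) ∈ B := by
      intro z hz
      obtain ⟨j, hj⟩ := exists_addChar_eq hψ1 (a := (z : ZMod p))
        (by rw [← Units.val_pow_eq_pow_val, hz, Units.val_one])
      have h1 := char_mem hw hψ z j hj.symm
      rwa [one_pow] at h1
    have hB : ∀ (a : (ZMod p)ˣ) (e : ZMod q), (a, Multiplicative.ofAdd e) ∈ B ↔ a ^ q = 1 ∨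
        (-1, (1 : Multiplicative (ZMod q))) ∈ B := by
      intro a e
      rw [mem_iff_of_pow, hD, and_iff_left]
      rw [hquot]
      refine hall _ ?_
      rw [mul_pow, hpowq, inv_pow, hχuq, inv_one, one_mul]
    by_cases hm : (-1, (1 : Multiplicative (ZMod q))) ∈ B
    · refine ⟨0, 1, fun a e => ?_⟩
      rw [hB]
      exact iff_of_true (Or.inr hm) (units_pow_two_mul hpq a)
    · refine ⟨1, 1, fun a e => ?_⟩
      rw [hB, or_iff_left hm]
      exact Iff.rfl
  · push Not at hcase
    have hB : ∀ (a : (ZMod p)ˣ) (e : ZMod q), (a, Multiplicative.ofAdd e) ∈ B ↔ (a ^ q = 1 ∨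
        (-1, (1 : Multiplicative (ZMod q))) ∈ B) ∧ (a : ZMod p) ^ (q + 1) = χ e := by
      intro a e
      rw [mem_iff_of_pow, hD]
      refine and_congr_right fun _ => ?_
      constructor
      · intro h
        rw [hquot] at h
        have h1 : a ^ (q + 1) * (χu e)⁻¹ = 1 := by
          by_contra h2
          refine hcase _ h2 ?_ h
          rw [mul_pow, hpowq, inv_pow, hχuq, inv_one, one_mul]
        rw [mul_inv_eq_one] at h1
        rw [← Units.val_pow_eq_pow_val, h1, hχu]
      · intro h
        exact hgraph _ _ h
    by_cases hχ1 : χ = 1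
    · by_cases hm : (-1, (1 : Multiplicative (ZMod q))) ∈ B
      · refine ⟨3, 1, fun a e => ?_⟩
        rw [hB, and_iff_right (Or.inr hm), hχ1, AddChar.one_apply]
        change _ ↔ a ^ 2 = 1
        rw [← Units.val_pow_eq_pow_val, Units.val_eq_one]
        constructor
        · intro h
          have h1 := congrArg (· ^ 2) h
          simp only [one_pow] at h1
          rw [← pow_mul, show (q + 1) * 2 = 2 * q + 2 by ring, pow_add, units_pow_two_mul hpq,
            one_mul] at h1
          exact h1
        · intro h
          obtain ⟨k, hk⟩ := hodd.add_one
          rw [hk, ← two_mul, pow_mul, h, one_pow]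
      · refine ⟨5, 1, fun a e => ?_⟩
        rw [hB, or_iff_left hm, hχ1, AddChar.one_apply]
        change _ ↔ a ^ 1 = 1
        rw [← Units.val_pow_eq_pow_val, Units.val_eq_one, pow_one]
        constructor
        · rintro ⟨h1, h2⟩
          rwa [pow_succ, h1, one_mul] at h2
        · rintro rfl
          simp
    -- α takes every q-th root of unity as a value, so χ(1) = α(c) and χ(e) = α(ce).
    · obtain ⟨c, hc⟩ := exists_addChar_eq hα (addChar_pow_eq_one χ 1)
      have hc0 : c ≠ 0 := by
        rintro rfl
        rw [AddChar.map_zero_eq_one] at hc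
        exact addChar_one_ne_one hχ1 hc.symm
      have hχα : ∀ e, χ e = α (c * e) := by
        intro e
        obtain ⟨n, rfl⟩ := ZMod.natCast_zmod_surjective e
        rw [addChar_apply_eq_pow, ← hc, ← α.map_nsmul_eq_pow]
        congr 1
        rw [nsmul_eq_mul, mul_comm]
      by_cases hm : (-1, (1 : Multiplicative (ZMod q))) ∈ B
      · refine ⟨2, Units.mk0 c hc0, fun a e => ?_⟩
        rw [hB, and_iff_right (Or.inr hm), hχα]
        exact (and_iff_right (units_pow_two_mul hpq a)).symm
      · refine ⟨4, Units.mk0 c hc0, fun a e => ?_⟩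
        rw [hB, or_iff_left hm, hχα]
        exact Iff.rfl

end SixGroups

/-! ### Classification of the groups -/

section Classification

variable {p q : ℕ} [hp : Fact p.Prime] [hq : Fact q.Prime]

theorem affPerm_injective {a a' : (ZMod p)ˣ} {b b' : ZMod p} {d d' : (ZMod q)ˣ} {e e' : ZMod q}
    (h : affPerm a b d e = affPerm a' b' d' e') : a = a' ∧ b = b' ∧ d = d' ∧ e = e' := by
  have h0 := DFunLike.congr_fun h (0, 0)
  have h1 := DFunLike.congr_fun h (1, 1)
  simp only [affPerm_apply, mul_zero, zero_add, mul_one, Prod.mk.injEq] at h0 h1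
  obtain ⟨rfl, rfl⟩ := h0
  exact ⟨Units.ext (add_right_cancel h1.1), rfl, Units.ext (add_right_cancel h1.2), rfl⟩

theorem affPerm_pow (a : (ZMod p)ˣ) (b : ZMod p) (d : (ZMod q)ˣ) (e : ZMod q) (n : ℕ) :
    ∃ b' e', affPerm a b d e ^ n = affPerm (a ^ n) b' (d ^ n) e' ∧
      (d = 1 → e' = n * e) := by
  induction n with
  | zero => exact ⟨0, 0, by rw [pow_zero, pow_zero, pow_zero, affPerm_one], by simp⟩
  | succ n ih =>
    obtain ⟨b', e', h, he⟩ := ih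
    refine ⟨_, _, by rw [pow_succ', h, affPerm_mul, ← pow_succ', ← pow_succ'], ?_⟩
    rintro rfl
    rw [he rfl, Units.val_one, Nat.cast_succ]
    ring

/-- Conjugation by g is additive on translations. As p and q are distinct primes, it preserves the
translations of each coordinate, so g is affine in each coordinate separately. -/
theorem exists_affPerm_of_normalizes (hqp : q < p) {g : Equiv.Perm (ZMod p × ZMod q)}
    (hg : ∀ y ∈ shearGroup (1 : AddChar (ZMod q) (ZMod p)) 1,
      g * y * g⁻¹ ∈ shearGroup (1 : AddChar (ZMod q) (ZMod p)) 1) :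
    ∃ a b d e, g = affPerm a b d e := by
  have hadd : ∀ i t, ∃ i' t', ∀ x j, g (x + t, j + i) = ((g (x, j)).1 + t', (g (x, j)).2 + i') := by
    intro i t
    obtain ⟨i', t', h⟩ := hg _ (shear_mem i t)
    refine ⟨i', t', fun x j => ?_⟩
    have h1 := DFunLike.congr_fun (mul_inv_eq_iff_eq_mul.1 h) (x, j)
    rw [Equiv.Perm.mul_apply, Equiv.Perm.mul_apply, shear_apply, ← Prod.mk.eta (p := g (x, j)),
      shear_apply] at h1
    simpa using h1
  have hiter : ∀ i t i' t', (∀ x j, g (x + t, j + i) = ((g (x, j)).1 + t', (g (x, j)).2 + i')) →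
      ∀ n : ℕ, g (n * t, n * i) = ((g (0, 0)).1 + n * t', (g (0, 0)).2 + n * i') := by
    intro i t i' t' h n
    induction n with
    | zero => simp
    | succ n ih =>
      rw [Nat.cast_succ, Nat.cast_succ, add_mul, add_mul, one_mul, one_mul, h, ih]
      ext
      · simp only
        ring
      · simp only
        ring
  have hp0 : (p : ZMod q) ≠ 0 := by
    rw [Ne, ZMod.natCast_eq_zero_iff, Nat.prime_dvd_prime_iff_eq hq.out hp.out]
    exact hqp.ne
  have hq0 : (q : ZMod p) ≠ 0 := by
    rw [Ne, ZMod.natCast_eq_zero_iff, Nat.prime_dvd_prime_iff_eq hp.out hq.out]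
    exact hqp.ne'
  obtain ⟨i₁, a, h1⟩ := hadd 0 1
  obtain ⟨d, t₂, h2⟩ := hadd 1 0
  have h1' := hiter _ _ _ _ h1
  have h2' := hiter _ _ _ _ h2
  -- Applying the unit translation p times shows p · i₁ = 0 in Z/q, where p is invertible.
  have hi₁ : i₁ = 0 := by
    have h3 := h1' p
    simp only [ZMod.natCast_self, zero_mul, mul_zero] at h3
    have h4 := congrArg Prod.snd h3
    exact (mul_eq_zero.1 (left_eq_add.1 h4)).resolve_left hp0
  have ht₂ : t₂ = 0 := by
    have h3 := h2' q
    simp only [ZMod.natCast_self, zero_mul, mul_zero] at h3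
    have h4 := congrArg Prod.fst h3
    exact (mul_eq_zero.1 (left_eq_add.1 h4)).resolve_left hq0
  subst hi₁ ht₂
  have h3 : ∀ x j, g (x, j) = (a * x + (g (0, 0)).1, d * j + (g (0, 0)).2) := by
    intro x j
    obtain ⟨n, rfl⟩ := ZMod.natCast_zmod_surjective x
    obtain ⟨m, rfl⟩ := ZMod.natCast_zmod_surjective j
    have h4 : ∀ m : ℕ, g ((n : ZMod p), (m : ZMod q)) =
        ((g (0, 0)).1 + n * a, (g (0, 0)).2 + m * d) := by
      intro m
      induction m with
      | zero => simpa using h1' n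
      | succ m ih =>
        have h5 := h2 n m
        rw [add_zero, ih, add_zero] at h5
        rw [Nat.cast_succ, h5]
        ext
        · rfl
        · simp only
          ring
    rw [h4]
    ext
    · simp only
      ring
    · simp only
      ring
  have ha : a ≠ 0 := by
    rintro rfl
    have h4 : g (1, 0) = g (0, 0) := by rw [h3]; simp
    simpa using g.injective h4
  have hd : d ≠ 0 := by
    rintro rfl
    have h4 : g (0, 1) = g (0, 0) := by rw [h3]; simp
    simpa using g.injective h4
  refine ⟨Units.mk0 a ha, (g (0, 0)).1, Units.mk0 d hd, (g (0, 0)).2, ?_⟩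
  ext1 ⟨x, j⟩
  rw [h3, affPerm_apply]
  rfl

variable {G : Subgroup (Equiv.Perm (ZMod p × ZMod q))} [MulAction.IsPretransitive G (ZMod p × ZMod q)]

/-- p divides |G| by transitivity. An affine map of order p has a = a^p = 1, d = 1 because p is
prime to q - 1, and e = 0 because p is invertible mod q; so it is a translation of x. -/
theorem translation_mem (hqp : q < p) (hG : ∀ g ∈ G, ∃ a b d e, g = affPerm a b d e) (t : ZMod p) :
    affPerm 1 t 1 0 ∈ G := by
  have hdvd : p ∣ Nat.card G := by
    have h1 := MulAction.index_stabilizer_of_transitive G ((0, 0) : ZMod p × ZMod q)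
    have h2 := (MulAction.stabilizer G ((0, 0) : ZMod p × ZMod q)).index_dvd_card
    rw [h1, Nat.card_prod, Nat.card_zmod, Nat.card_zmod] at h2
    exact (dvd_mul_right p q).trans h2
  obtain ⟨⟨y, hy⟩, hord⟩ := exists_prime_orderOf_dvd_card' (G := G) p hdvd
  rw [Subgroup.orderOf_mk] at hord
  obtain ⟨a, b, d, e, rfl⟩ := hG y hy
  have hpow : affPerm a b d e ^ p = 1 := orderOf_dvd_iff_pow_eq_one.1 hord.dvd
  obtain ⟨b', e', h1, h2⟩ := affPerm_pow a b d e p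
  rw [hpow, ← affPerm_one] at h1
  obtain ⟨ha, -, hd, he⟩ := affPerm_injective h1
  have ha1 : a = 1 := by
    refine Units.ext ?_
    have h3 := congrArg Units.val ha
    rw [Units.val_pow_eq_pow_val, ZMod.pow_card] at h3
    exact h3.symm
  have hd1 : d = 1 := by
    have h3 : d ^ (q - 1) = 1 := ZMod.units_pow_card_sub_one_eq_one q d
    have h4 : p.Coprime (q - 1) := by
      refine (Nat.Prime.coprime_iff_not_dvd hp.out).2 fun h => ?_
      have h5 := Nat.le_of_dvd (Nat.sub_pos_of_lt hq.out.one_lt) h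
      omega
    have h5 := Nat.dvd_gcd (orderOf_dvd_of_pow_eq_one hd.symm) (orderOf_dvd_of_pow_eq_one h3)
    rw [h4] at h5
    exact orderOf_eq_one_iff.1 (Nat.dvd_one.1 h5)
  have he1 : e = 0 := by
    have h3 := (he.trans (h2 hd1)).symm
    refine (mul_eq_zero.1 h3).resolve_left ?_
    rw [ZMod.natCast_eq_zero_iff, Nat.prime_dvd_prime_iff_eq hq.out hp.out]
    exact hqp.ne
  subst ha1 hd1 he1
  have hb : b ≠ 0 := by
    rintro rfl
    rw [affPerm_one, orderOf_one] at hord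
    exact hp.out.one_lt.ne hord
  obtain ⟨n, hn⟩ := ZMod.natCast_zmod_surjective (t / b)
  have h3 := G.pow_mem hy n
  rwa [← shear_one_one_eq, shear_zero_pow, hn, div_mul_cancel₀ _ hb, shear_one_one_eq] at h3

theorem exists_affPerm_one_mem (hqp : q < p) (hG : ∀ g ∈ G, ∃ a b d e, g = affPerm a b d e) :
    ∃ a, affPerm a 0 1 1 ∈ G := by
  have h1 : ∀ e : ZMod q, ∃ a d, affPerm a 0 d e ∈ G := by
    intro e
    obtain ⟨⟨g, hg⟩, h⟩ := MulAction.exists_smul_eq G ((0, 0) : ZMod p × ZMod q) (0, e)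
    obtain ⟨a, b, d, e', rfl⟩ := hG g hg
    have h2 : affPerm a b d e' (0, 0) = (0, e) := h
    rw [affPerm_apply, mul_zero, zero_add, mul_zero, zero_add, Prod.mk.injEq] at h2
    obtain ⟨rfl, rfl⟩ := h2
    exact ⟨a, d, hg⟩
  choose a d h2 using h1
  -- There are q elements, sending (0, 0) to the various (0, e), but only q - 1 possible slopes d.
  -- Two with the same slope have a quotient with d = 1 and nonzero shift f.
  obtain ⟨e, e', hne, hd⟩ := Fintype.exists_ne_map_eq_of_card_lt d (by
    rw [ZMod.card_units, ZMod.card]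
    exact Nat.sub_lt hq.out.pos one_pos)
  have h3 := G.mul_mem (h2 e') (G.inv_mem (h2 e))
  obtain ⟨a', b, d', f, h4⟩ := hG _ h3
  rw [h4] at h3
  rw [mul_inv_eq_iff_eq_mul, affPerm_mul] at h4
  obtain ⟨-, -, h5, h6⟩ := affPerm_injective h4
  have hd' : d' = 1 := by
    rw [← hd] at h5
    exact left_eq_mul.1 (h5.trans (mul_comm _ _)) |>.trans rfl
  subst hd'
  have hf : f ≠ 0 := by
    rintro rfl
    rw [Units.val_one, one_mul, add_zero] at h6
    exact hne h6.symm
  -- A power of this quotient shifts j by 1; a translation of x then removes the constant term.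
  obtain ⟨n, hn⟩ := ZMod.natCast_zmod_surjective f⁻¹
  obtain ⟨b', e₁, h7, h8⟩ := affPerm_pow a' b 1 f n
  have h9 := G.pow_mem h3 n
  rw [h7, h8 rfl, hn, inv_mul_cancel₀ hf, one_pow] at h9
  have h10 := G.mul_mem (translation_mem hqp hG (-b')) h9
  rw [affPerm_mul] at h10
  refine ⟨a' ^ n, ?_⟩
  simpa using h10

/-- Conjugation by j ↦ dj + e relates the value at 1 of a nontrivial character of the group to its
value at d. Invariance makes these equal, and nontrivial characters are injective. -/
theorem eq_one_of_normalizes_skewGroup {β χ ω : AddChar (ZMod q) (ZMod p)} {l : ZMod p}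
    (hne : ¬(χ = 1 ∧ ω = 1)) {a : (ZMod p)ˣ} {b : ZMod p} {d : (ZMod q)ˣ} {e : ZMod q}
    (h : ∀ y ∈ skewGroup β l χ ω, affPerm a b d e * y * (affPerm a b d e)⁻¹ ∈ skewGroup β l χ ω) :
    d = 1 := by
  have hconj : ∀ i t, ∃ i' t', ∀ x j,
      (a * (ω i * x + t * χ j + l * (β i - ω i) * β j) + b = ω i' * (a * x + b) + t' * χ (d * j + e)
        + l * (β i' - ω i') * β (d * j + e)) ∧ d * i = i' := by
    intro i t
    obtain ⟨y, hy, hy'⟩ : ∃ y ∈ skewGroup β l χ ω, ∀ x j,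
        y (x, j) = (ω i * x + t * χ j + l * (β i - ω i) * β j, j + i) := by
      refine ⟨_, ⟨_, shear_mem i t, rfl⟩, fun x j => ?_⟩
      obtain ⟨i₁, t₁, h1⟩ := mem_skewGroup.1
        (show (MulAut.conj (shear β 1 0 l)).toMonoidHom (shear χ ω i t) ∈ skewGroup β l χ ω from
          ⟨_, shear_mem i t, rfl⟩)
      change (shear β 1 0 l * shear χ ω i t * (shear β 1 0 l)⁻¹) (x, j) = _
      rw [shear_zero_inv, Equiv.Perm.mul_apply, Equiv.Perm.mul_apply, shear_apply, shear_apply,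
        shear_apply]
      ext
      · simp only [AddChar.map_add_eq_mul, AddChar.map_zero_eq_one]
        ring
      · simp
    obtain ⟨i', t', h1⟩ := mem_skewGroup.1 (h y hy)
    refine ⟨i', t', fun x j => ?_⟩
    have h2 := h1 (a * x + b) (d * j + e)
    have h3 : (affPerm a b d e * y * (affPerm a b d e)⁻¹) (affPerm a b d e (x, j)) =
        affPerm a b d e (y (x, j)) :=
      congrArg (fun z => affPerm a b d e (y z)) ((affPerm a b d e).symm_apply_apply (x, j))
    rw [hy', affPerm_apply, affPerm_apply, h2, Prod.mk.injEq] at h3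
    refine ⟨h3.1.symm, ?_⟩
    linear_combination -h3.2
  by_cases hχ : χ = 1
  · have hω : ω ≠ 1 := fun h => hne ⟨hχ, h⟩
    obtain ⟨i', t', h1⟩ := hconj 1 0
    have h2 := (h1 0 0).2
    rw [mul_one] at h2
    have h3 : (a : ZMod p) * ω 1 = a * ω d := by
      rw [h2]
      linear_combination (h1 1 0).1 - (h1 0 0).1
    exact Units.ext (addChar_injective hω (mul_left_cancel₀ a.ne_zero h3)).symm
  · obtain ⟨i', t', h1⟩ := hconj 0 1
    have h2 := (h1 0 0).2
    rw [mul_zero] at h2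
    subst h2
    simp only [AddChar.map_zero_eq_one, sub_self, mul_zero, zero_mul, add_zero, one_mul] at h1
    have h3 : ∀ j, (a : ZMod p) * χ j = t' * χ (d * j + e) := fun j => by
      linear_combination (h1 0 j).1
    have h4 := h3 0
    rw [AddChar.map_zero_eq_one, mul_zero, zero_add, mul_one] at h4
    have h5 := h3 1
    rw [AddChar.map_add_eq_mul, mul_left_comm, ← h4, mul_comm, mul_one] at h5
    exact Units.ext (addChar_injective hχ (mul_right_cancel₀ a.ne_zero h5)).symm

/-- The translations make G affine, and the non-abelian N removes the slopes d, so G is `affGroup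
B`. The conjugating map rescales the second coordinate by the c of `exists_sixSub`. -/
theorem exists_conj_eq_affGroup (hpq : p = 2 * q + 1) (hq2 : q ≠ 2)
    {α : AddChar (ZMod q) (ZMod p)} (hα : α ≠ 1)
    (hT : shearGroup 1 1 ∈ regularNormalized G.subtype)
    {N : Subgroup (Equiv.Perm (ZMod p × ZMod q))} (hN : N ∈ regularNormalized G.subtype)
    (hne : ∃ a b : N, a * b ≠ b * a) :
    ∃ (i : Fin 6) (f : Equiv.Perm (ZMod p × ZMod q)), ∀ g,
      g ∈ G ↔ f * g * f⁻¹ ∈ affGroup (sixSub α i) := by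
  have hqp : q < p := by omega
  rw [mem_regularNormalized_subtype] at hT hN
  have hG : ∀ g ∈ G, ∃ a b d e, g = affPerm a b d e := fun g hg =>
    exists_affPerm_of_normalizes hqp (hT.2 g hg)
  have htr := translation_mem hqp hG
  obtain ⟨a₀, ha₀⟩ := exists_affPerm_one_mem hqp hG
  obtain ⟨β, l, χ, ω, hχω, rfl⟩ : ∃ (β : AddChar (ZMod q) (ZMod p)) (l : ZMod p)
      (χ ω : AddChar (ZMod q) (ZMod p)), (χ = 1 ∨ ω = 1) ∧ N = skewGroup β l χ ω := by
    obtain ⟨χ, ω, h, hN' | ⟨β, l, -, -, -, hN'⟩⟩ := exists_eq_shearGroup hqp hN.1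
      (hN.2 _ (shear_one_one_eq (p := p) (q := q) 0 1 ▸ htr 1)) (hN.2 _ ha₀)
    · exact ⟨1, 0, χ, ω, h, hN'.trans (skewGroup_zero _ _ _).symm⟩
    · exact ⟨β, l, χ, ω, h, hN'⟩
  rw [skewGroup_commute_iff hχω] at hne
  have hG' : ∀ g ∈ G, ∃ a b e, g = affPerm a b 1 e := by
    intro g hg
    obtain ⟨a, b, d, e, rfl⟩ := hG g hg
    obtain rfl := eq_one_of_normalizes_skewGroup hne (hN.2 _ hg)
    exact ⟨a, b, e, rfl⟩
  have hmem : ∀ a b b' e, affPerm a b 1 e ∈ G → affPerm a b' 1 e ∈ G := by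
    intro a b b' e h
    have h1 := G.mul_mem (htr (b' - b)) h
    rw [affPerm_mul] at h1
    simpa using h1
  let B : Subgroup ((ZMod p)ˣ × Multiplicative (ZMod q)) :=
    { carrier := {u | affPerm u.1 0 1 u.2.toAdd ∈ G}
      mul_mem' := fun {u v} hu hv => by
        have h1 := G.mul_mem hu hv
        rw [affPerm_mul] at h1
        simpa [add_comm] using h1
      one_mem' := by
        change affPerm 1 0 1 0 ∈ G
        rw [affPerm_one]
        exact G.one_mem
      inv_mem' := fun {u} hu => by
        have h1 := G.inv_mem hu
        have h2 : affPerm u.1 0 1 u.2.toAdd * affPerm u.1⁻¹ 0 1 (-u.2.toAdd) = 1 := by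
          rw [affPerm_mul, ← affPerm_one]
          congr 1
          · exact mul_inv_cancel _
          · simp
          · simp
          · simp
        rw [inv_eq_of_mul_eq_one_right h2] at h1
        exact h1 }
  have hB : ∀ a b e, affPerm a b 1 e ∈ G ↔ (a, Multiplicative.ofAdd e) ∈ B := fun a b e =>
    ⟨hmem _ _ _ _, hmem _ _ _ _⟩
  obtain ⟨i, c, hc⟩ := exists_sixSub (B := B) hpq hq2 hα ((hB _ _ _).1 ha₀)
  have hconj : ∀ (a : (ZMod p)ˣ) (b : ZMod p) (e : ZMod q), affPerm 1 0 c 0 * affPerm a b 1 e * (affPerm 1 0 c 0)⁻¹ =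
      affPerm a b 1 ((c : ZMod q) * e) := by
    intro a b e
    rw [mul_inv_eq_iff_eq_mul, affPerm_mul, affPerm_mul]
    congr 1
    · exact mul_comm _ _
    · simp
    · exact mul_comm _ _
    · simp
  refine ⟨i, affPerm 1 0 c 0, fun g => ⟨fun hg => ?_, fun hg => ?_⟩⟩
  · obtain ⟨a, b, e, rfl⟩ := hG' g hg
    rw [hconj]
    exact affPerm_mem (u := (a, Multiplicative.ofAdd ((c : ZMod q) * e))) ((hc _ _).1 ((hB _ _ _).1 hg)) b
  · obtain ⟨u, hu, b, h1⟩ := hg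
    have h2 : g = affPerm u.1 b 1 (((c⁻¹ : (ZMod q)ˣ) : ZMod q) * u.2.toAdd) := by
      have h3 := hconj u.1 b (((c⁻¹ : (ZMod q)ˣ) : ZMod q) * u.2.toAdd)
      rw [Units.mul_inv_cancel_left, ← h1] at h3
      exact (mul_left_cancel (mul_right_cancel h3)).symm
    rw [h2, hB, hc, Units.mul_inv_cancel_left]
    exact hu

end Classification

/-! ### The abstract structure of the six groups -/

theorem nonempty_mulEquiv_of_injective {M P : Type*} [Group M] [Group P] {H : Subgroup P}
    (f : M →* P) (hf : Function.Injective f) (h : ∀ g, g ∈ H ↔ ∃ m, f m = g) :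
    Nonempty (H ≃* M) := by
  have h1 : f.range = H := Subgroup.ext fun g => (h g).symm
  subst h1
  exact ⟨(MonoidHom.ofInjective hf).symm⟩

section Structure

variable {p q : ℕ} [hp : Fact p.Prime] [hq : Fact q.Prime]

theorem unitsToMulAut_apply (u : (ZMod p)ˣ) (x : Cyc p) :
    (unitsToMulAut p u x).toAdd = (u : ZMod p) * x.toAdd := rfl

theorem affPerm_mul_affPerm_one (a a' : (ZMod p)ˣ) (b b' : ZMod p) (e e' : ZMod q) :
    affPerm a b 1 e * affPerm a' b' 1 e' = affPerm (a * a') (a * b' + b) 1 (e + e') := by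
  rw [affPerm_mul, mul_one, Units.val_one, one_mul, add_comm e']

/-- The action of `C_q × (C_p ⋊ C_d)` on `ZMod p × ZMod q`. -/
def prodCycSemiHom (p q d : ℕ) [Fact p.Prime] [Fact q.Prime] :
    Cyc q × CycSemi p d →* Equiv.Perm (ZMod p × ZMod q) where
  toFun x := affPerm x.2.right x.2.left.toAdd 1 x.1.toAdd
  map_one' := affPerm_one
  map_mul' x y := by
    rw [affPerm_mul_affPerm_one]
    congr 1
    simp only [Prod.snd_mul, SemidirectProduct.mul_left, toAdd_mul, MonoidHom.comp_apply,
      unitsToMulAut_apply, Subgroup.subtype_apply]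
    exact add_comm _ _

theorem prodCycSemiHom_injective {d : ℕ} : Function.Injective (prodCycSemiHom p q d) := by
  intro x y h
  obtain ⟨h1, h2, -, h3⟩ := affPerm_injective h
  exact Prod.ext h3 (SemidirectProduct.ext h2 (Subtype.ext h1))

theorem nonempty_affGroup_rootSub_mulEquiv (d : ℕ) :
    Nonempty (affGroup (rootSub p q d) ≃* Cyc q × CycSemi p d) := by
  refine nonempty_mulEquiv_of_injective (prodCycSemiHom p q d) prodCycSemiHom_injective
    fun g => ⟨?_, ?_⟩
  · rintro ⟨u, hu, b, rfl⟩
    exact ⟨(u.2, ⟨Multiplicative.ofAdd b, ⟨u.1, (mem_rootsOfUnity _ _).2 hu⟩⟩), rfl⟩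
  · rintro ⟨x, rfl⟩
    exact ⟨(x.2.right, x.1), (mem_rootsOfUnity _ _).1 x.2.right.2, x.2.left.toAdd, rfl⟩

theorem units_pow_succ_pow (hpq : p = 2 * q + 1) (hq2 : q ≠ 2) (a : (ZMod p)ˣ) :
    (a ^ (q + 1)) ^ q = 1 := by
  obtain ⟨k, hk⟩ := (hq.out.odd_of_ne_two hq2).add_one
  rw [← pow_mul, show (q + 1) * q = 2 * q * k by rw [hk]; ring, pow_mul,
    units_pow_two_mul hpq, one_pow]

/-- α is a bijection onto the q-th roots of unity, so the shift e is determined by a through α(e) =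
a^(q+1) and adds nothing to the abstract group. -/
theorem nonempty_affGroup_graph_mulEquiv {α : AddChar (ZMod q) (ZMod p)} (hα : α ≠ 1) {d : ℕ}
    (hd : ∀ a : (ZMod p)ˣ, (a ^ (q + 1)) ^ q = 1) :
    Nonempty (affGroup (rootSub p q d ⊓ graphSub α) ≃* CycSemi p d) := by
  have h1 : ∀ a : (ZMod p)ˣ, ∃ e : ZMod q, α e = (a : ZMod p) ^ (q + 1) := fun a =>
    exists_addChar_eq hα (by
      rw [← Units.val_pow_eq_pow_val, ← Units.val_pow_eq_pow_val, hd, Units.val_one])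
  choose ε hε using h1
  have hε' : ∀ (a : (ZMod p)ˣ) (e : ZMod q), α e = (a : ZMod p) ^ (q + 1) → e = ε a := fun a e h =>
    addChar_injective hα (h.trans (hε a).symm)
  let f : CycSemi p d →* Equiv.Perm (ZMod p × ZMod q) :=
    { toFun := fun x => affPerm x.right x.left.toAdd 1 (ε x.right)
      map_one' := by
        rw [← affPerm_one]
        congr 1
        exact (hε' _ _ (by simp)).symm
      map_mul' := fun x y => by
        rw [affPerm_mul_affPerm_one]
        congr 1
        · simp only [SemidirectProduct.mul_left, toAdd_mul, MonoidHom.comp_apply,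
            unitsToMulAut_apply, Subgroup.subtype_apply]
          exact add_comm _ _
        · refine (hε' _ _ ?_).symm
          rw [AddChar.map_add_eq_mul, hε, hε, SemidirectProduct.mul_right, Subgroup.coe_mul,
            Units.val_mul, mul_pow, mul_comm] }
  refine nonempty_mulEquiv_of_injective f (fun x y h => ?_) fun g => ⟨?_, ?_⟩
  · obtain ⟨h1, h2, -, -⟩ := affPerm_injective h
    exact SemidirectProduct.ext h2 (Subtype.ext h1)
  · rintro ⟨u, ⟨hu, hu'⟩, b, rfl⟩
    refine ⟨⟨Multiplicative.ofAdd b, ⟨u.1, (mem_rootsOfUnity _ _).2 hu⟩⟩, ?_⟩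
    change affPerm u.1 b 1 (ε u.1) = _
    rw [← hε' u.1 _ (mem_graphSub.1 hu').symm]
  · rintro ⟨x, rfl⟩
    exact ⟨(x.right, Multiplicative.ofAdd (ε x.right)),
      ⟨(mem_rootsOfUnity _ _).1 x.right.2, (hε x.right).symm⟩, x.left.toAdd, rfl⟩

theorem nonempty_affGroup_rootSub_one_mulEquiv (hpq : p ≠ q) :
    Nonempty (affGroup (rootSub p q 1) ≃* Cyc (p * q)) := by
  let c := ZMod.chineseRemainder ((Nat.coprime_primes hp.out hq.out).2 hpq)
  let f : Cyc (p * q) →* Equiv.Perm (ZMod p × ZMod q) :=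
    { toFun := fun x => affPerm 1 (c x.toAdd).1 1 (c x.toAdd).2
      map_one' := by
        rw [toAdd_one, map_zero]
        exact affPerm_one
      map_mul' := fun x y => by
        rw [affPerm_mul_affPerm_one, toAdd_mul, map_add]
        congr 1
        · simp
        · simpa using add_comm _ _ }
  refine nonempty_mulEquiv_of_injective f (fun x y h => ?_) fun g => ⟨?_, ?_⟩
  · obtain ⟨-, h1, -, h2⟩ := affPerm_injective h
    exact Multiplicative.toAdd.injective (c.injective (Prod.ext h1 h2))
  · rintro ⟨u, hu, b, rfl⟩
    refine ⟨Multiplicative.ofAdd (c.symm (b, u.2.toAdd)), ?_⟩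
    have h1 : u.1 = 1 := by
      rw [← pow_one u.1]
      exact hu
    change affPerm 1 (c (c.symm (b, u.2.toAdd))).1 1 (c (c.symm (b, u.2.toAdd))).2 = _
    rw [RingEquiv.apply_symm_apply, h1]
  · rintro ⟨x, rfl⟩
    exact ⟨(1, Multiplicative.ofAdd (c x.toAdd).2), one_pow 1, (c x.toAdd).1, rfl⟩

/-- The permutation of `ZMod p` given by an element of the dihedral group. -/
def dihedralPerm (q : ℕ) [Fact q.Prime] (e : ZMod q) : DihedralGroup p → Equiv.Perm (ZMod p × ZMod q)
  | .r i => affPerm 1 i 1 e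
  | .sr i => affPerm (-1) (-i) 1 e

theorem dihedralPerm_mul (e e' : ZMod q) (x y : DihedralGroup p) :
    dihedralPerm q (e + e') (x * y) = dihedralPerm q e x * dihedralPerm q e' y := by
  rcases x with i | i <;> rcases y with j | j <;>
    simp only [DihedralGroup.r_mul_r, DihedralGroup.r_mul_sr, DihedralGroup.sr_mul_r,
      DihedralGroup.sr_mul_sr, dihedralPerm, affPerm_mul_affPerm_one] <;>
    congr 1 <;> simp <;> ring

theorem dihedralPerm_injective (hp2 : p ≠ 2) {e e' : ZMod q} {x y : DihedralGroup p}
    (h : dihedralPerm q e x = dihedralPerm q e' y) : e = e' ∧ x = y := by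
  have h1 : (-1 : (ZMod p)ˣ) ≠ 1 := fun h => by
    have : Fact (2 < p) := ⟨lt_of_le_of_ne hp.out.two_le hp2.symm⟩
    exact ZMod.neg_one_ne_one (congrArg Units.val h)
  rcases x with i | i <;> rcases y with j | j <;> obtain ⟨h2, h3, -, h4⟩ := affPerm_injective h
  · exact ⟨h4, congrArg _ h3⟩
  · exact absurd h2.symm h1
  · exact absurd h2 h1
  · exact ⟨h4, congrArg _ (neg_injective h3)⟩

theorem nonempty_affGroup_rootSub_two_mulEquiv (hp2 : p ≠ 2) :
    Nonempty (affGroup (rootSub p q 2) ≃* DihedralGroup p × Cyc q) := by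
  let f : DihedralGroup p × Cyc q →* Equiv.Perm (ZMod p × ZMod q) :=
    { toFun := fun x => dihedralPerm q x.2.toAdd x.1
      map_one' := affPerm_one
      map_mul' := fun x y => dihedralPerm_mul _ _ _ _ }
  refine nonempty_mulEquiv_of_injective f (fun x y h => ?_) fun g => ⟨?_, ?_⟩
  · obtain ⟨h1, h2⟩ := dihedralPerm_injective hp2 h
    exact Prod.ext h2 h1
  · rintro ⟨u, hu, b, rfl⟩
    have h1 : u.1 = 1 ∨ u.1 = -1 := by
      rcases sq_eq_sq_iff_eq_or_eq_neg.1
        ((congrArg Units.val (mem_rootSub.1 hu)).trans (one_pow 2).symm) with h | h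
      · exact Or.inl (Units.ext h)
      · exact Or.inr (Units.ext h)
    rcases h1 with h1 | h1
    · exact ⟨(.r b, u.2), by rw [h1]; rfl⟩
    · refine ⟨(.sr (-b), u.2), ?_⟩
      change affPerm (-1) (- -b) 1 _ = _
      rw [h1, neg_neg]
  · rintro ⟨⟨i | i, e⟩, rfl⟩
    · exact ⟨(1, e), one_pow 2, i, rfl⟩
    · exact ⟨(-1, e), by simp [mem_rootSub], -i, rfl⟩

end Structure

/-! ### Invariants of the six groups -/

section RegularNormal

variable {X : Type*} {G N : Subgroup (Equiv.Perm X)}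

theorem IsRegularPerm.isPretransitive_of_le (h : IsRegularPerm N) (hle : N ≤ G) :
    MulAction.IsPretransitive G X :=
  ⟨fun x y => by
    obtain ⟨a, ha, hxy⟩ := h.exists_apply_eq x y
    exact ⟨⟨a, hle ha⟩, hxy⟩⟩

theorem normal_subgroupOf_of_mem_regularNormalized (h : N ∈ regularNormalized G.subtype) :
    (N.subgroupOf G).Normal :=
  ⟨fun n hn g => (mem_regularNormalized_subtype.1 h).2 g g.2 n hn⟩

/-- Each g agrees at x with exactly one element a of N, and a⁻¹g then fixes x. -/
theorem IsRegularPerm.isComplement'_stabilizer (h : IsRegularPerm N) (hle : N ≤ G) (x : X) :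
    (N.subgroupOf G).IsComplement' (MulAction.stabilizer G x) := by
  rw [Subgroup.isComplement'_def, Subgroup.isComplement_iff_existsUnique]
  intro g
  obtain ⟨a, ha, hax⟩ := h.exists_apply_eq x (g.1 x)
  refine ⟨⟨⟨⟨a, hle ha⟩, ha⟩, ⟨⟨a, hle ha⟩⁻¹ * g, ?_⟩⟩, ?_, ?_⟩
  · change (⟨a, hle ha⟩⁻¹ * g : G) • x = x
    rw [mul_smul, inv_smul_eq_iff]
    exact hax.symm
  · exact mul_inv_cancel_left _ _
  · rintro ⟨⟨⟨b, hbG⟩, hb⟩, ⟨c, hc⟩⟩ hbc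
    have h1 : (⟨b, hbG⟩ * c : G) = g := hbc
    have h2 : c • x = x := hc
    have h3 : b = a := by
      refine h.eq_of_apply_eq hb ha (x := x) ?_
      rw [hax, ← h1]
      exact congrArg b h2.symm
    subst h3
    subst h1
    refine Prod.ext rfl (Subtype.ext ?_)
    exact (inv_mul_cancel_left _ _).symm

end RegularNormal

section Invariants

variable {p q : ℕ} [hp : Fact p.Prime] [hq : Fact q.Prime] {α : AddChar (ZMod q) (ZMod p)}

theorem exists_addChar_ne_one (hpq : p = 2 * q + 1) : ∃ α : AddChar (ZMod q) (ZMod p), α ≠ 1 := by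
  have h1 : Nat.card (AddChar (ZMod q) (ZMod p)) = q :=
    card_addChar ⟨2, by rw [hpq, Nat.add_sub_cancel, mul_comm]⟩
  by_contra! h
  have : Subsingleton (AddChar (ZMod q) (ZMod p)) := ⟨fun a b => (h a).trans (h b).symm⟩
  rw [Nat.card_of_subsingleton (1 : AddChar (ZMod q) (ZMod p))] at h1
  exact hq.out.one_lt.ne h1

/-- The value at `e` of a character, as a unit. -/
noncomputable def charUnit (α : AddChar (ZMod q) (ZMod p)) (e : ZMod q) : (ZMod p)ˣ :=
  (α.val_isUnit e).unit

theorem charUnit_val (α : AddChar (ZMod q) (ZMod p)) (e : ZMod q) :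
    (charUnit α e : ZMod p) = α e := (α.val_isUnit e).unit_spec

theorem charUnit_pow (α : AddChar (ZMod q) (ZMod p)) (e : ZMod q) : charUnit α e ^ q = 1 :=
  Units.ext (by rw [Units.val_pow_eq_pow_val, charUnit_val, addChar_pow_eq_one, Units.val_one])

theorem charUnit_mem_rootSub_inf_graphSub {d : ℕ} (hd : q ∣ d) (e : ZMod q) :
    (charUnit α e, Multiplicative.ofAdd e) ∈ rootSub p q d ⊓ graphSub α := by
  obtain ⟨k, rfl⟩ := hd
  refine Subgroup.mem_inf.2 ⟨?_, ?_⟩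
  · rw [mem_rootSub, pow_mul, charUnit_pow, one_pow]
  · rw [mem_graphSub, pow_succ, ← Units.val_pow_eq_pow_val, charUnit_pow, Units.val_one, one_mul,
      charUnit_val]
    rfl

theorem one_ofAdd_mem_rootSub (d : ℕ) (e : ZMod q) :
    ((1 : (ZMod p)ˣ), Multiplicative.ofAdd e) ∈ rootSub p q d := one_pow d

theorem shearGroup_one_one_le {d : ℕ} : shearGroup 1 1 ≤ affGroup (rootSub p q d) := by
  rintro _ ⟨i, t, rfl⟩
  rw [shear_one_one_eq]
  exact affPerm_mem (one_ofAdd_mem_rootSub d i) t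

theorem shearGroup_one_le {d : ℕ} (hd : q ∣ d) :
    shearGroup 1 α ≤ affGroup (rootSub p q d ⊓ graphSub α) := by
  rintro _ ⟨i, t, rfl⟩
  have h1 : shear 1 α i t = affPerm (charUnit α i) t 1 i := by
    ext1 ⟨x, j⟩
    simp [affPerm_apply, shear_apply, charUnit_val]
  rw [h1]
  exact affPerm_mem (charUnit_mem_rootSub_inf_graphSub hd i) t

/-- Such a subgroup is regular and normal: it gives transitivity and the normal complement of the
point stabiliser. -/
theorem exists_shearGroup_le_sixSub (α : AddChar (ZMod q) (ZMod p)) (i : Fin 6) :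
    ∃ ω : AddChar (ZMod q) (ZMod p), shearGroup 1 ω ≤ affGroup (sixSub α i) := by
  fin_cases i
  · exact ⟨1, shearGroup_one_one_le⟩
  · exact ⟨1, shearGroup_one_one_le⟩
  · exact ⟨α, shearGroup_one_le (dvd_mul_left q 2)⟩
  · exact ⟨1, shearGroup_one_one_le⟩
  · exact ⟨α, shearGroup_one_le dvd_rfl⟩
  · exact ⟨1, shearGroup_one_one_le⟩

instance isPretransitive_sixSub (i : Fin 6) :
    MulAction.IsPretransitive (affGroup (sixSub α i)) (ZMod p × ZMod q) := by
  obtain ⟨ω, h⟩ := exists_shearGroup_le_sixSub α i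
  exact isRegularPerm_shearGroup.isPretransitive_of_le h

theorem Realises.isAlmostClassicallyGalois_sixSub {K : Type u} {L : Type v} [Field K] [Field L]
    [Algebra K L] [FiniteDimensional K L] [Algebra.IsSeparable K L] {i : Fin 6}
    (h : Realises K L (affGroup (sixSub α i)) (ZMod p × ZMod q)) :
    IsAlmostClassicallyGalois K L := by
  obtain ⟨ω, hω⟩ := exists_shearGroup_le_sixSub α i
  have := normal_subgroupOf_of_mem_regularNormalized
    (shearGroup_mem_regularNormalized (B := sixSub α i) (χ := 1) (ω := ω) (Or.inl rfl))
  exact h.isAlmostClassicallyGalois ((shearGroup 1 ω).subgroupOf (affGroup (sixSub α i)))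
    (isRegularPerm_shearGroup.isComplement'_stabilizer hω)

/-- The group with index `4` lies in the graph of `α`; each of the others contains a pair `(a, 1)` in
which `a` is not a non-trivial `q`-th root of unity. -/
theorem sixSub_cases (hq2 : q ≠ 2) (hp2 : p ≠ 2) (i : Fin 6) :
    (i ≠ 4 ∧ ∃ a : (ZMod p)ˣ, (a, Multiplicative.ofAdd 1) ∈ sixSub α i ∧
      ∀ β : AddChar (ZMod q) (ZMod p), β 1 = a → β = 1) ∨
    (i = 4 ∧ ∃ a : (ZMod p)ˣ, (a, Multiplicative.ofAdd 1) ∈ sixSub α i ∧ α 1 = a ∧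
      ∀ u ∈ sixSub α i, (u.1 : ZMod p) = α u.2.toAdd) := by
  have h1 : ∀ β : AddChar (ZMod q) (ZMod p), β 1 = ((1 : (ZMod p)ˣ) : ZMod p) → β = 1 :=
    fun β hβ => addChar_ext_one hβ
  have hodd : Odd q := hq.out.odd_of_ne_two hq2
  have hm : (-1 : ZMod p) ≠ 1 := by
    have : Fact (2 < p) := ⟨lt_of_le_of_ne hp.out.two_le hp2.symm⟩
    exact ZMod.neg_one_ne_one
  fin_cases i
  · exact Or.inl ⟨by decide, 1, one_ofAdd_mem_rootSub _ _, h1⟩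
  · exact Or.inl ⟨by decide, 1, one_ofAdd_mem_rootSub _ _, h1⟩
  -- The pair (-α(1), 1) still satisfies the graph condition because q + 1 is even, but (-α(1))^q =
  -- -1 as q is odd, so no character takes this value at 1.
  · refine Or.inl ⟨by decide, -charUnit α 1, Subgroup.mem_inf.2 ⟨?_, ?_⟩, fun β hβ => ?_⟩
    · rw [mem_rootSub, (even_two_mul q).neg_pow, mul_comm, pow_mul, charUnit_pow, one_pow]
    · rw [mem_graphSub, Units.val_neg, hodd.add_one.neg_pow]
      exact (mem_graphSub.1 (charUnit_mem_rootSub_inf_graphSub (α := α) dvd_rfl 1).2)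
    · have h2 := addChar_pow_eq_one β 1
      rw [hβ, Units.val_neg, hodd.neg_pow, charUnit_val, addChar_pow_eq_one] at h2
      exact absurd h2 hm
  · exact Or.inl ⟨by decide, 1, one_ofAdd_mem_rootSub _ _, h1⟩
  · refine Or.inr ⟨rfl, charUnit α 1, charUnit_mem_rootSub_inf_graphSub dvd_rfl 1,
      (charUnit_val _ _).symm, ?_⟩
    rintro u ⟨hu, hu'⟩
    rw [← mem_graphSub.1 hu', pow_succ, ← Units.val_pow_eq_pow_val, mem_rootSub.1 hu,
      Units.val_one, one_mul]
  · exact Or.inl ⟨by decide, 1, one_ofAdd_mem_rootSub _ _, h1⟩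

theorem ncard_cyclic_sixSub (hpq : p = 2 * q + 1) (hq2 : q ≠ 2) (hα : α ≠ 1) (i : Fin 6) :
    Set.ncard {N | N ∈ regularNormalized (affGroup (sixSub α i)).subtype ∧ IsCyclic N} =
      ![1, 1, 1, 1, p, 1] i := by
  have hqp : q < p := by omega
  have hp2 : p ≠ 2 := by omega
  rcases sixSub_cases (α := α) hq2 hp2 i with ⟨hi, a, ha, hβ⟩ | ⟨rfl, a, ha, ha', hB⟩
  · rw [ncard_cyclic_affGroup hqp ha hβ]
    fin_cases i <;> first | rfl | exact absurd rfl hi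
  · exact ncard_cyclic_affGroup_graph hqp hα ha ha' hB

theorem ncard_nonabelian_sixSub (hpq : p = 2 * q + 1) (hq2 : q ≠ 2) (hα : α ≠ 1) (i : Fin 6) :
    Set.ncard {N | N ∈ regularNormalized (affGroup (sixSub α i)).subtype ∧
      ∃ a b : N, a * b ≠ b * a} = ![2 * (q - 1), 2 * (q - 1), 2 * (q - 1), 2 * (q - 1),
        2 * p * (q - 2) + 2, 2 * (q - 1)] i := by
  have hqp : q < p := by omega
  have hp2 : p ≠ 2 := by omega
  have hd : q ∣ p - 1 := ⟨2, by rw [hpq, Nat.add_sub_cancel, mul_comm]⟩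
  rcases sixSub_cases (α := α) hq2 hp2 i with ⟨hi, a, ha, hβ⟩ | ⟨rfl, a, ha, ha', hB⟩
  · rw [ncard_nonabelian_affGroup hqp hd ha hβ]
    fin_cases i <;> first | rfl | exact absurd rfl hi
  · exact ncard_nonabelian_affGroup_graph hqp hd hα ha ha' hB

theorem card_affGroup_sixSub (hpq : p = 2 * q + 1) (hq2 : q ≠ 2) (hα : α ≠ 1) (i : Fin 6) :
    Nat.card (affGroup (sixSub α i)) = p * q * ![2 * q, q, 2, 2, 1, 1] i := by
  have hp1 : p - 1 = 2 * q := by omega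
  have hcard : ∀ d, d ∣ 2 * q → Nat.card (CycSemi p d) = p * d := by
    intro d hd
    rw [SemidirectProduct.card, card_rootsOfUnity_zmod (hp1 ▸ hd)]
    exact congrArg (· * d) (Nat.card_zmod p)
  have hcyc : ∀ m, Nat.card (Cyc m) = m := Nat.card_zmod
  have hroot : ∀ d, d ∣ 2 * q → Nat.card (affGroup (rootSub p q d)) = q * (p * d) := by
    intro d hd
    obtain ⟨f⟩ := nonempty_affGroup_rootSub_mulEquiv (p := p) (q := q) d
    rw [Nat.card_congr f.toEquiv, Nat.card_prod, hcard d hd, hcyc]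
  have hgraph : ∀ d, d ∣ 2 * q → Nat.card (affGroup (rootSub p q d ⊓ graphSub α)) = p * d := by
    intro d hd
    obtain ⟨f⟩ := nonempty_affGroup_graph_mulEquiv hα (d := d) (units_pow_succ_pow hpq hq2)
    rw [Nat.card_congr f.toEquiv, hcard d hd]
  fin_cases i
  · exact (hroot _ dvd_rfl).trans (by simp; ring)
  · exact (hroot _ (dvd_mul_left q 2)).trans (by simp; ring)
  · exact (hgraph _ dvd_rfl).trans (by simp; ring)
  · exact (hroot _ (dvd_mul_right 2 q)).trans (by simp; ring)
  · exact (hgraph _ (dvd_mul_left q 2)).trans (by simp)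
  · exact (hroot _ (one_dvd _)).trans (by simp; ring)

/-- The shift (x, j) ↦ (x, j + 1) is central because the linear coefficient a is independent of the
shift. -/
theorem exists_central_affGroup_rootSub (d : ℕ) :
    ∃ g : affGroup (rootSub p q d), g ≠ 1 ∧ ∀ h, g * h = h * g := by
  refine ⟨⟨_, affPerm_mem (one_ofAdd_mem_rootSub d 1) 0⟩, fun h => ?_, ?_⟩
  · have h1 := congrArg Subtype.val h
    rw [Subgroup.coe_one, ← affPerm_one] at h1
    exact one_ne_zero (affPerm_injective h1).2.2.2
  · rintro ⟨_, u, hu, b, rfl⟩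
    refine Subtype.ext ((affPerm_mul_affPerm_one _ _ _ _ _ _).trans
      (Eq.trans ?_ (affPerm_mul_affPerm_one _ _ _ _ _ _).symm))
    congr 1
    · simp
    · simp
    · exact add_comm _ _

/-- Commuting with x ↦ x + 1 forces a = 1, commuting with an element of linear part α(1) ≠ 1 forces
b = 0, and the graph condition then gives α(e) = 1, so e = 0. -/
theorem eq_one_of_central_affGroup_graph (hα : α ≠ 1) {d : ℕ} (hd : q ∣ d)
    (g : affGroup (rootSub p q d ⊓ graphSub α)) (hg : ∀ h, g * h = h * g) : g = 1 := by
  obtain ⟨_, ⟨a, e⟩, hu, b, rfl⟩ := g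
  have hcomm : ∀ h ∈ affGroup (rootSub p q d ⊓ graphSub α),
      affPerm a b 1 e.toAdd * h = h * affPerm a b 1 e.toAdd := fun h hh =>
    congrArg Subtype.val (hg ⟨h, hh⟩)
  have h1 := hcomm _ (affPerm_mem (Subgroup.one_mem _) 1)
  rw [affPerm_mul_affPerm_one, affPerm_mul_affPerm_one] at h1
  have h2 := (affPerm_injective h1).2.1
  have ha : a = 1 := Units.ext (by
    simp only [Prod.fst_one, Units.val_one, mul_one, one_mul] at h2
    rw [Units.val_one]
    linear_combination h2)
  have h3 := hcomm _ (affPerm_mem (charUnit_mem_rootSub_inf_graphSub hd 1) 0)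
  rw [affPerm_mul_affPerm_one, affPerm_mul_affPerm_one] at h3
  have h4 := (affPerm_injective h3).2.1
  rw [mul_zero, zero_add, add_zero, charUnit_val] at h4
  have hb : b = 0 := by
    by_contra hb
    exact addChar_one_ne_one hα (mul_right_cancel₀ hb (h4.symm.trans (one_mul b).symm))
  have he : e.toAdd = 0 := by
    have h5 := mem_graphSub.1 hu.2
    rw [ha, Units.val_one, one_pow] at h5
    exact addChar_injective hα (h5.symm.trans α.map_zero_eq_one.symm)
  refine Subtype.ext ?_
  change affPerm a b 1 e.toAdd = 1
  rw [ha, hb, he, affPerm_one]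

theorem exists_central_sixSub_iff (hα : α ≠ 1) (i : Fin 6) :
    (∃ g : affGroup (sixSub α i), g ≠ 1 ∧ ∀ h, g * h = h * g) ↔ i ≠ 2 ∧ i ≠ 4 := by
  fin_cases i
  · exact iff_of_true (exists_central_affGroup_rootSub _) (by decide)
  · exact iff_of_true (exists_central_affGroup_rootSub _) (by decide)
  · refine iff_of_false ?_ (by decide)
    rintro ⟨g, hg, h⟩
    exact hg (eq_one_of_central_affGroup_graph hα (dvd_mul_left q 2) g h)
  · exact iff_of_true (exists_central_affGroup_rootSub _) (by decide)
  · refine iff_of_false ?_ (by decide)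
    rintro ⟨g, hg, h⟩
    exact hg (eq_one_of_central_affGroup_graph hα dvd_rfl g h)
  · exact iff_of_true (exists_central_affGroup_rootSub _) (by decide)

theorem exists_central_congr {M N : Type*} [Group M] [Group N] (f : M ≃* N) :
    (∃ g : M, g ≠ 1 ∧ ∀ h, g * h = h * g) ↔ ∃ g : N, g ≠ 1 ∧ ∀ h, g * h = h * g := by
  rw [f.surjective.exists]
  refine exists_congr fun a => and_congr (map_ne_one_iff f f.injective).symm ?_
  rw [f.surjective.forall]
  refine forall_congr' fun b => ?_
  rw [← map_mul, ← map_mul, f.injective.eq_iff]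

/-- The orders separate all pairs except 2, 3 and 4, 5, in which exactly one group has a trivial
centre. -/
theorem eq_of_affGroup_sixSub_mulEquiv (hpq : p = 2 * q + 1) (hq2 : q ≠ 2) (hα : α ≠ 1)
    {i j : Fin 6} (f : affGroup (sixSub α i) ≃* affGroup (sixSub α j)) : i = j := by
  have h1 := Nat.card_congr f.toEquiv
  rw [card_affGroup_sixSub hpq hq2 hα, card_affGroup_sixSub hpq hq2 hα] at h1
  have h2 := Nat.eq_of_mul_eq_mul_left (Nat.mul_pos hp.out.pos hq.out.pos) h1
  have h3 := exists_central_congr f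
  rw [exists_central_sixSub_iff hα, exists_central_sixSub_iff hα] at h3
  have h4 : 2 < q := lt_of_le_of_ne hq.out.two_le hq2.symm
  clear h1 f
  revert h2 h3
  fin_cases i <;> fin_cases j <;> intro h2 h3 <;> first
    | rfl
    | (exfalso; revert h3; decide)
    | (exfalso; simp at h2 <;> omega)

end Invariants

/-! ### Isomorphisms of permutation groups -/

section PermGroupIso

theorem PermGroupIso.trans {G X G' X' G'' X'' : Type*} [Group G] [MulAction G X] [Group G']
    [MulAction G' X'] [Group G''] [MulAction G'' X''] (h : PermGroupIso G X G' X')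
    (h' : PermGroupIso G' X' G'' X'') : PermGroupIso G X G'' X'' := by
  obtain ⟨θ, e, he⟩ := h
  obtain ⟨θ', e', he'⟩ := h'
  exact ⟨θ.trans θ', e.trans e', fun g x => (congrArg e' (he g x)).trans (he' _ _)⟩

theorem PermGroupIso.isPretransitive {G X G' X' : Type*} [Group G] [MulAction G X] [Group G']
    [MulAction G' X'] [MulAction.IsPretransitive G X] (h : PermGroupIso G X G' X') :
    MulAction.IsPretransitive G' X' := by
  obtain ⟨θ, e, he⟩ := h
  refine ⟨fun x y => ?_⟩
  obtain ⟨g, hg⟩ := MulAction.exists_smul_eq G (e.symm x) (e.symm y)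
  refine ⟨θ g, ?_⟩
  have h1 := he g (e.symm x)
  rwa [hg, e.apply_symm_apply, e.apply_symm_apply, eq_comm] at h1

theorem permGroupIso_of_forall_mem {G X Y : Type*} [Group G] [MulAction G X] [FaithfulSMul G X]
    {H : Subgroup (Equiv.Perm Y)} (e : X ≃ Y)
    (h : ∀ π, π ∈ H ↔ ∃ g, e.permCongrHom (MulAction.toPermHom G X g) = π) :
    PermGroupIso G X H Y := by
  have h1 : (e.permCongrHom.toMonoidHom.comp (MulAction.toPermHom G X)).range = H :=
    Subgroup.ext fun g => (h g).symm
  subst h1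
  refine ⟨MonoidHom.ofInjective
    (e.permCongrHom.injective.comp MulAction.toPerm_injective), e, fun g x => ?_⟩
  change e (g • x) = e (g • e.symm (e x))
  rw [e.symm_apply_apply]

theorem toPermHom_subgroup {X : Type*} (H : Subgroup (Equiv.Perm X)) :
    MulAction.toPermHom H X = H.subtype := rfl

end PermGroupIso

section Degree

variable {p q : ℕ} [hp : Fact p.Prime] [hq : Fact q.Prime] {α : AddChar (ZMod q) (ZMod p)}

theorem exists_permGroupIso_affGroup (hpq : p = 2 * q + 1) (hq2 : q ≠ 2) (hα : α ≠ 1)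
    {G : Type w} {X : Type z} [Group G] [MulAction G X] [FaithfulSMul G X]
    [MulAction.IsPretransitive G X] (hX : Nat.card X = p * q) {N N' : Subgroup (Equiv.Perm X)}
    (hN : N ∈ regularNormalized (MulAction.toPermHom G X)) (hc : IsCyclic N)
    (hN' : N' ∈ regularNormalized (MulAction.toPermHom G X)) (hne : ∃ a b : N', a * b ≠ b * a) :
    ∃ i, PermGroupIso G X (affGroup (sixSub α i)) (ZMod p × ZMod q) := by
  have hpq' : p ≠ q := by omega
  have hX0 : 0 < Nat.card X := by
    rw [hX]
    exact Nat.mul_pos hp.out.pos hq.out.pos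
  obtain ⟨⟨x⟩, -⟩ := Nat.card_pos_iff.1 hX0
  have hc' : IsCyclic (shearGroup (1 : AddChar (ZMod q) (ZMod p)) 1) :=
    (isCyclic_shearGroup_iff (Or.inl rfl) hpq').2 ⟨rfl, rfl⟩
  have hreg : IsRegularPerm (shearGroup (1 : AddChar (ZMod q) (ZMod p)) 1) := isRegularPerm_shearGroup
  have hcard : Nat.card N = Nat.card (shearGroup (1 : AddChar (ZMod q) (ZMod p)) 1) := by
    have : Nonempty X := ⟨x⟩
    rw [hN.1.card_eq, hreg.card_eq, hX, Nat.card_prod, Nat.card_zmod, Nat.card_zmod]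
  -- N and the translation group are cyclic of the same order. Both act regularly, so an isomorphism
  -- between them is induced by a bijection of the sets.
  let f := mulEquivOfCyclicCardEq hcard
  have := hN.1.isPretransitive_of_le le_rfl
  obtain ⟨e, he⟩ := exists_equivariant_equiv (G := N) ((Subgroup.subtype _).comp f.toMonoidHom)
    (fun a b => by
      obtain ⟨c, hc, hab⟩ := hreg.exists_apply_eq a b
      obtain ⟨n, hn⟩ := f.surjective ⟨c, hc⟩
      refine ⟨n, ?_⟩
      change (f n).1 a = b
      rw [hn, hab]) x (0, 0) (fun n => by
      have h1 : n • x = x ↔ n = 1 := (hN.1 x).1.eq_iff (a := n) (b := 1)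
      have h2 : (f n).1 (0, 0) = (0, 0) ↔ f n = 1 := (hreg (0, 0)).1.eq_iff (a := f n) (b := 1)
      rw [h1]
      exact (h2.trans (map_eq_one_iff f f.injective)).symm)
  have hNmap : N.map e.permCongrHom.toMonoidHom = shearGroup 1 1 := by
    have h1 : ∀ n : N, e.permCongrHom n.1 = (f n).1 := fun n => by
      ext1 y
      change e (n.1 (e.symm y)) = (f n).1 y
      have h2 := he n (e.symm y)
      rw [e.apply_symm_apply] at h2
      exact h2
    ext π
    constructor
    · rintro ⟨n, hn, rfl⟩
      exact (h1 ⟨n, hn⟩).symm ▸ (f ⟨n, hn⟩).2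
    · intro hπ
      obtain ⟨n, hn⟩ := f.surjective ⟨π, hπ⟩
      exact ⟨n.1, n.2, (h1 n).trans (congrArg Subtype.val hn)⟩
  let H := (e.permCongrHom.toMonoidHom.comp (MulAction.toPermHom G X)).range
  have hθ : Function.Surjective (e.permCongrHom.toMonoidHom.comp
    (MulAction.toPermHom G X)).rangeRestrict := MonoidHom.rangeRestrict_surjective _
  have hequiv : ∀ g x, e (MulAction.toPermHom G X g x) = H.subtype
      ((e.permCongrHom.toMonoidHom.comp (MulAction.toPermHom G X)).rangeRestrict g) (e x) := by
    intro g x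
    change _ = e (MulAction.toPermHom G X g (e.symm (e x)))
    rw [e.symm_apply_apply]
  have hT := (map_mem_regularNormalized e hθ hequiv).2 hN
  rw [hNmap] at hT
  have hM := (map_mem_regularNormalized e hθ hequiv).2 hN'
  have hH : MulAction.IsPretransitive H (ZMod p × ZMod q) := by
    refine ⟨fun a b => ?_⟩
    obtain ⟨g, hg⟩ := MulAction.exists_smul_eq G (e.symm a) (e.symm b)
    refine ⟨⟨_, g, rfl⟩, ?_⟩
    change e (g • e.symm a) = b
    rw [hg, e.apply_symm_apply]
  obtain ⟨i, k, hk⟩ := exists_conj_eq_affGroup hpq hq2 hα hT hM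
    ((exists_mul_ne_congr (N'.equivMapOfInjective _ e.permCongrHom.injective)).1 hne)
  refine ⟨i, permGroupIso_of_forall_mem (e.trans k) fun π => ?_⟩
  have h1 : k * (k⁻¹ * π * k) * k⁻¹ = π := by group
  rw [← h1, ← hk, h1]
  refine exists_congr fun g => ?_
  have h2 : (e.trans k).permCongrHom (MulAction.toPermHom G X g) =
    k * e.permCongrHom (MulAction.toPermHom G X g) * k⁻¹ := rfl
  rw [h2, mul_inv_eq_iff_eq_mul, ← eq_inv_mul_iff_mul_eq, mul_assoc]
  rfl

/-- Each of the six groups normalises `shearGroup 1 1`, which is cyclic, and `shearGroup 1 α`, which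
is not abelian; one extension realising the group therefore carries structures of both types. -/
theorem isRealised_of_permGroupIso (hpq : p ≠ q) (hα : α ≠ 1) {i : Fin 6}
    {H : Subgroup (Equiv.Perm (Fin (p * q)))}
    (hH : PermGroupIso (affGroup (sixSub α i)) (ZMod p × ZMod q) H (Fin (p * q)))
    {G : Type w} {X : Type z} [Group G] [MulAction G X]
    (h : PermGroupIso G X H (Fin (p * q))) :
    IsRealisedByCyclicType.{u, v, w, z} G X ∧ IsRealisedByNonabelianType.{u, v, w, z} G X := by
  have := hH.isPretransitive
  obtain ⟨K, L, _, _, _, hf, hs, hr⟩ := exists_realises.{u, v} H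
    ⟨0, Nat.mul_pos hp.out.pos hq.out.pos⟩
  have hr' := Realises.of_permGroupIso hH hr
  refine ⟨⟨K, L, _, _, _, hf, hs, hr.of_permGroupIso h, ?_⟩,
    ⟨K, L, _, _, _, hf, hs, hr.of_permGroupIso h, ?_⟩⟩
  · exact hr'.exists_isOfCyclicType_iff.2 ⟨shearGroup 1 1,
      shearGroup_mem_regularNormalized (Or.inl rfl),
      (isCyclic_shearGroup_iff (Or.inl rfl) hpq).2 ⟨rfl, rfl⟩⟩
  · exact hr'.exists_isOfNonabelianType_iff.2 ⟨shearGroup 1 α,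
      shearGroup_mem_regularNormalized (Or.inl rfl),
      (shearGroup_commute_iff (Or.inl rfl)).2 fun h => hα h.2⟩

end Degree

theorem mainTheorem5 (p q : ℕ) (hp : p.Prime) (hq : q.Prime) (hq2 : q ≠ 2)
    (hpq : p = 2 * q + 1) :
    ∃ P : Fin 6 → Subgroup (Equiv.Perm (Fin (p * q))),
      -- six transitive permutation groups of degree `p * q`, pairwise non-isomorphic
      (∀ i, MulAction.IsPretransitive (P i) (Fin (p * q))) ∧
      (∀ i j, PermGroupIso (P i) (Fin (p * q)) (P j) (Fin (p * q)) → i = j) ∧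
      -- with the stated abstract structures
      Nonempty (P 0 ≃* Cyc q × CycSemi p (2 * q)) ∧
      Nonempty (P 1 ≃* Cyc q × CycSemi p q) ∧
      Nonempty (P 2 ≃* CycSemi p (2 * q)) ∧
      Nonempty (P 3 ≃* DihedralGroup p × Cyc q) ∧
      Nonempty (P 4 ≃* CycSemi p q) ∧
      Nonempty (P 5 ≃* Cyc (p * q)) ∧
      -- they are exactly the permutation groups realised by structures of both types
      (∀ (G : Type w) (X : Type z) [Group G] [MulAction G X] [FaithfulSMul G X]
          [MulAction.IsPretransitive G X], Nat.card X = p * q →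
        ((IsRealisedByCyclicType.{u, v, w, z} G X ∧ IsRealisedByNonabelianType.{u, v, w, z} G X) ↔
          ∃ i, PermGroupIso G X (P i) (Fin (p * q)))) ∧
      -- numbers of structures, and almost classical Galois property, for all extensions
      (∀ (i : Fin 6) (K : Type u) (L : Type v) [Field K] [Field L] [Algebra K L]
          [FiniteDimensional K L] [Algebra.IsSeparable K L],
        Realises K L (P i) (Fin (p * q)) →
          numCyclicType K L = ![1, 1, 1, 1, p, 1] i ∧
          numNonabelianType K L =
            ![2 * (q - 1), 2 * (q - 1), 2 * (q - 1), 2 * (q - 1),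
              2 * p * (q - 2) + 2, 2 * (q - 1)] i ∧
          IsAlmostClassicallyGalois K L) := by
  have : Fact p.Prime := ⟨hp⟩
  have : Fact q.Prime := ⟨hq⟩
  have hpq' : p ≠ q := by omega
  have hp2 : p ≠ 2 := by omega
  obtain ⟨α, hα⟩ := exists_addChar_ne_one hpq
  obtain ⟨e⟩ : Nonempty (ZMod p × ZMod q ≃ Fin (p * q)) := by
    refine ⟨Finite.equivFinOfCardEq ?_⟩
    rw [Nat.card_prod, Nat.card_zmod, Nat.card_zmod]
  -- The six affine groups are transported along an arbitrary bijection to `Fin (p * q)`.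
  obtain ⟨P, hP⟩ : ∃ P : Fin 6 → Subgroup (Equiv.Perm (Fin (p * q))), ∀ i,
      PermGroupIso (affGroup (sixSub α i)) (ZMod p × ZMod q) (P i) (Fin (p * q)) :=
    ⟨fun i => (affGroup (sixSub α i)).map e.permCongrHom.toMonoidHom, fun i =>
      permGroupIso_of_forall_mem e fun π =>
        ⟨fun ⟨g, hg, h⟩ => ⟨⟨g, hg⟩, h⟩, fun ⟨g, h⟩ => ⟨g.1, g.2, h⟩⟩⟩
  choose f hf using hP
  have hP : ∀ i, PermGroupIso (affGroup (sixSub α i)) (ZMod p × ZMod q) (P i) (Fin (p * q)) :=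
    fun i => ⟨f i, hf i⟩
  refine ⟨P, fun i => (hP i).isPretransitive, ?_, ?_, ?_, ?_, ?_, ?_, ?_, ?_, ?_⟩
  · rintro i j ⟨g, -⟩
    exact eq_of_affGroup_sixSub_mulEquiv hpq hq2 hα (((f i).trans g).trans (f j).symm)
  · exact (nonempty_affGroup_rootSub_mulEquiv (2 * q)).map (f 0).symm.trans
  · exact (nonempty_affGroup_rootSub_mulEquiv q).map (f 1).symm.trans
  · exact (nonempty_affGroup_graph_mulEquiv hα (units_pow_succ_pow hpq hq2)).map (f 2).symm.trans
  · exact (nonempty_affGroup_rootSub_two_mulEquiv hp2).map (f 3).symm.trans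
  · exact (nonempty_affGroup_graph_mulEquiv hα (units_pow_succ_pow hpq hq2)).map (f 4).symm.trans
  · exact (nonempty_affGroup_rootSub_one_mulEquiv hpq').map (f 5).symm.trans
  · intro G X _ _ _ _ hX
    constructor
    · rintro ⟨⟨K, L, _, _, _, _, _, hr, hS⟩, ⟨K', L', _, _, _, _, _, hr', hS'⟩⟩
      obtain ⟨N, hN, hc⟩ := hr.exists_isOfCyclicType_iff.1 hS
      obtain ⟨N', hN', hne⟩ := hr'.exists_isOfNonabelianType_iff.1 hS'
      obtain ⟨i, hi⟩ := exists_permGroupIso_affGroup hpq hq2 hα hX hN hc hN' hne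
      exact ⟨i, hi.trans (hP i)⟩
    · rintro ⟨i, hi⟩
      exact isRealised_of_permGroupIso hpq' hα (hP i) hi
  · intro i K L _ _ _ _ _ hr
    have hr' := Realises.of_permGroupIso (hP i) hr
    rw [hr'.numCyclicType_eq, hr'.numNonabelianType_eq, toPermHom_subgroup]
    exact ⟨ncard_cyclic_sixSub hpq hq2 hα i, ncard_nonabelian_sixSub hpq hq2 hα i,
      hr'.isAlmostClassicallyGalois_sixSub⟩
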